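/- Let $q\in(0,1)$ and let $k,l\ge 1$ be coprime integers. Let $\mathcal O(S_q^3)$ be the universal unital $*$-algebra with generators $z_0,z_1$ and relations $z_0z_1=qz_1z_0$, $z_0z_1^*=qz_1^*z_0$, $z_1z_0^*=qz_0^*z_1$, $z_0z_0^*=z_0^*z_0+(q^{-2}-1)z_1z_1^*$, $z_1z_1^*=z_1^*z_1$, $z_0z_0^*+z_1z_1^*=1$. Let $\mathcal O(W_q(k,l))$ be the fixed point algebra of the circle action $z_0\mapsto w^kz_0$, $z_1\mapsto w^lz_1$ ($|w|=1$) and $C(W_q(k,l))$ its universal enveloping $C^*$-algebra; put $a=z_0^l(z_1^*)^k$, $b=z_1z_1^*$. For $1\le s\le l$ let $\pi_s$ be the unital $*$-representation of $\mathcal O(W_q(k,l))$, and hence of $C(W_q(k,l))$, on $l^2(\mathbb N_0)$ with orthonormal basis $(e_p)_{p\ge0}$, given by \[ \pi_s(b)e_p=q^{2s}q^{2lp}e_p,\qquad \pi_s(a)e_0=0,\qquad \pi_s(a)e_p=q^{k(lp+s)}\prod_{m=1}^l\bigl(1-q^{2(lp+s-m)}\bigr)^{1/2}e_{p-1}\quad(p\ge1),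 \] and let $\varepsilon$ be the character of $\mathcal O(W_q(k,l))$, and hence of $C(W_q(k,l))$, with $\varepsilon(a)=\varepsilon(b)=0$ (the restriction of $z_0\mapsto1$, $z_1\mapsto0$). For $1\le r\le l$ let $p_r\in C(W_q(k,l))$ be the orthogonal projection such that $\pi_s(p_r)=\delta_{sr}e_{00}$ for all $s\in\{1,\dots,l\}$, where $e_{00}$ is the orthogonal projection onto $\mathbb Ce_0$; let $p_0=1$. With the polynomials $f(X)=\bigl(1-\prod_{m=1}^l(1-q^{-2m}X)\bigr)/X$ and $g(X)=\bigl(1-(1-X)^k\bigr)/X$ put $\xi_1=f(z_1z_1^*)^{k/2}$ and $\xi_0=g(z_0^l(z_0^*)^l)^{1/2}$ in $C(W_q(k,l))$, and for $x\in\mathcal O(W_q(k,l))$ let \[ \Psi x\Psi^*=\begin{pmatrix}\xi_1z_1^kx(z_1^*)^k\xi_1&\xi_1z_1^kx(z_0^*)^l\xi_0\\ \xi_0z_0^lx(z_1^*)^k\xi_1&\xi_0z_0^lx(z_0^*)^l\xi_0\end{pmatrix}\in M_2(C(W_q(k,l))). \] Let $H=l^2(\mathbb N_0)\otimes\mathbb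 C^2$ and let $H_\pm$ be two copies of $H$. For $1\le s\le l$ the formula \[ \rho_s(x)=\begin{pmatrix}\pi_s(\Psi x\Psi^*)&0\\0&\varepsilon(\Psi x\Psi^*)\end{pmatrix} \] ($\pi_s$ and $\varepsilon$ applied entrywise) defines a $*$-homomorphism on $\mathcal O(W_q(k,l))$ into the bounded operators on $H_+\oplus H_-$, which extends uniquely to a $*$-homomorphism on $C(W_q(k,l))$. For $s=0$ let $\rho_0=\begin{pmatrix}\varepsilon&0\\0&0\end{pmatrix}$ on $\mathbb C_+\oplus\mathbb C_-$. In all cases let $F=\begin{pmatrix}0&1\\1&0\end{pmatrix}$ and $\gamma=\begin{pmatrix}1&0\\0&-1\end{pmatrix}$. Then for every $s\in\{0,\dots,l\}$ the datum $\mathcal F_s$ consisting of the Hilbert space, $\rho_s$, $F$ and $\gamma$ is an even Fredholm module which is $1$-summable over $\mathcal O(W_q(k,l))$, and for all $r,s\in\{0,\dots,l\}$ the operator $\gamma F[F,\rho_s(p_r)]$ is trace class and \[ \langle[\mathcal F_s],[p_r]\rangle:=\tfrac12\operatorname{Tr}\bigl(\gamma F[F,\rho_s(p_r)]\bigr)=\begin{cases}1&\text{if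 }s=r,\\1&\text{if }r=0,\\0&\text{otherwise.}\end{cases} \] -/

import Mathlib

open scoped ENNReal InnerProductSpace

noncomputable section

namespace QuantumWPL

/-! ### Universal unital `*`-algebras given by generators and relations -/

/-- The free unital complex algebra on `X ∪ X*`: the letter `(x, false)` stands for `x` and the
letter `(x, true)` for `x*`. -/
abbrev Free (X : Type) : Type := FreeAlgebra ℂ (X × Bool)

/-- The conjugate linear anti-automorphism of the free algebra exchanging `x` and `x*`. -/
def freeStar (X : Type) : Free X →+* (Free X)ᵐᵒᵖ :=
  letI : Algebra ℂ (Free X)ᵐᵒᵖ := Algebra.compHom _ (starRingEnd ℂ)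
  (FreeAlgebra.lift ℂ fun p : X × Bool =>
    MulOpposite.op (FreeAlgebra.ι ℂ (p.1, !p.2))).toRingHom

theorem freeStar_ι {X : Type} (p : X × Bool) :
    freeStar X (FreeAlgebra.ι ℂ p) = MulOpposite.op (FreeAlgebra.ι ℂ (p.1, !p.2)) := by
  let _ : Algebra ℂ (Free X)ᵐᵒᵖ := Algebra.compHom _ (starRingEnd ℂ)
  exact FreeAlgebra.lift_ι_apply _ _

theorem freeStar_algebraMap {X : Type} (c : ℂ) :
    freeStar X (algebraMap ℂ (Free X) c) =
      MulOpposite.op (algebraMap ℂ (Free X) (starRingEnd ℂ c)) := by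
  let _ : Algebra ℂ (Free X)ᵐᵒᵖ := Algebra.compHom _ (starRingEnd ℂ)
  exact (FreeAlgebra.lift ℂ fun p : X × Bool =>
    MulOpposite.op (FreeAlgebra.ι ℂ (p.1, !p.2))).commutes c

/-- The given relations together with their adjoints. -/
inductive StarRel {X : Type} (R : Free X → Free X → Prop) : Free X → Free X → Prop
  | of {x y : Free X} : R x y → StarRel R x y
  | adj {x y : Free X} : R x y → StarRel R (freeStar X x).unop (freeStar X y).unop

/-- The universal unital `*`-algebra over `ℂ` with generators `X` and relations `R`. -/
def UnivStarAlg (X : Type) (R : Free X → Free X → Prop) : Type := RingQuot (StarRel R)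

namespace UnivStarAlg

variable {X : Type} {R : Free X → Free X → Prop}

instance : Ring (UnivStarAlg X R) := inferInstanceAs (Ring (RingQuot (StarRel R)))

instance : Algebra ℂ (UnivStarAlg X R) := inferInstanceAs (Algebra ℂ (RingQuot (StarRel R)))

/-- The quotient map from the free algebra. -/
def mk (X : Type) (R : Free X → Free X → Prop) : Free X →ₐ[ℂ] UnivStarAlg X R :=
  RingQuot.mkAlgHom ℂ (StarRel R)

theorem mk_surjective : Function.Surjective (mk X R) := RingQuot.mkAlgHom_surjective ℂ _

theorem mk_rel {x y : Free X} (h : StarRel R x y) : mk X R x = mk X R y :=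
  RingQuot.mkAlgHom_rel ℂ h

theorem freeStar_freeStar (x : Free X) : (freeStar X (freeStar X x).unop).unop = x := by
  induction x using FreeAlgebra.induction with
  | grade0 c => simp [freeStar_algebraMap]
  | grade1 p => simp [freeStar_ι]
  | mul a b ha hb => simp [ha, hb]
  | add a b ha hb => simp [ha, hb]

/-- The adjoint, as a map on the quotient. -/
def starHom : UnivStarAlg X R →+* (UnivStarAlg X R)ᵐᵒᵖ :=
  RingQuot.lift ⟨(RingHom.op (mk X R).toRingHom).comp (freeStar X), by
    intro x y h
    refine MulOpposite.unop_injective ?_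
    change mk X R (freeStar X x).unop = mk X R (freeStar X y).unop
    cases h with
    | of h => exact mk_rel (.adj h)
    | adj h => rw [freeStar_freeStar, freeStar_freeStar]; exact mk_rel (.of h)⟩

theorem starHom_mk (x : Free X) :
    starHom (mk X R x) = MulOpposite.op (mk X R (freeStar X x).unop) := by
  have h : mk X R x = RingQuot.mkRingHom (StarRel R) x := by
    rw [← RingQuot.mkAlgHom_coe ℂ (StarRel R)]; rfl
  rw [h]
  exact RingQuot.lift_mkRingHom_apply _ _ x

instance : StarRing (UnivStarAlg X R) where
  star x := (starHom x).unop
  star_involutive x := by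
    obtain ⟨x, rfl⟩ := mk_surjective x
    simp [starHom_mk, freeStar_freeStar]
  star_mul x y := by simp
  star_add x y := by simp

theorem star_mk (x : Free X) : star (mk X R x) = mk X R (freeStar X x).unop :=
  congrArg MulOpposite.unop (starHom_mk x)

instance : StarModule ℂ (UnivStarAlg X R) where
  star_smul c x := by
    obtain ⟨x, rfl⟩ := mk_surjective x
    rw [← map_smul, star_mk, star_mk, Algebra.smul_def, map_mul, freeStar_algebraMap]
    simp [Algebra.smul_def, Algebra.commutes]

/-- The generator of the universal `*`-algebra belonging to `x`. -/
def gen (R : Free X → Free X → Prop) (x : X) : UnivStarAlg X R :=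
  mk X R (FreeAlgebra.ι ℂ (x, false))

theorem star_gen (x : X) : star (gen R x) = mk X R (FreeAlgebra.ι ℂ (x, true)) := by
  simp [gen, star_mk, freeStar_ι]

section lift

variable {B : Type*} [Ring B] [StarRing B] [Algebra ℂ B] [StarModule ℂ B]

/-- Evaluation of a free polynomial at elements of a `*`-algebra. -/
def eval (f : X → B) : Free X →ₐ[ℂ] B :=
  FreeAlgebra.lift ℂ fun p : X × Bool => if p.2 then star (f p.1) else f p.1

theorem eval_freeStar (f : X → B) (x : Free X) :
    eval f (freeStar X x).unop = star (eval f x) := by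
  induction x using FreeAlgebra.induction with
  | grade0 c => simp [freeStar_algebraMap, ← algebraMap_star_comm]
  | grade1 p => rcases p with ⟨x, _ | _⟩ <;> simp [freeStar_ι, eval]
  | mul a b ha hb => simp [ha, hb]
  | add a b ha hb => simp [ha, hb]

/-- The universal property. -/
def lift (f : X → B) (hf : ∀ x y, R x y → eval f x = eval f y) : UnivStarAlg X R →⋆ₐ[ℂ] B :=
  { RingQuot.liftAlgHom ℂ (s := StarRel R) ⟨eval f, by
      intro x y h
      cases h with
      | of h => exact hf _ _ h
      | adj h => rw [eval_freeStar, eval_freeStar, hf _ _ h]⟩ with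
    map_star' := by
      intro x
      obtain ⟨x, rfl⟩ := mk_surjective x
      rw [star_mk]
      change RingQuot.liftAlgHom ℂ (s := StarRel R) _ (RingQuot.mkAlgHom ℂ _ _) =
        star (RingQuot.liftAlgHom ℂ (s := StarRel R) _ (RingQuot.mkAlgHom ℂ _ _))
      rw [RingQuot.liftAlgHom_mkAlgHom_apply, RingQuot.liftAlgHom_mkAlgHom_apply, eval_freeStar] }

theorem lift_gen (f : X → B) (hf : ∀ x y, R x y → eval f x = eval f y) (x : X) :
    lift f hf (gen R x) = f x := by
  change RingQuot.liftAlgHom ℂ (s := StarRel R) _ (RingQuot.mkAlgHom ℂ _ _) = _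
  rw [RingQuot.liftAlgHom_mkAlgHom_apply]
  simp [eval]

end lift

end UnivStarAlg

/-! ### The quantum 3-sphere and the quantum weighted projective lines -/

/-- The letter `z_i` of the free algebra. -/
abbrev fz (i : Fin 2) : Free (Fin 2) := FreeAlgebra.ι ℂ (i, false)

/-- The letter `z_i*` of the free algebra. -/
abbrev fzs (i : Fin 2) : Free (Fin 2) := FreeAlgebra.ι ℂ (i, true)

/-- The defining relations of the quantum 3-sphere. -/
inductive SphereRel (q : ℝ) : Free (Fin 2) → Free (Fin 2) → Prop
  | z0_z1 : SphereRel q (fz 0 * fz 1) ((q : ℂ) • (fz 1 * fz 0))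
  | z0_z1s : SphereRel q (fz 0 * fzs 1) ((q : ℂ) • (fzs 1 * fz 0))
  | z1_z0s : SphereRel q (fz 1 * fzs 0) ((q : ℂ) • (fzs 0 * fz 1))
  | z0_z0s : SphereRel q (fz 0 * fzs 0)
      (fzs 0 * fz 0 + (((q : ℂ) ^ 2)⁻¹ - 1) • (fz 1 * fzs 1))
  | z1_z1s : SphereRel q (fz 1 * fzs 1) (fzs 1 * fz 1)
  | sphere : SphereRel q (fz 0 * fzs 0 + fz 1 * fzs 1) 1

/-- The coordinate algebra of the quantum 3-sphere. -/
abbrev OSphere (q : ℝ) : Type := UnivStarAlg (Fin 2) (SphereRel q)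

/-- The generator `z₀`. -/
def z₀ (q : ℝ) : OSphere q := UnivStarAlg.gen (SphereRel q) 0

/-- The generator `z₁`. -/
def z₁ (q : ℝ) : OSphere q := UnivStarAlg.gen (SphereRel q) 1

theorem mk_fz_zero (q : ℝ) : UnivStarAlg.mk _ (SphereRel q) (fz 0) = z₀ q := rfl

theorem mk_fz_one (q : ℝ) : UnivStarAlg.mk _ (SphereRel q) (fz 1) = z₁ q := rfl

theorem mk_fzs_zero (q : ℝ) : UnivStarAlg.mk _ (SphereRel q) (fzs 0) = star (z₀ q) :=
  (UnivStarAlg.star_gen 0).symm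

theorem mk_fzs_one (q : ℝ) : UnivStarAlg.mk _ (SphereRel q) (fzs 1) = star (z₁ q) :=
  (UnivStarAlg.star_gen 1).symm

theorem z0_z1 (q : ℝ) : z₀ q * z₁ q = (q : ℂ) • (z₁ q * z₀ q) := by
  simpa only [map_mul, map_smul, mk_fz_zero, mk_fz_one] using
    UnivStarAlg.mk_rel (.of (SphereRel.z0_z1 (q := q)))

theorem z0_z1s (q : ℝ) : z₀ q * star (z₁ q) = (q : ℂ) • (star (z₁ q) * z₀ q) := by
  simpa only [map_mul, map_smul, mk_fz_zero, mk_fzs_one] using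
    UnivStarAlg.mk_rel (.of (SphereRel.z0_z1s (q := q)))

theorem z1_z0s (q : ℝ) : z₁ q * star (z₀ q) = (q : ℂ) • (star (z₀ q) * z₁ q) := by
  simpa only [map_mul, map_smul, mk_fz_one, mk_fzs_zero] using
    UnivStarAlg.mk_rel (.of (SphereRel.z1_z0s (q := q)))

theorem z0_z0s (q : ℝ) : z₀ q * star (z₀ q) =
    star (z₀ q) * z₀ q + (((q : ℂ) ^ 2)⁻¹ - 1) • (z₁ q * star (z₁ q)) := by
  simpa only [map_mul, map_add, map_smul, mk_fz_zero, mk_fz_one, mk_fzs_zero, mk_fzs_one] using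
    UnivStarAlg.mk_rel (.of (SphereRel.z0_z0s (q := q)))

theorem z1_z1s (q : ℝ) : z₁ q * star (z₁ q) = star (z₁ q) * z₁ q := by
  simpa only [map_mul, mk_fz_one, mk_fzs_one] using
    UnivStarAlg.mk_rel (.of (SphereRel.z1_z1s (q := q)))

theorem sphere_eq (q : ℝ) : z₀ q * star (z₀ q) + z₁ q * star (z₁ q) = 1 := by
  simpa only [map_mul, map_add, map_one, mk_fz_zero, mk_fz_one, mk_fzs_zero, mk_fzs_one] using
    UnivStarAlg.mk_rel (.of (SphereRel.sphere (q := q)))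

/-- The universal property of the coordinate algebra of the quantum 3-sphere. -/
def OSphere.lift (q : ℝ) {B : Type*} [Ring B] [StarRing B] [Algebra ℂ B] [StarModule ℂ B]
    (x y : B) (h1 : x * y = (q : ℂ) • (y * x)) (h2 : x * star y = (q : ℂ) • (star y * x))
    (h3 : y * star x = (q : ℂ) • (star x * y))
    (h4 : x * star x = star x * x + (((q : ℂ) ^ 2)⁻¹ - 1) • (y * star y))
    (h5 : y * star y = star y * y) (h6 : x * star x + y * star y = 1) :
    OSphere q →⋆ₐ[ℂ] B :=
  UnivStarAlg.lift ![x, y] (by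
    intro a b h
    have e0 : UnivStarAlg.eval ![x, y] (fz 0) = x := by simp [UnivStarAlg.eval]
    have e1 : UnivStarAlg.eval ![x, y] (fz 1) = y := by simp [UnivStarAlg.eval]
    have e2 : UnivStarAlg.eval ![x, y] (fzs 0) = star x := by simp [UnivStarAlg.eval]
    have e3 : UnivStarAlg.eval ![x, y] (fzs 1) = star y := by simp [UnivStarAlg.eval]
    cases h <;> simp only [map_mul, map_add, map_smul, map_one, e0, e1, e2, e3] <;> assumption)

/-- The weighted circle action `z₀ ↦ w ^ k z₀`, `z₁ ↦ w ^ l z₁`. -/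
def circleAction (q : ℝ) (k l : ℕ) (w : Circle) : OSphere q →⋆ₐ[ℂ] OSphere q :=
  have hw : (w : ℂ) * (starRingEnd ℂ) (w : ℂ) = 1 := by
    rw [Complex.mul_conj]; simp
  have hw' (n : ℕ) : (w : ℂ) ^ n * (starRingEnd ℂ) (w : ℂ) ^ n = 1 := by
    rw [← mul_pow, hw, one_pow]
  have hw'' (n : ℕ) : (starRingEnd ℂ) (w : ℂ) ^ n * (w : ℂ) ^ n = 1 := by
    rw [mul_comm, hw']
  OSphere.lift q ((w : ℂ) ^ k • z₀ q) ((w : ℂ) ^ l • z₁ q)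
    (by simp only [smul_mul_smul_comm, z0_z1, smul_smul]; ring_nf)
    (by simp only [star_smul, smul_mul_smul_comm, z0_z1s, smul_smul]; ring_nf)
    (by simp only [star_smul, smul_mul_smul_comm, z1_z0s, smul_smul]; ring_nf)
    (by simp only [star_smul, star_pow, Complex.star_def, smul_mul_smul_comm, hw', hw'',
          one_smul, z0_z0s])
    (by simp only [star_smul, star_pow, Complex.star_def, smul_mul_smul_comm, hw', hw'',
          one_smul, z1_z1s])
    (by simp only [star_smul, star_pow, Complex.star_def, smul_mul_smul_comm, hw',
          one_smul, sphere_eq])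

theorem circleAction_z0 (q : ℝ) (k l : ℕ) (w : Circle) :
    circleAction q k l w (z₀ q) = (w : ℂ) ^ k • z₀ q := by
  unfold circleAction
  exact UnivStarAlg.lift_gen _ _ 0

theorem circleAction_z1 (q : ℝ) (k l : ℕ) (w : Circle) :
    circleAction q k l w (z₁ q) = (w : ℂ) ^ l • z₁ q := by
  unfold circleAction
  exact UnivStarAlg.lift_gen _ _ 1

/-- The coordinate algebra `O(W_q(k,l))`: the fixed points of the weighted circle action. -/
def OW (q : ℝ) (k l : ℕ) : StarSubalgebra ℂ (OSphere q) where
  carrier := {x | ∀ w : Circle, circleAction q k l w x = x}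
  mul_mem' hx hy w := by rw [map_mul, hx w, hy w]
  add_mem' hx hy w := by rw [map_add, hx w, hy w]
  algebraMap_mem' c w := AlgHomClass.commutes _ c
  star_mem' hx w := by rw [map_star, hx w]

/-- The elements `y₀ = z₁ ^ k` and `y₁ = z₀ ^ l` of the quantum sphere. -/
def lineElt (q : ℝ) (k l : ℕ) : Fin 2 → OSphere q := ![z₁ q ^ k, z₀ q ^ l]

theorem circleAction_lineElt (q : ℝ) (k l : ℕ) (w : Circle) (i : Fin 2) :
    circleAction q k l w (lineElt q k l i) = (w : ℂ) ^ (k * l) • lineElt q k l i := by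
  fin_cases i
  · simp [lineElt, circleAction_z1, smul_pow, ← pow_mul, mul_comm]
  · simp [lineElt, circleAction_z0, smul_pow, ← pow_mul]

/-- For `x ∈ O(W_q(k,l))` the element `y_i x y_j*` of `O(W_q(k,l))`. -/
def sandwich (q : ℝ) (k l : ℕ) (i j : Fin 2) (x : OW q k l) : OW q k l :=
  ⟨lineElt q k l i * (x : OSphere q) * star (lineElt q k l j), fun w => by
    have hw : (w : ℂ) * (starRingEnd ℂ) (w : ℂ) = 1 := by
      rw [Complex.mul_conj]; simp
    rw [map_mul, map_mul, map_star, circleAction_lineElt, circleAction_lineElt, x.2 w, star_smul,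
      smul_mul_assoc, smul_mul_smul_comm, star_pow, ← mul_pow, Complex.star_def, hw, one_pow,
      one_smul]⟩

/-- The element `a = z₀ ^ l (z₁*) ^ k`. -/
def aElt (q : ℝ) (k l : ℕ) : OW q k l :=
  ⟨z₀ q ^ l * star (z₁ q) ^ k, by
    simpa [sandwich, lineElt] using (sandwich q k l 1 0 1).2⟩

/-- The element `b = z₁ z₁*`. -/
def bElt (q : ℝ) (k l : ℕ) : OW q k l :=
  ⟨z₁ q * star (z₁ q), fun w => by
    have hw : (w : ℂ) * (starRingEnd ℂ) (w : ℂ) = 1 := by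
      rw [Complex.mul_conj]; simp
    rw [map_mul, map_star, circleAction_z1, star_smul, smul_mul_smul_comm, star_pow, ← mul_pow,
      Complex.star_def, hw, one_pow, one_smul]⟩

/-- The element `z₀ ^ l (z₀*) ^ l`. -/
def cElt (q : ℝ) (k l : ℕ) : OW q k l :=
  ⟨z₀ q ^ l * star (z₀ q) ^ l, by
    simpa [sandwich, lineElt] using (sandwich q k l 1 1 1).2⟩

/-- The restriction to `O(W_q(k,l))` of the counit `z₀ ↦ 1`, `z₁ ↦ 0` of quantum `SU(2)`. -/
def counit (q : ℝ) (k l : ℕ) : OW q k l →⋆ₐ[ℂ] ℂ :=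
  (OSphere.lift q (1 : ℂ) 0 (by simp) (by simp) (by simp) (by simp) (by simp) (by simp)).comp
    (OW q k l).subtype

/-! ### Enveloping C⋆-algebras -/

/-- A unital `*`-representation of `A` by bounded operators on a nonzero complex Hilbert space. -/
structure StarRep (A : Type) [Ring A] [StarRing A] [Algebra ℂ A] : Type 1 where
  H : Type
  [normed : NormedAddCommGroup H]
  [inner : InnerProductSpace ℂ H]
  [complete : CompleteSpace H]
  [nontriv : Nontrivial H]
  toHom : A →⋆ₐ[ℂ] (H →L[ℂ] H)

attribute [instance] StarRep.normed StarRep.inner StarRep.complete StarRep.nontriv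

section envelope

variable (A : Type) [Ring A] [StarRing A] [Algebra ℂ A]

/-- The C⋆-algebra of bounded families of operators indexed by the representations of `A`. -/
abbrev RepProd : Type 1 := lp (fun π : StarRep A => π.H →L[ℂ] π.H) ∞

instance : CStarAlgebra (RepProd A) where

/-- The bounded families of the form `π ↦ π a`, with `a ∈ A`. -/
def repImage : StarSubalgebra ℂ (RepProd A) where
  carrier := {f | ∃ a : A, ∀ π : StarRep A, f π = π.toHom a}
  mul_mem' := by
    rintro f g ⟨a, ha⟩ ⟨b, hb⟩
    exact ⟨a * b, fun π => by rw [lp.infty_coeFn_mul, Pi.mul_apply, ha, hb, map_mul]⟩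
  add_mem' := by
    rintro f g ⟨a, ha⟩ ⟨b, hb⟩
    exact ⟨a + b, fun π => by rw [lp.coeFn_add, Pi.add_apply, ha, hb, map_add]⟩
  algebraMap_mem' c := ⟨algebraMap ℂ A c, fun π => by rw [AlgHomClass.commutes]; rfl⟩
  star_mem' := by
    rintro f ⟨a, ha⟩
    exact ⟨star a, fun π => by rw [lp.star_apply, ha, map_star]⟩

/-- The enveloping C⋆-algebra: the closure of `A` in its universal representation. When every
`a ∈ A` is bounded (`IsBoundedElt`), it is the separated completion of `A` with respect to the
C⋆-seminorm `a ↦ sup_π ‖π a‖`. -/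
def CStarEnv : Type 1 := (repImage A).topologicalClosure

instance : CStarAlgebra (CStarEnv A) :=
  haveI : IsClosed ((repImage A).topologicalClosure : Set (RepProd A)) := isClosed_closure
  inferInstanceAs (CStarAlgebra (repImage A).topologicalClosure)

variable {A}

/-- The norms of `a` in all representations have a common bound. -/
def IsBoundedElt (a : A) : Prop := BddAbove (Set.range fun π : StarRep A => ‖π.toHom a‖)

open Classical in
/-- The canonical map of `A` into its enveloping C⋆-algebra (with value `0` at elements which are
not bounded). -/
def toEnv (a : A) : CStarEnv A :=
  if h : IsBoundedElt a then
    ⟨⟨fun π => π.toHom a, memℓp_infty h⟩, subset_closure ⟨a, fun _ => rfl⟩⟩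
  else 0

/-- The extension of a representation of `A` to the enveloping C⋆-algebra. -/
def extend {H : Type} [NormedAddCommGroup H] [InnerProductSpace ℂ H] [CompleteSpace H]
    [Nontrivial H] (π : A →⋆ₐ[ℂ] (H →L[ℂ] H)) : CStarEnv A →⋆ₐ[ℂ] (H →L[ℂ] H) where
  toFun f := f.1 (⟨H, π⟩ : StarRep A)
  map_one' := rfl
  map_mul' _ _ := rfl
  map_zero' := rfl
  map_add' _ _ := rfl
  commutes' _ := rfl
  map_star' _ := rfl

theorem extend_toEnv {H : Type} [NormedAddCommGroup H] [InnerProductSpace ℂ H] [CompleteSpace H]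
    [Nontrivial H] (π : A →⋆ₐ[ℂ] (H →L[ℂ] H)) {a : A} (ha : IsBoundedElt a) :
    extend π (toEnv a) = π a := by
  have h : toEnv a = (⟨⟨fun π => π.toHom a, memℓp_infty ha⟩, subset_closure ⟨a, fun _ => rfl⟩⟩ :
      (repImage A).topologicalClosure) := dif_pos ha
  rw [h]; rfl

/-- The representation of `A` by scalar operators given by a character. -/
def scalarRep (χ : A →⋆ₐ[ℂ] ℂ) (H : Type) [NormedAddCommGroup H] [InnerProductSpace ℂ H]
    [CompleteSpace H] : A →⋆ₐ[ℂ] (H →L[ℂ] H) where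
  toFun a := χ a • (1 : H →L[ℂ] H)
  map_one' := by simp
  map_mul' a b := by simp [smul_smul, mul_comm]
  map_zero' := by simp
  map_add' a b := by simp [add_smul]
  commutes' c := by rw [AlgHomClass.commutes]; exact (Algebra.algebraMap_eq_smul_one c).symm
  map_star' a := by rw [map_star, star_smul, star_one]

end envelope

/-! ### Operators on Hilbert spaces -/

section operators

variable {H : Type} [NormedAddCommGroup H] [InnerProductSpace ℂ H] [CompleteSpace H]

/-- `T` is trace class: the diagonal of `|T| = (T* T) ^ (1/2)` with respect to any
orthonormal basis is summable. -/
def IsTraceClass (T : H →L[ℂ] H) : Prop :=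
  ∀ (ι : Type) (e : HilbertBasis ι ℂ H),
    Summable fun i => ⟪e i, cfc Real.sqrt (star T * T) (e i)⟫_ℂ

/-- The trace of a trace class operator, as the sum of the diagonal entries with respect to an
orthonormal basis. -/
def opTrace (T : H →L[ℂ] H) : ℂ :=
  let e := (exists_hilbertBasis ℂ H).choose_spec.choose
  ∑' i, ⟪e i, T (e i)⟫_ℂ

variable {E : Type} [NormedAddCommGroup E] [InnerProductSpace ℂ E]

/-- The Hilbert space direct sum `E ⊕ E = E ⊗ ℂ²`. -/
abbrev Two (E : Type) [NormedAddCommGroup E] : Type := PiLp 2 fun _ : Fin 2 => E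

/-- The operator on `E ⊕ E` given by a `2 × 2` matrix of operators on `E`. -/
def blockOp (M : Matrix (Fin 2) (Fin 2) (E →L[ℂ] E)) : Two E →L[ℂ] Two E :=
  (PiLp.continuousLinearEquiv 2 ℂ fun _ : Fin 2 => E).symm.toContinuousLinearMap ∘L
    ContinuousLinearMap.pi fun i =>
      ∑ j, M i j ∘L (PiLp.proj 2 (fun _ : Fin 2 => E) j : Two E →L[ℂ] E)

theorem blockOp_apply (M : Matrix (Fin 2) (Fin 2) (E →L[ℂ] E)) (v : Two E) (i : Fin 2) :
    blockOp M v i = ∑ j, M i j (v j) := by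
  simp [blockOp]

/-- The corner embedding `T ↦ T ⊕ 0`. -/
def cornerHom (E : Type) [NormedAddCommGroup E] [InnerProductSpace ℂ E] [CompleteSpace E] :
    (E →L[ℂ] E) →⋆ₙₐ[ℂ] (Two E →L[ℂ] Two E) where
  toFun T := blockOp !![T, 0; 0, 0]
  map_zero' := by ext v i; fin_cases i <;> simp [blockOp_apply]
  map_add' S T := by ext v i; fin_cases i <;> simp [blockOp_apply]
  map_mul' S T := by ext v i; fin_cases i <;> simp [blockOp_apply]
  map_smul' c T := by ext v i; fin_cases i <;> simp [blockOp_apply]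
  map_star' T := by
    refine (ContinuousLinearMap.eq_adjoint_iff _ _).2 fun x y => ?_
    simp [PiLp.inner_apply, blockOp_apply, ContinuousLinearMap.star_eq_adjoint,
      ContinuousLinearMap.adjoint_inner_left]

/-- The operator `F` on `E₊ ⊕ E₋`. -/
def flipOp (E : Type) [NormedAddCommGroup E] [InnerProductSpace ℂ E] [CompleteSpace E] :
    Two E →L[ℂ] Two E := blockOp !![0, 1; 1, 0]

/-- The grading `γ` on `E₊ ⊕ E₋`. -/
def gradingOp (E : Type) [NormedAddCommGroup E] [InnerProductSpace ℂ E] [CompleteSpace E] :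
    Two E →L[ℂ] Two E := blockOp !![1, 0; 0, -1]

end operators

/-! ### Fredholm modules and index pairings -/

/-- The data of a (candidate) even Fredholm module: a Hilbert space `H`, a `*`-representation `ρ`
on it, not necessarily unital, and operators `F` and `γ`. -/
structure FredholmDatum (B : Type 1) [NonUnitalRing B] [StarRing B] [Module ℂ B] : Type 1 where
  H : Type
  [normed : NormedAddCommGroup H]
  [inner : InnerProductSpace ℂ H]
  [complete : CompleteSpace H]
  ρ : B →⋆ₙₐ[ℂ] (H →L[ℂ] H)
  F : H →L[ℂ] H
  γ : H →L[ℂ] H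

attribute [instance] FredholmDatum.normed FredholmDatum.inner FredholmDatum.complete

namespace FredholmDatum

variable {B : Type 1} [NonUnitalRing B] [StarRing B] [Module ℂ B] (D : FredholmDatum B)

/-- The commutator `[F, ρ b]`. -/
def comm (b : B) : D.H →L[ℂ] D.H := D.F * D.ρ b - D.ρ b * D.F

/-- The axioms of an even Fredholm module. -/
structure IsEvenFredholm : Prop where
  F_selfAdjoint : star D.F = D.F
  F_sq : D.F * D.F = 1
  γ_selfAdjoint : star D.γ = D.γ
  γ_sq : D.γ * D.γ = 1
  γ_comm : ∀ b, D.γ * D.ρ b = D.ρ b * D.γ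
  anticomm : D.γ * D.F + D.F * D.γ = 0
  compact : ∀ b, IsCompactOperator (D.comm b)

/-- The operator `γ F [F, ρ p]`. -/
def pairingOp (p : B) : D.H →L[ℂ] D.H := D.γ * D.F * D.comm p

/-- The index pairing `½ Tr (γ F [F, ρ p])`. -/
def indexPairing (p : B) : ℂ := (1 / 2) * opTrace (D.pairingOp p)

end FredholmDatum

/-! ### The representations, the projections and the Fredholm modules -/

/-- The Hilbert space of square summable sequences. -/
abbrev Ell2 : Type := lp (fun _ : ℕ => ℂ) 2

instance : Nontrivial Ell2 :=
  ⟨⟨lp.single 2 0 (1 : ℂ), 0, fun h => by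
    simpa using congrArg (fun v : Ell2 => v 0) h⟩⟩

/-- The standard orthonormal basis of the space of square summable sequences. -/
def e (p : ℕ) : Ell2 := lp.single 2 p (1 : ℂ)

/-- The orthogonal projection onto `ℂ e₀`. -/
def e₀₀ : Ell2 →L[ℂ] Ell2 := (Submodule.span ℂ {e 0}).starProjection

/-- The C⋆-algebra `C(W_q(k,l))`. -/
abbrev CW (q : ℝ) (k l : ℕ) : Type 1 := CStarEnv (OW q k l)

/-- `π` is the representation `π_s`, which is determined by its values on `a` and `b`. -/
structure IsPi (q : ℝ) (k l s : ℕ) (π : OW q k l →⋆ₐ[ℂ] (Ell2 →L[ℂ] Ell2)) : Prop where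
  map_b : ∀ p, π (bElt q k l) (e p) = ((q ^ (2 * s) * q ^ (2 * l * p) : ℝ) : ℂ) • e p
  map_a_zero : π (aElt q k l) (e 0) = 0
  map_a_succ : ∀ p, π (aElt q k l) (e (p + 1)) =
    ((q ^ (k * (l * (p + 1) + s)) *
      ∏ m ∈ Finset.Icc 1 l, √(1 - q ^ (2 * (l * (p + 1) + s - m))) : ℝ) : ℂ) • e p

/-- `p` is the orthogonal projection `p_r` of `C(W_q(k,l))`, where `1 ≤ r ≤ l`. -/
structure IsProj (q : ℝ) (k l : ℕ) (π : ℕ → OW q k l →⋆ₐ[ℂ] (Ell2 →L[ℂ] Ell2)) (r : ℕ)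
    (p : CW q k l) : Prop where
  isStarProjection : IsStarProjection p
  map_eq : ∀ s, 1 ≤ s → s ≤ l → extend (π s) p = if s = r then e₀₀ else 0

open Polynomial in
/-- The polynomial `(1 - ∏_{m=1}^l (1 - q ^ (-2m) X)) / X`. -/
def polyF (q : ℝ) (l : ℕ) : Polynomial ℂ :=
  (1 - ∏ m ∈ Finset.Icc 1 l, (1 - C (((q : ℂ) ^ (2 * m))⁻¹) * X)).divX

open Polynomial in
/-- The polynomial `(1 - (1 - X) ^ k) / X`. -/
def polyG (k : ℕ) : Polynomial ℂ := ((1 : Polynomial ℂ) - (1 - X) ^ k).divX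

/-- The elements `ξ₁ = F(z₁ z₁*) ^ (k/2)` and `ξ₀ = G(z₀ ^ l (z₀*) ^ l) ^ (1/2)` of `C(W_q(k,l))`,
in this order. -/
def ξ (q : ℝ) (k l : ℕ) : Fin 2 → CW q k l :=
  ![cfc Real.sqrt (toEnv (Polynomial.aeval (bElt q k l) (polyF q l) ^ k)),
    cfc Real.sqrt (toEnv (Polynomial.aeval (cElt q k l) (polyG k)))]

/-- For `x ∈ O(W_q(k,l))` the `2 × 2` matrix `Ψ x Ψ*` over `C(W_q(k,l))`. -/
def twist (q : ℝ) (k l : ℕ) (x : OW q k l) : Matrix (Fin 2) (Fin 2) (CW q k l) :=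
  Matrix.of fun i j => ξ q k l i * toEnv (sandwich q k l i j x) * ξ q k l j

/-- For `x ∈ O(W_q(k,l))` the operator `ρ_s(x) = π_s(Ψ x Ψ*) ⊕ ε(Ψ x Ψ*)` on `H₊ ⊕ H₋`, where
`H = Ell2 ⊗ ℂ²`. -/
def rhoOp (q : ℝ) (k l : ℕ) (π : OW q k l →⋆ₐ[ℂ] (Ell2 →L[ℂ] Ell2)) (x : OW q k l) :
    Two (Two Ell2) →L[ℂ] Two (Two Ell2) :=
  blockOp !![blockOp ((twist q k l x).map (extend π)), 0;
    0, blockOp ((twist q k l x).map (extend (scalarRep (counit q k l) Ell2)))]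

/-- `ρ` is the extension to `C(W_q(k,l))` of the representation `ρ_s` built from `π = π_s`. -/
def IsRho (q : ℝ) (k l : ℕ) (π : OW q k l →⋆ₐ[ℂ] (Ell2 →L[ℂ] Ell2))
    (ρ : CW q k l →⋆ₙₐ[ℂ] (Two (Two Ell2) →L[ℂ] Two (Two Ell2))) : Prop :=
  ∀ x : OW q k l, ρ (toEnv x) = rhoOp q k l π x

/-- The Fredholm modules `F_0, F_1, F_2, …` built from the representations `ρ_1, ρ_2, …`
(`ρ 0` is not used: `F_0` lives on `ℂ₊ ⊕ ℂ₋` with representation `ε ⊕ 0`). -/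
def fredholm (q : ℝ) (k l : ℕ)
    (ρ : ℕ → CW q k l →⋆ₙₐ[ℂ] (Two (Two Ell2) →L[ℂ] Two (Two Ell2))) :
    ℕ → FredholmDatum (CW q k l)
  | 0 => ⟨Two ℂ, (cornerHom ℂ).comp (extend (scalarRep (counit q k l) ℂ)).toNonUnitalStarAlgHom,
      flipOp ℂ, gradingOp ℂ⟩
  | s + 1 => ⟨Two (Two Ell2), ρ (s + 1), flipOp (Two Ell2), gradingOp (Two Ell2)⟩

end QuantumWPL

end

open QuantumWPL

noncomputable section

namespace QuantumWPL

open InnerProductSpace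

/-! ### Nuclear operators and their traces -/

section nuclear

variable {E F G K : Type} [NormedAddCommGroup E] [InnerProductSpace ℂ E]
  [NormedAddCommGroup F] [InnerProductSpace ℂ F]
  [NormedAddCommGroup G] [InnerProductSpace ℂ G]
  [NormedAddCommGroup K] [InnerProductSpace ℂ K]

/-! For a representation `f ⊕ g` on `E₊ ⊕ E₋`, the operator `γ F [F, ρ p]` is diagonal with both
entries equal to `f p - g p` (`evenDatum_pairingOp`). The pairing is therefore `Tr (f p - g p)`, and
everything reduces to showing that such differences are nuclear and computing their traces.

Let `s = t + 1 ≥ 1`. The powers `z₁ ^ k` and `z₀ ^ l` are not in the line algebra, but they act on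
the space of `π_s`, so `Ψ` becomes there a column `V` of operators (`column`; index `0` belongs to
`z₁ ^ k`, index `1` to `z₀ ^ l`). Under `ε` it becomes the column `(0, 1)`. With `L = (z₀*) ^ l z₀ ^
l`, the two summands of `Ψ* Ψ` are `(1 - L) ^ k` and `1 - (1 - L) ^ k` (`sum_star_lineElt_mul`).
Hence `V* V = 1`, and `x ↦ V π_s(x) V*` is a homomorphism preserving traces (`hasTrace_conjBlock`).

For `p_r` with `r ≥ 1`, the operator `π_s(p_r)` differs from `ε(p_r) • 1` by a compact operator and
has finite rank, so `ε(p_r) = 0` (`IsProj.counit_eq_zero`). The trace is that of `π_s(p_r)`, namely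
`1` if `s = r` and `0` otherwise. For `p_0 = 1` the trace compares `V V*` with the projection onto
the second summand. If `c n` is the eigenvalue of `L` on `e n`, the diagonal blocks have entries `(1
- c n) ^ k` and `-(1 - c (n + 1)) ^ k`. The sums telescope to the term `n = 0`, which is `1` because
`c 0 = 0` (`exists_hasTrace_column`). For `s = 0` the pairing is just `ε(p_r)`.

Summability comes from the geometric decay of `z₁` and `b`: `π_s(x) - ε(x)` is nuclear on the
generators `a`, `b`, hence on the algebra they generate (`isNuclear_lineRep_sub_counit`). That `a`
and `b` generate the fixed point algebra (`adjoin_aElt_bElt`) follows by averaging ordered monomials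
over roots of unity. The relations between `a` and `b` confine the spectrum of `b` to `0` and the
powers `q ^ (2n)`, `n ≥ 1` (`spectrum_subset`). This bounds all representations uniformly and yields
the `p_r` by functional calculus in `b`. -/

/-- `T` is the absolutely convergent sum of the rank one operators `|u i⟩⟨v i|`. -/
def IsNuclearSum {ι : Type} (T : E →L[ℂ] F) (u : ι → F) (v : ι → E) : Prop :=
  (Summable fun i => ‖u i‖ * ‖v i‖) ∧ HasSum (fun i => rankOne ℂ (u i) (v i)) T

/-- `T` is a nuclear operator. -/
def IsNuclear (T : E →L[ℂ] F) : Prop :=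
  ∃ (ι : Type) (u : ι → F) (v : ι → E), IsNuclearSum T u v

/-- `T` is a nuclear operator with trace `t`. -/
def HasTrace (T : E →L[ℂ] E) (t : ℂ) : Prop :=
  ∃ (ι : Type) (u v : ι → E), IsNuclearSum T u v ∧ HasSum (fun i => ⟪v i, u i⟫_ℂ) t

theorem HasTrace.isNuclear {T : E →L[ℂ] E} {t : ℂ} (h : HasTrace T t) : IsNuclear T :=
  let ⟨ι, u, v, h, _⟩ := h
  ⟨ι, u, v, h⟩

theorem IsNuclearSum.summable_inner {ι : Type} {T : E →L[ℂ] E} {u v : ι → E}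
    (h : IsNuclearSum T u v) : Summable fun i => ⟪v i, u i⟫_ℂ :=
  .of_norm_bounded h.1 fun _ => (norm_inner_le_norm _ _).trans (mul_comm _ _).le

theorem IsNuclear.hasTrace {T : E →L[ℂ] E} (h : IsNuclear T) : ∃ t, HasTrace T t :=
  let ⟨ι, u, v, h⟩ := h
  ⟨_, ι, u, v, h, h.summable_inner.hasSum⟩

theorem IsNuclearSum.add {ι κ : Type} {S T : E →L[ℂ] F} {u : ι → F} {v : ι → E} {u' : κ → F}
    {v' : κ → E} (hS : IsNuclearSum S u v) (hT : IsNuclearSum T u' v') :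
    IsNuclearSum (S + T) (Sum.elim u u') (Sum.elim v v') :=
  ⟨(HasSum.sum (f := fun i : ι ⊕ κ => ‖Sum.elim u u' i‖ * ‖Sum.elim v v' i‖)
    hS.1.hasSum hT.1.hasSum).summable,
    HasSum.sum (f := fun i : ι ⊕ κ => rankOne ℂ (Sum.elim u u' i) (Sum.elim v v' i)) hS.2 hT.2⟩

theorem IsNuclear.add {S T : E →L[ℂ] F} (hS : IsNuclear S) (hT : IsNuclear T) :
    IsNuclear (S + T) :=
  let ⟨_, _, _, hS⟩ := hS
  let ⟨_, _, _, hT⟩ := hT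
  ⟨_, _, _, hS.add hT⟩

theorem HasTrace.add {S T : E →L[ℂ] E} {s t : ℂ} (hS : HasTrace S s) (hT : HasTrace T t) :
    HasTrace (S + T) (s + t) :=
  let ⟨ι, u, v, hS, hs⟩ := hS
  let ⟨κ, u', v', hT, ht⟩ := hT
  ⟨_, _, _, hS.add hT,
    HasSum.sum (f := fun i : ι ⊕ κ => ⟪Sum.elim v v' i, Sum.elim u u' i⟫_ℂ) hs ht⟩

theorem isNuclear_zero : IsNuclear (0 : E →L[ℂ] F) :=
  ⟨Empty, Empty.elim, Empty.elim, summable_empty, hasSum_empty⟩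

theorem hasTrace_zero : HasTrace (0 : E →L[ℂ] E) 0 :=
  ⟨Empty, Empty.elim, Empty.elim, ⟨summable_empty, hasSum_empty⟩, hasSum_empty⟩

theorem hasTrace_rankOne (u v : E) : HasTrace (rankOne ℂ u v) ⟪v, u⟫_ℂ :=
  ⟨Unit, fun _ => u, fun _ => v, ⟨(hasSum_fintype _).summable, by simp⟩, by simp⟩

/-- The partial sums have finite rank and the compact operators are norm closed. -/
theorem IsNuclear.isCompactOperator [CompleteSpace F] {T : E →L[ℂ] F} (h : IsNuclear T) :
    IsCompactOperator T := by
  obtain ⟨ι, u, v, h⟩ := h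
  have hc : IsClosed {f : E →L[ℂ] F | IsCompactOperator f} := isClosed_setOfPred_isCompactOperator
  refine hc.mem_of_tendsto h.2 (.of_forall fun s => ?_)
  induction s using Finset.cons_induction with
  | empty => exact isCompactOperator_zero
  | cons i s hi ih =>
    rw [Set.mem_ofPred_eq, Finset.sum_cons]
    refine IsCompactOperator.add ?_ ih
    -- A rank one operator factors through `ℂ`, whose identity is compact.
    rw [rankOne_def']
    exact ((isCompactOperator_id (E := ℂ)).comp_clm (innerSL ℂ (v i))).clm_comp
      (ContinuousLinearMap.toSpanSingleton ℂ (u i))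

theorem IsNuclearSum.comp [CompleteSpace E] [CompleteSpace G] {ι : Type} {T : E →L[ℂ] F}
    {u : ι → F} {v : ι → E}
    (h : IsNuclearSum T u v) (A : F →L[ℂ] K) (B : G →L[ℂ] E) :
    IsNuclearSum (A ∘L T ∘L B) (fun i => A (u i)) (fun i => B.adjoint (v i)) := by
  constructor
  · refine .of_nonneg_of_le (fun _ => by positivity) (fun i => ?_) (h.1.mul_left (‖A‖ * ‖B‖))
    calc ‖A (u i)‖ * ‖B.adjoint (v i)‖ ≤ (‖A‖ * ‖u i‖) * (‖B.adjoint‖ * ‖v i‖) := by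
          gcongr <;> exact ContinuousLinearMap.le_opNorm _ _
      _ = ‖A‖ * ‖B‖ * (‖u i‖ * ‖v i‖) := by rw [LinearIsometryEquiv.norm_map]; ring
  · have := h.2.mapL ((ContinuousLinearMap.compL ℂ G F K A) ∘L
      ((ContinuousLinearMap.compL ℂ G E F).flip B))
    simpa only [ContinuousLinearMap.comp_apply, ContinuousLinearMap.flip_apply,
      ContinuousLinearMap.compL_apply, rankOne_comp, comp_rankOne] using this

theorem IsNuclear.comp [CompleteSpace E] [CompleteSpace G] {T : E →L[ℂ] F} (h : IsNuclear T)
    (A : F →L[ℂ] K) (B : G →L[ℂ] E) :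
    IsNuclear (A ∘L T ∘L B) :=
  let ⟨_, _, _, h⟩ := h
  ⟨_, _, _, h.comp A B⟩

/-- Termwise, `⟪B* v, A u⟫ = ⟪v, B A u⟫ = c ⟪v, u⟫`. With `c = 1` this replaces cyclicity of the
trace for isometric embeddings. -/
theorem HasTrace.comp [CompleteSpace E] [CompleteSpace G] {T : E →L[ℂ] E} {t : ℂ}
    (h : HasTrace T t) {A : E →L[ℂ] G}
    {B : G →L[ℂ] E} {c : ℂ} (hBA : ∀ x, B (A x) = c • x) : HasTrace (A ∘L T ∘L B) (c * t) := by
  obtain ⟨ι, u, v, h, ht⟩ := h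
  refine ⟨ι, _, _, h.comp A B, ?_⟩
  simpa [ContinuousLinearMap.adjoint_inner_left, hBA, inner_smul_right] using ht.mul_left c

variable [CompleteSpace E]

theorem IsNuclear.comp_left {T : E →L[ℂ] F} (h : IsNuclear T) (A : F →L[ℂ] K) :
    IsNuclear (A ∘L T) := h.comp A (.id ℂ E)

theorem IsNuclear.smul {T : E →L[ℂ] F} (h : IsNuclear T) (c : ℂ) : IsNuclear (c • T) := by
  have := h.comp_left (c • .id ℂ F)
  convert this using 1
  ext; simp

theorem IsNuclear.neg {T : E →L[ℂ] F} (h : IsNuclear T) : IsNuclear (-T) := by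
  simpa using h.smul (-1)

end nuclear

/-! ### Diagonals of nuclear operators, and why nuclear operators are trace class. -/

section diagonal

variable {E H : Type} [NormedAddCommGroup E] [InnerProductSpace ℂ E]
  [NormedAddCommGroup H] [InnerProductSpace ℂ H] {κ : Type}

/-- Cauchy–Schwarz in `j`, then Bessel's inequality for each of the two orthonormal families. -/
theorem sum_norm_inner_mul_inner_le {ι : Type} (u : ι → H) (v : ι → E)
    (b : κ → H) (c : κ → E) (hb : Orthonormal ℂ b) (hc : Orthonormal ℂ c) (i : ι)
    (s : Finset κ) : ∑ j ∈ s, ‖⟪b j, u i⟫_ℂ * ⟪v i, c j⟫_ℂ‖ ≤ ‖u i‖ * ‖v i‖ := by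
  simp only [norm_mul]
  refine (Real.sum_mul_le_sqrt_mul_sqrt s _ _).trans ?_
  gcongr
  · exact Real.sqrt_le_iff.2 ⟨norm_nonneg _, hb.sum_inner_products_le _⟩
  · refine Real.sqrt_le_iff.2 ⟨norm_nonneg _, ?_⟩
    simp_rw [norm_inner_symm (v i)]
    exact hc.sum_inner_products_le _

theorem IsNuclearSum.hasSum_inner {ι : Type} {T : E →L[ℂ] H} {u : ι → H} {v : ι → E}
    (h : IsNuclearSum T u v) (x : E) (y : H) :
    HasSum (fun i => ⟪y, u i⟫_ℂ * ⟪v i, x⟫_ℂ) ⟪y, T x⟫_ℂ := by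
  have := h.2.mapL ((innerSL ℂ y) ∘L (ContinuousLinearMap.apply ℂ H x))
  simpa [inner_smul_right, mul_comm] using this

/-- The diagonal of a nuclear operator is absolutely summable, with a uniform bound. -/
theorem IsNuclearSum.sum_norm_inner_le {ι : Type} {T : E →L[ℂ] H} {u : ι → H} {v : ι → E}
    (h : IsNuclearSum T u v) {b : κ → H} {c : κ → E} (hb : Orthonormal ℂ b)
    (hc : Orthonormal ℂ c) (s : Finset κ) :
    ∑ j ∈ s, ‖⟪b j, T (c j)⟫_ℂ‖ ≤ ∑' i, ‖u i‖ * ‖v i‖ := by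
  have hs (j : κ) : Summable fun i => ‖⟪b j, u i⟫_ℂ * ⟪v i, c j⟫_ℂ‖ :=
    (h.hasSum_inner (c j) (b j)).summable.norm
  calc ∑ j ∈ s, ‖⟪b j, T (c j)⟫_ℂ‖ ≤ ∑ j ∈ s, ∑' i, ‖⟪b j, u i⟫_ℂ * ⟪v i, c j⟫_ℂ‖ := by
        gcongr with j
        rw [← (h.hasSum_inner (c j) (b j)).tsum_eq]
        exact norm_tsum_le_tsum_norm (hs j)
    _ = ∑' i, ∑ j ∈ s, ‖⟪b j, u i⟫_ℂ * ⟪v i, c j⟫_ℂ‖ :=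
        (Summable.tsum_finsetSum fun j _ => hs j).symm
    _ ≤ _ := Summable.tsum_le_tsum (fun i => sum_norm_inner_mul_inner_le u v b c hb hc i s)
        (summable_sum fun j _ => hs j) h.1

/-- The trace of a nuclear operator is the sum of its diagonal in any orthonormal basis. -/
theorem HasTrace.hasSum_hilbertBasis [CompleteSpace H] {T : H →L[ℂ] H} {t : ℂ} (h : HasTrace T t)
    (b : HilbertBasis κ ℂ H) : HasSum (fun j => ⟪b j, T (b j)⟫_ℂ) t := by
  obtain ⟨ι, u, v, h, ht⟩ := h
  -- Absolute summability over pairs allows both orders of summation: over `κ` first, Parseval gives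
  -- `⟪v i, u i⟫`; over `ι` first, one gets the diagonal of `T`.
  have hsum : Summable fun p : ι × κ => ‖⟪b p.2, u p.1⟫_ℂ * ⟪v p.1, b p.2⟫_ℂ‖ := by
    have hb (i : ι) := sum_norm_inner_mul_inner_le u v b b b.orthonormal b.orthonormal i
    refine (summable_prod_of_nonneg fun _ => norm_nonneg _).2
      ⟨fun i => summable_of_sum_le (fun _ => norm_nonneg _) (hb i), ?_⟩
    exact .of_nonneg_of_le (fun i => tsum_nonneg fun _ => norm_nonneg _)
      (fun i => Real.tsum_le_of_sum_le (fun _ => norm_nonneg _) (hb i)) h.1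
  have h1 := hsum.of_norm.hasSum.prod_fiberwise
    (g := fun i => ⟪v i, u i⟫_ℂ) fun i => by
      simpa only [mul_comm] using b.hasSum_inner_mul_inner (v i) (u i)
  rw [ht.unique h1]
  exact ((Equiv.prodComm κ ι).hasSum_iff.2 hsum.of_norm.hasSum).prod_fiberwise
    fun j => h.hasSum_inner (b j) (b j)

theorem HasTrace.opTrace_eq [CompleteSpace H] {T : H →L[ℂ] H} {t : ℂ} (h : HasTrace T t) :
    opTrace T = t :=
  (h.hasSum_hilbertBasis _).tsum_eq

/-- The modulus of an operator is a norm limit of contractive multiples of it. -/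
theorem exists_norm_mul_sub_cfc_sqrt_le {A : Type} [CStarAlgebra A] (T : A) {ε : ℝ}
    (hε : 0 < ε) : ∃ W : A, ‖W‖ ≤ 1 ∧ ‖cfc Real.sqrt (star T * T) - W * T‖ ≤ √ε := by
  let _ := CStarAlgebra.spectralOrder A
  have := CStarAlgebra.spectralOrderedRing A
  set S := star T * T with hS
  have hS0 : 0 ≤ S := star_mul_self_nonneg T
  have hsa : IsSelfAdjoint S := .of_nonneg hS0
  have hsp {x : ℝ} (hx : x ∈ spectrum ℝ S) : 0 ≤ x := spectrum_nonneg_of_nonneg hS0 hx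
  -- `W = (T* T + ε)^(-1/2) T*` stands in for the adjoint of the partial isometry of the polar
  -- decomposition. The two estimates are `x / (x + ε) ≤ 1` for `W W*` and `√x - x / √(x + ε) ≤ √ε`
  -- for the error.
  let g : ℝ → ℝ := fun x => (√(x + ε))⁻¹
  have hg : ContinuousOn g (spectrum ℝ S) := by
    refine ContinuousOn.inv₀ (by fun_prop) fun x hx => ?_
    have := hsp hx
    positivity
  refine ⟨cfc g S * star T, ?_, ?_⟩
  · have h1 : ‖(cfc g S * star T) * star (cfc g S * star T)‖ ≤ 1 := by
      have : (cfc g S * star T) * star (cfc g S * star T) = cfc (fun x => g x * x * g x) S := by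
        rw [cfc_mul _ _ S (by fun_prop) hg, cfc_mul _ _ S hg (by fun_prop), cfc_id' ℝ S,
          star_mul, star_star, (cfc_predicate g S : IsSelfAdjoint _).star_eq, hS]
        simp only [mul_assoc]
      rw [this]
      refine norm_cfc_le zero_le_one fun x hx => ?_
      have hx0 := hsp hx
      have : g x * x * g x = x / (x + ε) := by
        have : √(x + ε) ^ 2 = x + ε := Real.sq_sqrt (by positivity)
        simp only [g]
        field_simp
        rw [this]
      rw [this, Real.norm_of_nonneg (by positivity)]
      exact div_le_one_of_le₀ (by linarith) (by positivity)
    rw [CStarRing.norm_self_mul_star] at h1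
    nlinarith [norm_nonneg (cfc g S * star T)]
  · have : cfc g S * star T * T = cfc (fun x => g x * x) S := by
      rw [cfc_mul _ _ S hg (by fun_prop), cfc_id' ℝ S, mul_assoc, hS]
    rw [this, ← cfc_sub Real.sqrt (fun x => g x * x) S (by fun_prop) (hg.mul continuousOn_id)]
    refine norm_cfc_le (by positivity) fun x hx => ?_
    have hx0 := hsp hx
    have h1 : √(x + ε) ^ 2 = x + ε := Real.sq_sqrt (by positivity)
    have h2 : √x ^ 2 = x := Real.sq_sqrt hx0
    have h3 : √x ≤ √(x + ε) := Real.sqrt_le_sqrt (by linarith)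
    have h4 : √(x + ε) ≤ √x + √ε := by
      rw [Real.sqrt_le_left (by positivity)]
      nlinarith [Real.sq_sqrt hε.le, mul_nonneg (Real.sqrt_nonneg x) (Real.sqrt_nonneg ε)]
    have h5 : 0 < √(x + ε) := by positivity
    have h6 : √x - g x * x = √x * (√(x + ε) - √x) / √(x + ε) := by
      simp only [g]
      field_simp
      linear_combination h2
    rw [h6, Real.norm_of_nonneg (div_nonneg (mul_nonneg (by positivity) (by linarith)) h5.le),
      div_le_iff₀ h5]
    nlinarith [Real.sqrt_nonneg x, Real.sqrt_nonneg ε]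

/-- On a finite set of basis vectors, `|T|` may be replaced by `W T` with `W` a contraction.
Composing with `W` does not increase `∑ ‖u i‖ ‖v i‖`, and the error, at most `ε` per vector,
disappears as `ε → 0` with the finite set fixed. -/
theorem IsNuclear.isTraceClass [CompleteSpace H] {T : H →L[ℂ] H} (h : IsNuclear T) :
    IsTraceClass T := by
  intro κ b
  obtain ⟨ι, u, v, h⟩ := h
  set M := ∑' i, ‖u i‖ * ‖v i‖
  refine .of_norm (summable_of_sum_le (c := M) (fun _ => norm_nonneg _) fun s => ?_)
  have key (ε : ℝ) (hε : 0 < ε) :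
      ∑ j ∈ s, ‖⟪b j, cfc Real.sqrt (star T * T) (b j)⟫_ℂ‖ ≤ M + s.card * ε := by
    obtain ⟨W, hW, hWT⟩ := exists_norm_mul_sub_cfc_sqrt_le T (pow_pos hε 2)
    rw [Real.sqrt_sq hε.le] at hWT
    have hu (i : ι) : ‖W (u i)‖ ≤ ‖u i‖ := by
      simpa using W.le_of_opNorm_le hW (u i)
    have hWs : ∑ j ∈ s, ‖⟪b j, (W * T) (b j)⟫_ℂ‖ ≤ M := by
      have h' : IsNuclearSum (W * T) (fun i => W (u i)) v := by
        have := h.comp W (.id ℂ H)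
        simp only [ContinuousLinearMap.adjoint_id, ContinuousLinearMap.comp_id] at this
        exact this
      refine (h'.sum_norm_inner_le b.orthonormal b.orthonormal s).trans ?_
      exact Summable.tsum_le_tsum (fun i => by gcongr; exact hu i) h'.1 h.1
    have hj (j : κ) : ‖⟪b j, cfc Real.sqrt (star T * T) (b j)⟫_ℂ‖ ≤
        ‖⟪b j, (W * T) (b j)⟫_ℂ‖ + ε := by
      have h1 : ⟪b j, cfc Real.sqrt (star T * T) (b j)⟫_ℂ = ⟪b j, (W * T) (b j)⟫_ℂ +
          ⟪b j, (cfc Real.sqrt (star T * T) - W * T) (b j)⟫_ℂ := by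
        rw [← inner_add_right, sub_apply, add_sub_cancel]
      have h2 : ‖⟪b j, (cfc Real.sqrt (star T * T) - W * T) (b j)⟫_ℂ‖ ≤ ε := by
        refine (norm_inner_le_norm _ _).trans ?_
        simpa [b.orthonormal.1 j] using
          ContinuousLinearMap.le_of_opNorm_le _ hWT (b j)
      rw [h1]
      exact (norm_add_le _ _).trans (by gcongr)
    calc _ ≤ ∑ j ∈ s, (‖⟪b j, (W * T) (b j)⟫_ℂ‖ + ε) := Finset.sum_le_sum fun j _ => hj j
      _ ≤ M + s.card * ε := by
        rw [Finset.sum_add_distrib, Finset.sum_const, nsmul_eq_mul]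
        gcongr
  have hlim : Filter.Tendsto (fun ε : ℝ => M + s.card * ε) (nhdsWithin 0 (Set.Ioi 0)) (nhds M) := by
    have : Filter.Tendsto (fun ε : ℝ => M + s.card * ε) (nhds 0) (nhds (M + s.card * 0)) := by
      apply Continuous.tendsto; fun_prop
    simpa using this.mono_left nhdsWithin_le_nhds
  exact ge_of_tendsto hlim (Filter.eventually_of_mem self_mem_nhdsWithin key)

end diagonal

/-! ### Block operators -/

section block

variable {E : Type} [NormedAddCommGroup E] [InnerProductSpace ℂ E]

/-- The inclusion of a direct summand of `E ⊕ E`. -/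
def incl (E : Type) [NormedAddCommGroup E] [InnerProductSpace ℂ E] (i : Fin 2) : E →L[ℂ] Two E :=
  (PiLp.continuousLinearEquiv 2 ℂ fun _ : Fin 2 => E).symm.toContinuousLinearMap ∘L
    ContinuousLinearMap.single ℂ (fun _ : Fin 2 => E) i

/-- The projection onto a direct summand of `E ⊕ E`. -/
abbrev coord (E : Type) [NormedAddCommGroup E] [InnerProductSpace ℂ E] (i : Fin 2) :
    Two E →L[ℂ] E := PiLp.proj 2 (fun _ : Fin 2 => E) i

theorem incl_apply (i j : Fin 2) (x : E) : incl E i x j = if j = i then x else 0 := by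
  simp [incl]

theorem blockOp_eq (A B C D : E →L[ℂ] E) : blockOp !![A, B; C, D] =
    incl E 0 ∘L A ∘L coord E 0 + incl E 0 ∘L B ∘L coord E 1 +
      (incl E 1 ∘L C ∘L coord E 0 + incl E 1 ∘L D ∘L coord E 1) := by
  ext v i
  fin_cases i <;> simp [blockOp_apply, incl_apply]

theorem blockOp_mul (M N : Matrix (Fin 2) (Fin 2) (E →L[ℂ] E)) :
    blockOp M * blockOp N = blockOp (M * N) := by
  ext v i
  fin_cases i <;>
    simp [blockOp_apply, Matrix.mul_apply, Fin.sum_univ_two, add_add_add_comm]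

theorem blockOp_add (M N : Matrix (Fin 2) (Fin 2) (E →L[ℂ] E)) :
    blockOp M + blockOp N = blockOp (M + N) := by
  ext v i
  fin_cases i <;> simp [blockOp_apply, Fin.sum_univ_two, add_add_add_comm]

theorem blockOp_sub (M N : Matrix (Fin 2) (Fin 2) (E →L[ℂ] E)) :
    blockOp M - blockOp N = blockOp (M - N) := by
  ext v i
  fin_cases i <;> simp [blockOp_apply, Fin.sum_univ_two, add_sub_add_comm]

theorem blockOp_smul (c : ℂ) (M : Matrix (Fin 2) (Fin 2) (E →L[ℂ] E)) :
    c • blockOp M = blockOp (c • M) := by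
  ext v i
  fin_cases i <;> simp [blockOp_apply, Fin.sum_univ_two]

theorem blockOp_one : blockOp (1 : Matrix (Fin 2) (Fin 2) (E →L[ℂ] E)) = 1 := by
  ext v i
  fin_cases i <;> simp [blockOp_apply, Fin.sum_univ_two, Matrix.one_apply]

theorem blockOp_zero : blockOp (0 : Matrix (Fin 2) (Fin 2) (E →L[ℂ] E)) = 0 := by
  ext v i
  fin_cases i <;> simp [blockOp_apply]

variable [CompleteSpace E]

theorem star_blockOp (M : Matrix (Fin 2) (Fin 2) (E →L[ℂ] E)) :
    star (blockOp M) = blockOp (star M) := by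
  symm
  rw [ContinuousLinearMap.star_eq_adjoint, ContinuousLinearMap.eq_adjoint_iff]
  intro x y
  simp only [PiLp.inner_apply, blockOp_apply, Fin.sum_univ_two, Matrix.star_apply,
    ContinuousLinearMap.star_eq_adjoint, inner_add_left, inner_add_right,
    ContinuousLinearMap.adjoint_inner_left]
  ring

theorem isNuclear_blockOp {A B C D : E →L[ℂ] E} (hA : IsNuclear A) (hB : IsNuclear B)
    (hC : IsNuclear C) (hD : IsNuclear D) : IsNuclear (blockOp !![A, B; C, D]) := by
  rw [blockOp_eq]
  exact ((hA.comp _ _).add (hB.comp _ _)).add ((hC.comp _ _).add (hD.comp _ _))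

theorem hasTrace_blockOp {A B C D : E →L[ℂ] E} {a d : ℂ} (hA : HasTrace A a) (hB : IsNuclear B)
    (hC : IsNuclear C) (hD : HasTrace D d) : HasTrace (blockOp !![A, B; C, D]) (a + d) := by
  rw [blockOp_eq]
  -- Off-diagonal blocks have trace zero term by term, because `coord j` after `incl i` vanishes for
  -- `j ≠ i`.
  have h01 {T : E →L[ℂ] E} (hT : IsNuclear T) {i j : Fin 2} (hij : j ≠ i) :
      HasTrace (incl E i ∘L T ∘L coord E j) 0 := by
    obtain ⟨ι, u, v, hT⟩ := hT
    refine ⟨ι, _, _, hT.comp _ _, ?_⟩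
    simp [ContinuousLinearMap.adjoint_inner_left, incl_apply, hij]
  have h00 {T : E →L[ℂ] E} {t : ℂ} (hT : HasTrace T t) (i : Fin 2) :
      HasTrace (incl E i ∘L T ∘L coord E i) t := by
    simpa using hT.comp (c := 1) (A := incl E i) (B := coord E i) (by simp [incl_apply])
  convert ((h00 hA 0).add (h01 hB one_ne_zero)).add ((h01 hC zero_ne_one).add (h00 hD 1)) using 1
  ring

end block

end QuantumWPL

namespace QuantumWPL

/-! ### The algebra of the quantum sphere -/

section algebra

theorem mul_pow_of_qcomm {B : Type*} [Ring B] [Algebra ℂ B] {x y : B} {c : ℂ}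
    (h : x * y = c • (y * x)) (j : ℕ) : x * y ^ j = c ^ j • (y ^ j * x) := by
  induction j with
  | zero => simp
  | succ j ih =>
    rw [pow_succ, ← mul_assoc, ih, smul_mul_assoc, mul_assoc, h, mul_smul_comm, smul_smul,
      ← mul_assoc, pow_succ]

theorem pow_mul_pow_of_qcomm {B : Type*} [Ring B] [Algebra ℂ B] {x y : B} {c : ℂ}
    (h : x * y = c • (y * x)) (i j : ℕ) : x ^ i * y ^ j = c ^ (i * j) • (y ^ j * x ^ i) := by
  induction i with
  | zero => simp
  | succ i ih =>
    rw [pow_succ, mul_assoc, mul_pow_of_qcomm h, mul_smul_comm, ← mul_assoc, ih, smul_mul_assoc,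
      smul_smul, mul_assoc, ← pow_add, add_mul, one_mul, add_comm]

theorem qcomm_symm {B : Type*} [Ring B] [Algebra ℂ B] {x y : B} {c : ℂ} (hc : c ≠ 0)
    (h : x * y = c • (y * x)) : y * x = c⁻¹ • (x * y) := by
  rw [h, smul_smul, inv_mul_cancel₀ hc, one_smul]

open Polynomial

/-- The polynomial `∏_{m=1}^l (1 - q ^ (-2m) X)`. -/
def lowerPoly (q : ℝ) (l : ℕ) : ℂ[X] := ∏ m ∈ Finset.Icc 1 l, (1 - C (((q : ℂ) ^ (2 * m))⁻¹) * X)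

/-- The polynomial `∏_{m=0}^{l-1} (1 - q ^ (2m) X)`. -/
def upperPoly (q : ℝ) (l : ℕ) : ℂ[X] := ∏ m ∈ Finset.range l, (1 - C ((q : ℂ) ^ (2 * m)) * X)

/-- The numerator has no constant term, so `divX` is exact division by `X`. -/
theorem polyF_mul_X (q : ℝ) (l : ℕ) : polyF q l * X = 1 - lowerPoly q l := by
  have h := Polynomial.divX_mul_X_add (1 - lowerPoly q l)
  have h0 : (1 - lowerPoly q l).coeff 0 = 0 := by
    simp [coeff_zero_eq_eval_zero, lowerPoly, eval_prod]
  rw [h0, C_0, add_zero] at h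
  exact h

theorem polyG_mul_X (k : ℕ) : polyG k * X = 1 - (1 - X) ^ k := by
  have h := Polynomial.divX_mul_X_add ((1 : ℂ[X]) - (1 - X) ^ k)
  have h0 : ((1 : ℂ[X]) - (1 - X) ^ k).coeff 0 = 0 := by
    simp [coeff_zero_eq_eval_zero]
  rw [h0, C_0, add_zero] at h
  exact h

variable (q : ℝ)

/-- The element `z₁ z₁*` of the quantum sphere. -/
def bS : OSphere q := z₁ q * star (z₁ q)

theorem star_bS : star (bS q) = bS q := by simp [bS]

theorem z0_mul_bS : z₀ q * bS q = (q : ℂ) ^ 2 • (bS q * z₀ q) := by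
  rw [bS, ← mul_assoc, z0_z1, smul_mul_assoc, mul_assoc, z0_z1s, mul_smul_comm, smul_smul, sq,
    mul_assoc]

theorem bS_mul_z0s : bS q * star (z₀ q) = (q : ℂ) ^ 2 • (star (z₀ q) * bS q) := by
  have := congrArg star (z0_mul_bS q)
  simpa [star_bS, ← Complex.ofReal_pow] using this

theorem z0_mul_z0s : z₀ q * star (z₀ q) = 1 - bS q := eq_sub_of_add_eq (sphere_eq q)

theorem z0s_mul_z0 : star (z₀ q) * z₀ q = 1 - ((q : ℂ) ^ 2)⁻¹ • bS q := by
  have h := z0_z0s q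
  rw [z0_mul_z0s, ← bS, sub_smul, one_smul] at h
  rw [← sub_eq_of_eq_add h]
  abel

variable {q}

theorem bS_mul_z0 (hq : q ≠ 0) : bS q * z₀ q = ((q : ℂ) ^ 2)⁻¹ • (z₀ q * bS q) :=
  qcomm_symm (by simpa using hq) (z0_mul_bS q)

/-- The innermost pair is `z₀* z₀ = 1 - q ^ (-2) b`. Moving this `b` to the right past `z₀ ^ l`
multiplies it by `q ^ (-2l)`, which gives the factor with `m = l + 1`. In the opposite order one
starts from `z₀ z₀* = 1 - b`, hence the positive exponents starting at `0` in `upperPoly`. -/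
theorem z0s_pow_mul_z0_pow (hq : q ≠ 0) (l : ℕ) :
    star (z₀ q) ^ l * z₀ q ^ l = aeval (bS q) (lowerPoly q l) := by
  induction l with
  | zero => simp [lowerPoly]
  | succ l ih =>
    have h : bS q * z₀ q ^ l = (((q : ℂ) ^ 2)⁻¹) ^ l • (z₀ q ^ l * bS q) :=
      mul_pow_of_qcomm (bS_mul_z0 hq) l
    rw [lowerPoly, Finset.prod_Icc_succ_top (by lia), map_mul, ← lowerPoly, ← ih, pow_succ,
      pow_succ' (z₀ q), mul_assoc, ← mul_assoc (star (z₀ q)) (z₀ q), z0s_mul_z0, sub_mul,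
      one_mul, smul_mul_assoc, h, smul_smul, mul_sub, mul_assoc, mul_smul_comm]
    simp only [map_sub, map_one, map_mul, aeval_X, aeval_C, mul_sub, mul_one,
      ← Algebra.smul_def, mul_smul_comm]
    congr 2
    rw [← pow_succ', pow_mul, inv_pow]

theorem z0_pow_mul_z0s_pow (l : ℕ) :
    z₀ q ^ l * star (z₀ q) ^ l = aeval (bS q) (upperPoly q l) := by
  induction l with
  | zero => simp [upperPoly]
  | succ l ih =>
    have h : bS q * star (z₀ q) ^ l = ((q : ℂ) ^ 2) ^ l • (star (z₀ q) ^ l * bS q) :=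
      mul_pow_of_qcomm (bS_mul_z0s q) l
    rw [upperPoly, Finset.prod_range_succ, map_mul, ← upperPoly, ← ih, pow_succ,
      pow_succ' (star (z₀ q)), mul_assoc, ← mul_assoc (z₀ q), z0_mul_z0s, sub_mul,
      one_mul, h, mul_sub, mul_assoc]
    simp only [map_sub, map_one, map_mul, aeval_X, aeval_C, mul_sub, mul_one,
      ← Algebra.smul_def, mul_smul_comm]
    rw [pow_mul]

theorem commute_z1_aeval (p : ℂ[X]) : Commute (z₁ q) (aeval (bS q) p) := by
  refine Algebra.commute_of_mem_adjoin_singleton_of_commute (aeval_mem_adjoin_singleton ℂ _) ?_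
  rw [Commute, SemiconjBy, bS, mul_assoc, ← z1_z1s]

theorem z1_pow_mul_z1s_pow (k : ℕ) : z₁ q ^ k * star (z₁ q) ^ k = bS q ^ k := by
  rw [bS]
  exact (Commute.mul_pow (show Commute (z₁ q) (star (z₁ q)) from z1_z1s q) k).symm

/-! ### Generators of the coordinate algebra of the quantum weighted projective line -/

theorem coe_aeval_OW {k l : ℕ} (x : OW q k l) (p : ℂ[X]) :
    ((aeval x p : OW q k l) : OSphere q) = aeval (x : OSphere q) p :=
  (aeval_algHom_apply ((OW q k l).subtype : OW q k l →ₐ[ℂ] OSphere q) x p).symm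

theorem coe_bElt {k l : ℕ} : (bElt q k l : OSphere q) = bS q := rfl

theorem star_bElt {k l : ℕ} : star (bElt q k l) = bElt q k l := Subtype.ext (star_bS q)

theorem aElt_mul_bElt {k l : ℕ} :
    aElt q k l * bElt q k l = ((q : ℂ) ^ (2 * l)) • (bElt q k l * aElt q k l) := by
  refine Subtype.ext ?_
  change z₀ q ^ l * star (z₁ q) ^ k * bS q =
    ((q : ℂ) ^ (2 * l)) • (bS q * (z₀ q ^ l * star (z₁ q) ^ k))
  have h1 : star (z₁ q) ^ k * bS q = bS q * star (z₁ q) ^ k := by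
    have := (commute_z1_aeval (q := q) X).star_star
    simp only [aeval_X, star_bS] at this
    exact (this.pow_left k).eq
  have h2 := pow_mul_pow_of_qcomm (z0_mul_bS q) l 1
  rw [mul_assoc, h1, ← mul_assoc, ← pow_one (bS q), h2, smul_mul_assoc, mul_assoc, mul_one, pow_mul]

/-- Together with `aElt_mul_bElt` and self-adjointness of `b`, this is all that the spectral
analysis of `b` needs. -/
theorem star_aElt_mul_aElt (hq : q ≠ 0) {k l : ℕ} :
    star (aElt q k l) * aElt q k l = aeval (bElt q k l) (X ^ k * lowerPoly q l) := by
  refine Subtype.ext ?_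
  rw [coe_aeval_OW, coe_bElt]
  change star (z₀ q ^ l * star (z₁ q) ^ k) * (z₀ q ^ l * star (z₁ q) ^ k) = _
  rw [star_mul, star_pow, star_pow, star_star, mul_assoc, ← mul_assoc (star (z₀ q) ^ l),
    z0s_pow_mul_z0_pow hq, ← mul_assoc, ((commute_z1_aeval _).pow_left k).eq, mul_assoc,
    z1_pow_mul_z1s_pow, mul_comm, map_mul, map_pow, aeval_X]

theorem cElt_eq {k l : ℕ} : cElt q k l = aeval (bElt q k l) (upperPoly q l) := by
  refine Subtype.ext ?_
  rw [coe_aeval_OW, coe_bElt]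
  exact z0_pow_mul_z0s_pow l

/-- The homogeneous elements of weight `d` for the weighted circle action. -/
def HasWeight (k l : ℕ) (d : ℤ) (x : OSphere q) : Prop :=
  ∀ w : Circle, circleAction q k l w x = ((w : ℂ) ^ d) • x

theorem HasWeight.mul {k l : ℕ} {c d : ℤ} {x y : OSphere q} (hx : HasWeight k l c x)
    (hy : HasWeight k l d y) : HasWeight k l (c + d) (x * y) := fun w => by
  rw [map_mul, hx w, hy w, smul_mul_smul_comm, zpow_add₀ w.coe_ne_zero]

theorem HasWeight.pow {k l : ℕ} {d : ℤ} {x : OSphere q} (hx : HasWeight k l d x) (n : ℕ) :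
    HasWeight k l (d * n) (x ^ n) := fun w => by
  rw [map_pow, hx w, _root_.smul_pow, zpow_mul, zpow_natCast]

theorem HasWeight.star {k l : ℕ} {d : ℤ} {x : OSphere q} (hx : HasWeight k l d x) :
    HasWeight k l (-d) (star x) := fun w => by
  rw [map_star, hx w, star_smul, star_zpow₀, zpow_neg, ← inv_zpow, Complex.star_def,
    ← Circle.coe_inv_eq_conj, Circle.coe_inv]

theorem hasWeight_z0 {k l : ℕ} : HasWeight k l k (z₀ q) := fun w => by
  rw [circleAction_z0, zpow_natCast]

theorem hasWeight_z1 {k l : ℕ} : HasWeight k l l (z₁ q) := fun w => by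
  rw [circleAction_z1, zpow_natCast]

variable (q) in
/-- The span of the monomials in `z₁` and `z₁*`. -/
def torusSpan : Submodule ℂ (OSphere q) :=
  Submodule.span ℂ (Set.range fun p : ℕ × ℕ => z₁ q ^ p.1 * star (z₁ q) ^ p.2)

theorem z1_mul_mem_torusSpan {x : OSphere q} (hx : x ∈ torusSpan q) :
    z₁ q * x ∈ torusSpan q := by
  have : torusSpan q ≤ (torusSpan q).comap (LinearMap.mulLeft ℂ (z₁ q)) := by
    refine Submodule.span_le.2 ?_
    rintro _ ⟨⟨i, j⟩, rfl⟩
    exact Submodule.subset_span ⟨(i + 1, j), by simp [pow_succ', mul_assoc]⟩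
  exact this hx

theorem z1s_mul_mem_torusSpan {x : OSphere q} (hx : x ∈ torusSpan q) :
    star (z₁ q) * x ∈ torusSpan q := by
  have : torusSpan q ≤ (torusSpan q).comap (LinearMap.mulLeft ℂ (star (z₁ q))) := by
    refine Submodule.span_le.2 ?_
    rintro _ ⟨⟨i, j⟩, rfl⟩
    refine Submodule.subset_span ⟨(i, j + 1), ?_⟩
    have h : Commute (star (z₁ q)) (z₁ q) := (z1_z1s q).symm
    simp only [LinearMap.mulLeft_apply]
    rw [← mul_assoc, (h.pow_right i).eq, mul_assoc, pow_succ']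
  exact this hx

theorem bS_mul_mem_torusSpan {x : OSphere q} (hx : x ∈ torusSpan q) : bS q * x ∈ torusSpan q := by
  rw [bS, mul_assoc]
  exact z1_mul_mem_torusSpan (z1s_mul_mem_torusSpan hx)

variable (q) in
/-- The span of the ordered monomials. -/
def monomialSpan : Submodule ℂ (OSphere q) :=
  Submodule.span ℂ
    (Set.range (fun p : ℕ × ℕ × ℕ => z₀ q ^ p.1 * (z₁ q ^ p.2.1 * star (z₁ q) ^ p.2.2)) ∪
    Set.range (fun p : ℕ × ℕ × ℕ => star (z₀ q) ^ p.1 * (z₁ q ^ p.2.1 * star (z₁ q) ^ p.2.2)))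

theorem z0_pow_mul_mem_monomialSpan (i : ℕ) {x : OSphere q} (hx : x ∈ torusSpan q) :
    z₀ q ^ i * x ∈ monomialSpan q := by
  have : torusSpan q ≤ (monomialSpan q).comap (LinearMap.mulLeft ℂ (z₀ q ^ i)) := by
    refine Submodule.span_le.2 ?_
    rintro _ ⟨⟨m, n⟩, rfl⟩
    exact Submodule.subset_span (.inl ⟨(i, m, n), rfl⟩)
  exact this hx

theorem z0s_pow_mul_mem_monomialSpan (i : ℕ) {x : OSphere q} (hx : x ∈ torusSpan q) :
    star (z₀ q) ^ i * x ∈ monomialSpan q := by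
  have : torusSpan q ≤ (monomialSpan q).comap (LinearMap.mulLeft ℂ (star (z₀ q) ^ i)) := by
    refine Submodule.span_le.2 ?_
    rintro _ ⟨⟨m, n⟩, rfl⟩
    exact Submodule.subset_span (.inr ⟨(i, m, n), rfl⟩)
  exact this hx

theorem mul_mem_monomialSpan {y : OSphere q}
    (h0 : ∀ i, ∀ x ∈ torusSpan q, y * (z₀ q ^ i * x) ∈ monomialSpan q)
    (h1 : ∀ i, ∀ x ∈ torusSpan q, y * (star (z₀ q) ^ i * x) ∈ monomialSpan q)
    {x : OSphere q} (hx : x ∈ monomialSpan q) : y * x ∈ monomialSpan q := by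
  have : monomialSpan q ≤ (monomialSpan q).comap (LinearMap.mulLeft ℂ y) := by
    refine Submodule.span_le.2 (Set.union_subset ?_ ?_)
    · rintro _ ⟨⟨i, m, n⟩, rfl⟩
      exact h0 i _ (Submodule.subset_span ⟨(m, n), rfl⟩)
    · rintro _ ⟨⟨i, m, n⟩, rfl⟩
      exact h1 i _ (Submodule.subset_span ⟨(m, n), rfl⟩)
  exact this hx

theorem z0_mul_mem_monomialSpan {x : OSphere q} (hx : x ∈ monomialSpan q) :
    z₀ q * x ∈ monomialSpan q := by
  refine mul_mem_monomialSpan (fun i x hx => ?_) (fun i x hx => ?_) hx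
  · rw [← mul_assoc, ← pow_succ']
    exact z0_pow_mul_mem_monomialSpan _ hx
  · cases i with
    | zero => simpa using z0_pow_mul_mem_monomialSpan 1 hx
    | succ i =>
      -- The adjacent pair `z₀ z₀*` becomes `1 - b`, and `b` is carried to the right through `(z₀*)
      -- ^ i` into the part in `z₁`, `z₁*`.
      rw [pow_succ', mul_assoc, ← mul_assoc, z0_mul_z0s, sub_mul, one_mul, ← mul_assoc (bS q),
        mul_pow_of_qcomm (bS_mul_z0s q), smul_mul_assoc, mul_assoc]
      exact sub_mem (z0s_pow_mul_mem_monomialSpan _ hx)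
        (Submodule.smul_mem _ _ (z0s_pow_mul_mem_monomialSpan _ (bS_mul_mem_torusSpan hx)))

theorem z0s_mul_mem_monomialSpan (hq : q ≠ 0) {x : OSphere q} (hx : x ∈ monomialSpan q) :
    star (z₀ q) * x ∈ monomialSpan q := by
  refine mul_mem_monomialSpan (fun i x hx => ?_) (fun i x hx => ?_) hx
  · cases i with
    | zero => simpa using z0s_pow_mul_mem_monomialSpan 1 hx
    | succ i =>
      rw [pow_succ', mul_assoc, ← mul_assoc, z0s_mul_z0, sub_mul, one_mul, smul_mul_assoc,
        ← mul_assoc (bS q), mul_pow_of_qcomm (bS_mul_z0 hq), smul_mul_assoc, mul_assoc]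
      exact sub_mem (z0_pow_mul_mem_monomialSpan _ hx) (Submodule.smul_mem _ _
        (Submodule.smul_mem _ _ (z0_pow_mul_mem_monomialSpan _ (bS_mul_mem_torusSpan hx))))
  · rw [← mul_assoc, ← pow_succ']
    exact z0s_pow_mul_mem_monomialSpan _ hx

theorem z1_mul_mem_monomialSpan (hq : q ≠ 0) {x : OSphere q} (hx : x ∈ monomialSpan q) :
    z₁ q * x ∈ monomialSpan q := by
  have hq' : (q : ℂ) ≠ 0 := by simpa using hq
  refine mul_mem_monomialSpan (fun i x hx => ?_) (fun i x hx => ?_) hx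
  · rw [← mul_assoc, mul_pow_of_qcomm (qcomm_symm hq' (z0_z1 q)), smul_mul_assoc, mul_assoc]
    exact Submodule.smul_mem _ _ (z0_pow_mul_mem_monomialSpan _ (z1_mul_mem_torusSpan hx))
  · rw [← mul_assoc, mul_pow_of_qcomm (z1_z0s q), smul_mul_assoc, mul_assoc]
    exact Submodule.smul_mem _ _ (z0s_pow_mul_mem_monomialSpan _ (z1_mul_mem_torusSpan hx))

theorem z1s_mul_mem_monomialSpan (hq : q ≠ 0) {x : OSphere q} (hx : x ∈ monomialSpan q) :
    star (z₁ q) * x ∈ monomialSpan q := by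
  have hq' : (q : ℂ) ≠ 0 := by simpa using hq
  have h : star (z₁ q) * star (z₀ q) = (q : ℂ) • (star (z₀ q) * star (z₁ q)) := by
    simpa using congrArg star (z0_z1 q)
  refine mul_mem_monomialSpan (fun i x hx => ?_) (fun i x hx => ?_) hx
  · rw [← mul_assoc, mul_pow_of_qcomm (qcomm_symm hq' (z0_z1s q)), smul_mul_assoc, mul_assoc]
    exact Submodule.smul_mem _ _ (z0_pow_mul_mem_monomialSpan _ (z1s_mul_mem_torusSpan hx))
  · rw [← mul_assoc, mul_pow_of_qcomm h, smul_mul_assoc, mul_assoc]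
    exact Submodule.smul_mem _ _ (z0s_pow_mul_mem_monomialSpan _ (z1s_mul_mem_torusSpan hx))

/-- The span contains `1` and is stable under left multiplication by each of the four letters, hence
by every word. -/
theorem mem_monomialSpan (hq : q ≠ 0) (x : OSphere q) : x ∈ monomialSpan q := by
  obtain ⟨f, rfl⟩ := UnivStarAlg.mk_surjective x
  have key : ∀ y ∈ monomialSpan q, UnivStarAlg.mk _ (SphereRel q) f * y ∈ monomialSpan q := by
    induction f using FreeAlgebra.induction with
    | grade0 c =>
      intro y hy
      rw [AlgHom.commutes, ← Algebra.smul_def]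
      exact Submodule.smul_mem _ _ hy
    | grade1 p =>
      intro y hy
      obtain ⟨i, s⟩ := p
      fin_cases i <;> cases s
      · exact z0_mul_mem_monomialSpan hy
      · exact (mk_fzs_zero q).symm ▸ z0s_mul_mem_monomialSpan hq hy
      · exact z1_mul_mem_monomialSpan hq hy
      · exact (mk_fzs_one q).symm ▸ z1s_mul_mem_monomialSpan hq hy
    | mul a b ha hb =>
      intro y hy
      rw [map_mul, mul_assoc]
      exact ha _ (hb _ hy)
    | add a b ha hb =>
      intro y hy
      rw [map_add, add_mul]
      exact add_mem (ha _ hy) (hb _ hy)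
  simpa using key 1 (Submodule.subset_span (.inl ⟨(0, 0, 0), by simp⟩))

/-- The average of `x` over the rotations by the powers of `w`. -/
def average (k l N : ℕ) (w : Circle) : OSphere q →ₗ[ℂ] OSphere q :=
  (N : ℂ)⁻¹ • ∑ j ∈ Finset.range N,
    (circleAction q k l (w ^ j) : OSphere q →ₐ[ℂ] OSphere q).toLinearMap

theorem average_of_mem {k l N : ℕ} (hN : N ≠ 0) (w : Circle) {x : OSphere q} (hx : x ∈ OW q k l) :
    average k l N w x = x := by
  have h (w : Circle) : circleAction q k l w x = x := hx w
  simp [average, h, hN, smul_smul, ← Nat.cast_smul_eq_nsmul ℂ]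

/-- A geometric sum over the powers of a nontrivial `N`-th root of unity vanishes. Finite averages
thus replace integration over the circle. -/
theorem average_of_hasWeight {k l N : ℕ} {w : Circle} (hw : IsPrimitiveRoot (w : ℂ) N)
    {d : ℤ} (hd : ¬ (N : ℤ) ∣ d) {x : OSphere q} (hx : HasWeight k l d x) :
    average k l N w x = 0 := by
  have h1 : (w : ℂ) ^ d ≠ 1 := fun h => hd ((hw.zpow_eq_one_iff_dvd d).1 h)
  have h2 : ∑ j ∈ Finset.range N, ((w : ℂ) ^ d) ^ j = 0 := by
    rw [geom_sum_eq h1, ← zpow_natCast, ← zpow_mul, mul_comm, zpow_mul, zpow_natCast, hw.pow_eq_one,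
      one_zpow, sub_self, zero_div]
  have h3 (j : ℕ) : circleAction q k l (w ^ j) x = (((w : ℂ) ^ d) ^ j) • x := by
    rw [hx, Circle.coe_pow, ← zpow_natCast, ← zpow_natCast, ← zpow_mul, ← zpow_mul, mul_comm]
  simp [average, h3, ← Finset.sum_smul, h2]

theorem exists_isPrimitiveRoot_circle {N : ℕ} (hN : N ≠ 0) :
    ∃ w : Circle, IsPrimitiveRoot (w : ℂ) N := by
  refine ⟨Circle.exp (2 * Real.pi / N), ?_⟩
  convert Complex.isPrimitiveRoot_exp N hN using 1
  rw [Circle.coe_exp]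
  congr 1
  push_cast
  ring

/-- The `*`-subalgebra generated by `a` and `b`. -/
def genAlg (q : ℝ) (k l : ℕ) : StarSubalgebra ℂ (OSphere q) :=
  StarAlgebra.adjoin ℂ {z₀ q ^ l * star (z₁ q) ^ k, bS q}

/-- Up to a power of `q`, this element is `a ^ t`. -/
theorem z0_pow_mul_z1s_pow_mem {k l : ℕ} (t : ℕ) :
    z₀ q ^ (l * t) * star (z₁ q) ^ (k * t) ∈ genAlg q k l := by
  have ha : z₀ q ^ l * star (z₁ q) ^ k ∈ genAlg q k l := StarAlgebra.subset_adjoin _ _ (by simp)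
  induction t with
  | zero => simp
  | succ t ih =>
    have h := pow_mul_pow_of_qcomm (z0_z1s q) (l * t) k
    have : z₀ q ^ (l * (t + 1)) * star (z₁ q) ^ (k * (t + 1)) = (q : ℂ) ^ (l * t * k) •
        ((z₀ q ^ l * star (z₁ q) ^ k) * (z₀ q ^ (l * t) * star (z₁ q) ^ (k * t))) := by
      rw [mul_add, mul_add, mul_one, mul_one, add_comm, add_comm (k * t), pow_add, pow_add,
        mul_assoc, ← mul_assoc (_ ^ (l * t)), h]
      simp only [smul_mul_assoc, mul_smul_comm, mul_assoc]
    rw [this]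
    exact SMulMemClass.smul_mem _ (mul_mem ha ih)

theorem z0s_pow_mul_z1_pow_mem (hq : q ≠ 0) {k l : ℕ} (t : ℕ) :
    star (z₀ q) ^ (l * t) * z₁ q ^ (k * t) ∈ genAlg q k l := by
  have h := star_mem (z0_pow_mul_z1s_pow_mem (q := q) (k := k) (l := l) t)
  rw [star_mul, star_pow, star_pow, star_star] at h
  have hq' : (q : ℂ) ≠ 0 := by simpa using hq
  rw [qcomm_symm (pow_ne_zero _ hq') (pow_mul_pow_of_qcomm (z1_z0s q) _ _)]
  exact SMulMemClass.smul_mem _ h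

/-- The equation says that the monomial has weight zero. Coprimality then forces `i = l t` and `n =
k t + m`, so the monomial is `z₀ ^ (l t) (z₁*) ^ (k t)` times `b ^ m`. -/
theorem monomial_mem_genAlg {k l : ℕ} (hl : 0 < l) (hkl : Nat.Coprime k l)
    {i m n : ℕ} (h : k * i + l * m = l * n) :
    z₀ q ^ i * (z₁ q ^ m * star (z₁ q) ^ n) ∈ genAlg q k l := by
  have hli : l ∣ i := by
    refine hkl.symm.dvd_of_dvd_mul_left ?_
    exact (Nat.dvd_add_left (dvd_mul_right l m)).1 (h ▸ dvd_mul_right l n)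
  obtain ⟨t, rfl⟩ := hli
  have hn : n = k * t + m := Nat.eq_of_mul_eq_mul_left hl (by rw [← h]; ring)
  have hc : Commute (z₁ q) (star (z₁ q)) := z1_z1s q
  rw [hn, add_comm, pow_add, ← mul_assoc (_ ^ m), z1_pow_mul_z1s_pow, bS,
    ((hc.mul_left (Commute.refl _)).pow_pow _ _).eq, ← mul_assoc]
  exact mul_mem (z0_pow_mul_z1s_pow_mem t)
    (pow_mem (StarAlgebra.subset_adjoin _ _ (by simp [bS])) _)

theorem star_monomial_mem_genAlg (hq : q ≠ 0) {k l : ℕ} (hl : 0 < l) (hkl : Nat.Coprime k l)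
    {i m n : ℕ} (h : k * i + l * n = l * m) :
    star (z₀ q) ^ i * (z₁ q ^ m * star (z₁ q) ^ n) ∈ genAlg q k l := by
  have hli : l ∣ i := by
    refine hkl.symm.dvd_of_dvd_mul_left ?_
    exact (Nat.dvd_add_left (dvd_mul_right l n)).1 (h ▸ dvd_mul_right l m)
  obtain ⟨t, rfl⟩ := hli
  have hm : m = k * t + n := Nat.eq_of_mul_eq_mul_left hl (by rw [← h]; ring)
  rw [hm, pow_add, mul_assoc, z1_pow_mul_z1s_pow, ← mul_assoc]
  exact mul_mem (z0s_pow_mul_z1_pow_mem hq t)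
    (pow_mem (StarAlgebra.subset_adjoin _ _ (by simp)) _)

theorem average_mem_genAlg_of_hasWeight {k l : ℕ} {d : ℤ} {x : OSphere q}
    (hx : HasWeight k l d x) (h0 : d = 0 → x ∈ genAlg q k l) :
    ∃ N₀ : ℕ, ∀ N ≥ N₀, N ≠ 0 → ∀ w : Circle, IsPrimitiveRoot (w : ℂ) N →
      average k l N w x ∈ genAlg q k l := by
  -- Once `N > |d|`, `N` divides `d` only if `d = 0`.
  refine ⟨d.natAbs + 1, fun N hN hN0 w hw => ?_⟩
  by_cases hd : d = 0
  · rw [average_of_mem hN0 w (fun w => by rw [hx w, hd, zpow_zero, one_smul])]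
    exact h0 hd
  · rw [average_of_hasWeight hw _ hx]
    · exact zero_mem _
    · intro hdvd
      have := Int.le_of_dvd (by positivity) ((dvd_abs _ _).2 hdvd)
      rw [Int.abs_eq_natAbs] at this
      lia

/-- A fixed element equals its average, and for large `N` averaging keeps only the weight-zero
monomials. Asking for all large `N` makes the claim stable under sums. -/
theorem mem_genAlg (hq : q ≠ 0) {k l : ℕ} (hl : 0 < l) (hkl : Nat.Coprime k l) {x : OSphere q}
    (hx : x ∈ OW q k l) : x ∈ genAlg q k l := by
  have key : ∃ N₀ : ℕ, ∀ N ≥ N₀, N ≠ 0 → ∀ w : Circle, IsPrimitiveRoot (w : ℂ) N →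
      average k l N w x ∈ genAlg q k l := by
    -- The monomials occurring in a fixed element need not be fixed, so the induction must run over
    -- arbitrary elements.
    clear hx
    induction mem_monomialSpan hq x using Submodule.span_induction with
    | mem x hx =>
      obtain ⟨⟨i, m, n⟩, rfl⟩ | ⟨⟨i, m, n⟩, rfl⟩ := hx
      · refine average_mem_genAlg_of_hasWeight ((hasWeight_z0.pow i).mul
          ((hasWeight_z1.pow m).mul (hasWeight_z1.star.pow n))) fun h => ?_
        refine monomial_mem_genAlg hl hkl ?_
        zify
        linarith
      · refine average_mem_genAlg_of_hasWeight ((hasWeight_z0.star.pow i).mul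
          ((hasWeight_z1.pow m).mul (hasWeight_z1.star.pow n))) fun h => ?_
        refine star_monomial_mem_genAlg hq hl hkl ?_
        zify
        linarith
    | zero => exact ⟨0, fun N _ _ w _ => by rw [map_zero]; exact zero_mem _⟩
    | add x y _ _ hx hy =>
      obtain ⟨Nx, hx⟩ := hx
      obtain ⟨Ny, hy⟩ := hy
      refine ⟨max Nx Ny, fun N hN hN0 w hw => ?_⟩
      rw [map_add]
      exact add_mem (hx N (le_of_max_le_left hN) hN0 w hw) (hy N (le_of_max_le_right hN) hN0 w hw)
    | smul c x _ hx =>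
      obtain ⟨Nx, hx⟩ := hx
      refine ⟨Nx, fun N hN hN0 w hw => ?_⟩
      rw [map_smul]
      exact SMulMemClass.smul_mem _ (hx N hN hN0 w hw)
  obtain ⟨N₀, h⟩ := key
  obtain ⟨w, hw⟩ := exists_isPrimitiveRoot_circle (N₀ + 1).succ_ne_zero
  have := h _ (by lia) (N₀ + 1).succ_ne_zero w hw
  rwa [average_of_mem (N₀ + 1).succ_ne_zero w hx] at this

/-- The coordinate algebra of the quantum weighted projective line is generated by `a` and `b`. -/
theorem adjoin_aElt_bElt (hq : q ≠ 0) {k l : ℕ} (hl : 0 < l) (hkl : Nat.Coprime k l) :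
    StarAlgebra.adjoin ℂ {aElt q k l, bElt q k l} = ⊤ := by
  refine eq_top_iff.2 fun x _ => ?_
  have h := mem_genAlg hq hl hkl x.2
  have h2 := (OW q k l).subtype.map_adjoin {aElt q k l, bElt q k l}
  rw [Set.image_pair] at h2
  change x.1 ∈ StarAlgebra.adjoin ℂ {(OW q k l).subtype (aElt q k l),
    (OW q k l).subtype (bElt q k l)} at h
  rw [← h2] at h
  obtain ⟨y, hy, hyx⟩ := h
  exact (Subtype.ext hyx : y = x) ▸ hy

end algebra

end QuantumWPL

namespace QuantumWPL

/-! ### Spectral consequences of the relations between `a` and `b` -/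

section spectral

open Polynomial

variable {B : Type*} [CStarAlgebra B]

/-- The spectrum of `b` is real, so `z - b` is self-adjoint and the adjoint of a left inverse would
be a right inverse. -/
theorem isUnit_sub_of_mul_eq_one {b u : B} (hb : IsSelfAdjoint b) {z : ℂ}
    (hz : z ∈ spectrum ℂ b) : u * (algebraMap ℂ B z - b) ≠ 1 := by
  intro hu
  have hz' : (starRingEnd ℂ) z = z := by
    rw [hb.mem_spectrum_eq_re hz, Complex.conj_ofReal]
  have h2 : (algebraMap ℂ B z - b) * star u = 1 := by
    have := congrArg star hu
    rwa [star_mul, star_one, star_sub, hb.star_eq, ← algebraMap_star_comm, Complex.star_def,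
      hz'] at this
  refine spectrum.mem_iff.1 hz ⟨⟨_, star u, h2, ?_⟩, rfl⟩
  rw [← left_inv_eq_right_inv hu h2, hu]

/-- Since `a (z - b) = r (r⁻¹ z - b) a`, an inverse of `r⁻¹ z - b` placed between `a*` and `a` would
give `r P(b)` as a left multiple of `z - b`. As `P(b)` is `P(z)` modulo left multiples of `z - b`
and `P(z) ≠ 0`, `z - b` would have a left inverse. -/
theorem inv_mul_mem_spectrum {a b : B} (hb : IsSelfAdjoint b) {r z : ℂ} (hr : r ≠ 0)
    (hab : a * b = r • (b * a)) {P : ℂ[X]} (haa : star a * a = aeval b P) (hz : z ∈ spectrum ℂ b)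
    (hP : P.eval z ≠ 0) : r⁻¹ * z ∈ spectrum ℂ b := by
  by_contra hn
  rw [spectrum.notMem_iff] at hn
  obtain ⟨u, hu⟩ := hn
  obtain ⟨Q, hQ⟩ := X_sub_C_dvd_sub_C_eval (a := z) (p := P)
  have h1 : a * (algebraMap ℂ B z - b) = r • ((u : B) * a) := by
    rw [hu, sub_mul, mul_sub, hab, smul_sub, ← Algebra.smul_def, smul_smul, ← mul_assoc,
      mul_inv_cancel₀ hr, one_mul, ← Algebra.commutes, ← Algebra.smul_def]
  have h2 : (star a * ((u⁻¹ : Bˣ) : B) * a) * (algebraMap ℂ B z - b) = r • aeval b P := by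
    rw [mul_assoc, h1, mul_smul_comm, mul_assoc, Units.inv_mul_cancel_left, haa]
  have h3 : aeval b P = algebraMap ℂ B (P.eval z) - aeval b Q * (algebraMap ℂ B z - b) := by
    have h := congrArg (aeval b) hQ
    rw [mul_comm] at h
    simp only [map_sub, map_mul, aeval_X, aeval_C] at h
    rw [sub_eq_iff_eq_add.1 h, ← neg_sub b, mul_neg, sub_neg_eq_add, add_comm]
  refine isUnit_sub_of_mul_eq_one hb hz
    (u := (P.eval z)⁻¹ • (r⁻¹ • (star a * ((u⁻¹ : Bˣ) : B) * a) + aeval b Q)) ?_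
  rw [smul_mul_assoc, add_mul, smul_mul_assoc, h2, smul_smul, inv_mul_cancel₀ hr, one_smul, h3,
    sub_add_cancel, Algebra.algebraMap_eq_smul_one, smul_smul, inv_mul_cancel₀ hP, one_smul]

variable {q : ℝ} {k l : ℕ}

theorem eval_lowerPoly_eq_zero (hq : q ≠ 0) {z : ℂ} (h : (X ^ k * lowerPoly q l).eval z = 0) :
    z = 0 ∨ ∃ m, 1 ≤ m ∧ z = (q : ℂ) ^ (2 * m) := by
  rw [eval_mul, mul_eq_zero, lowerPoly, eval_prod, Finset.prod_eq_zero_iff] at h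
  obtain h | ⟨m, hm, h⟩ := h
  · rw [eval_pow, eval_X] at h
    exact .inl (eq_zero_of_pow_eq_zero h)
  · refine .inr ⟨m, (Finset.mem_Icc.1 hm).1, ?_⟩
    have : (q : ℂ) ^ (2 * m) ≠ 0 := pow_ne_zero _ (by simpa using hq)
    simp only [eval_sub, eval_one, eval_mul, eval_C, eval_X] at h
    field_simp at h
    linear_combination -h

/-- A point `z` outside the list stays outside the zeros of the polynomial under repeated
multiplication by `q ^ (-2l)`. All these multiples then lie in the spectrum, which is bounded, so `z
= 0`. -/
theorem spectrum_subset (hq0 : 0 < q) (hq1 : q < 1) (hl : 0 < l) {a b : B} (hb : IsSelfAdjoint b)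
    (hab : a * b = ((q : ℂ) ^ (2 * l)) • (b * a))
    (haa : star a * a = aeval b (X ^ k * lowerPoly q l)) {z : ℂ} (hz : z ∈ spectrum ℂ b) :
    z = 0 ∨ ∃ n, 1 ≤ n ∧ z = (q : ℂ) ^ (2 * n) := by
  by_contra! hn
  have hq : (q : ℂ) ≠ 0 := by exact_mod_cast hq0.ne'
  set r : ℂ := (q : ℂ) ^ (2 * l) with hr
  have hr0 : r ≠ 0 := pow_ne_zero _ hq
  have key (j : ℕ) : (r⁻¹) ^ j * z ∈ spectrum ℂ b := by
    induction j with
    | zero => simpa using hz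
    | succ j ih =>
      rw [pow_succ', mul_assoc]
      refine inv_mul_mem_spectrum hb hr0 hab haa ih fun h => ?_
      obtain h | ⟨m, hm, h⟩ := eval_lowerPoly_eq_zero hq0.ne' h
      · exact hn.1 ((mul_eq_zero.1 h).resolve_left (pow_ne_zero _ (inv_ne_zero hr0)))
      · refine hn.2 (l * j + m) (by lia) ?_
        rw [inv_pow, inv_mul_eq_iff_eq_mul₀ (pow_ne_zero _ hr0)] at h
        rw [h, hr]
        ring
  have hbd (j : ℕ) : ‖z‖ ≤ (q ^ (2 * l)) ^ j * (‖b‖ * ‖(1 : B)‖) := by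
    have h := spectrum.norm_le_norm_mul_of_mem (key j)
    rw [norm_mul, norm_pow, norm_inv, hr, norm_pow, Complex.norm_real, Real.norm_of_nonneg hq0.le,
      inv_pow, inv_mul_le_iff₀ (by positivity)] at h
    exact h
  have hlim : Filter.Tendsto (fun j : ℕ => (q ^ (2 * l)) ^ j * (‖b‖ * ‖(1 : B)‖)) .atTop
      (nhds 0) := by
    rw [← zero_mul (‖b‖ * ‖(1 : B)‖)]
    exact (tendsto_pow_atTop_nhds_zero_of_lt_one (by positivity)
      (pow_lt_one₀ hq0.le hq1 (by lia))).mul_const _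
  exact hn.1 (norm_le_zero_iff.1 (ge_of_tendsto' hlim hbd))

theorem real_spectrum_subset (hq0 : 0 < q) (hq1 : q < 1) (hl : 0 < l) {a b : B}
    (hb : IsSelfAdjoint b) (hab : a * b = ((q : ℂ) ^ (2 * l)) • (b * a))
    (haa : star a * a = aeval b (X ^ k * lowerPoly q l)) {x : ℝ} (hx : x ∈ spectrum ℝ b) :
    x = 0 ∨ ∃ n, 1 ≤ n ∧ x = q ^ (2 * n) := by
  have hx' : (x : ℂ) ∈ spectrum ℂ b := by
    simpa using spectrum.algebraMap_mem ℂ hx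
  obtain h | ⟨n, hn, h⟩ := spectrum_subset hq0 hq1 hl hb hab haa hx'
  · exact .inl (by exact_mod_cast h)
  · exact .inr ⟨n, hn, by exact_mod_cast h⟩

theorem norm_le_one_of_relations (hq0 : 0 < q) (hq1 : q < 1) (hl : 0 < l) {a b : B}
    (hb : IsSelfAdjoint b) (hab : a * b = ((q : ℂ) ^ (2 * l)) • (b * a))
    (haa : star a * a = aeval b (X ^ k * lowerPoly q l)) : ‖b‖ ≤ 1 := by
  rw [← cfc_id' ℝ b]
  refine norm_cfc_le zero_le_one fun x hx => ?_
  obtain rfl | ⟨n, _, rfl⟩ := real_spectrum_subset hq0 hq1 hl hb hab haa hx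
  · simp
  · rw [Real.norm_of_nonneg (by positivity)]
    exact pow_le_one₀ hq0.le hq1.le

end spectral

/-! ### The enveloping C⋆-algebra -/

section envelope

variable {A : Type} [Ring A] [StarRing A] [Algebra ℂ A]

theorem IsBoundedElt.exists_le {a : A} (ha : IsBoundedElt a) :
    ∃ M, ∀ π : StarRep A, ‖π.toHom a‖ ≤ M :=
  let ⟨M, hM⟩ := ha
  ⟨M, fun π => hM ⟨π, rfl⟩⟩

theorem isBoundedElt_of_le {a : A} {M : ℝ} (h : ∀ π : StarRep A, ‖π.toHom a‖ ≤ M) :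
    IsBoundedElt a :=
  ⟨M, by rintro _ ⟨π, rfl⟩; exact h π⟩

variable (A) in
/-- The bounded elements of a `*`-algebra. -/
def boundedElts [StarModule ℂ A] : StarSubalgebra ℂ A where
  carrier := {a | IsBoundedElt a}
  mul_mem' := by
    intro a b ha hb
    obtain ⟨M, hM⟩ := ha.exists_le
    obtain ⟨N, hN⟩ := hb.exists_le
    refine isBoundedElt_of_le (M := M * N) fun π => ?_
    rw [map_mul]
    exact (norm_mul_le _ _).trans
      (mul_le_mul (hM π) (hN π) (norm_nonneg _) ((norm_nonneg _).trans (hM π)))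
  add_mem' := by
    intro a b ha hb
    obtain ⟨M, hM⟩ := ha.exists_le
    obtain ⟨N, hN⟩ := hb.exists_le
    refine isBoundedElt_of_le (M := M + N) fun π => ?_
    rw [map_add]
    exact (norm_add_le _ _).trans (add_le_add (hM π) (hN π))
  algebraMap_mem' c := by
    refine isBoundedElt_of_le (M := ‖c‖) fun π => ?_
    rw [AlgHomClass.commutes, norm_algebraMap']
  star_mem' := by
    intro a ha
    obtain ⟨M, hM⟩ := ha.exists_le
    refine isBoundedElt_of_le (M := M) fun π => ?_
    rw [map_star, norm_star]
    exact hM π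

theorem isBoundedElt_of_star_mul_self {a : A} (h : IsBoundedElt (star a * a)) :
    IsBoundedElt a := by
  obtain ⟨M, hM⟩ := h.exists_le
  refine isBoundedElt_of_le (M := √M) fun π => Real.le_sqrt_of_sq_le ?_
  rw [sq, ← CStarRing.norm_star_mul_self, ← map_star, ← map_mul]
  exact hM π

theorem coe_toEnv_apply {a : A} (ha : IsBoundedElt a) (π : StarRep A) :
    (toEnv a).1 π = π.toHom a := by
  have h : toEnv a = (⟨⟨fun π => π.toHom a, memℓp_infty ha⟩, subset_closure ⟨a, fun _ => rfl⟩⟩ :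
      (repImage A).topologicalClosure) := dif_pos ha
  rw [h]

theorem CStarEnv.ext {x y : CStarEnv A} (h : ∀ π : StarRep A, x.1 π = y.1 π) : x = y :=
  Subtype.ext (lp.ext (funext h))

/-- The canonical homomorphism of a `*`-algebra with bounded elements into its envelope. -/
def toEnvHom (hA : ∀ a : A, IsBoundedElt a) : A →⋆ₐ[ℂ] CStarEnv A where
  toFun := toEnv
  map_one' := CStarEnv.ext fun π => by rw [coe_toEnv_apply (hA _), map_one]; rfl
  map_mul' a b := CStarEnv.ext fun π => by
    rw [coe_toEnv_apply (hA _), map_mul, ← coe_toEnv_apply (hA a), ← coe_toEnv_apply (hA b)]; rfl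
  map_zero' := CStarEnv.ext fun π => by rw [coe_toEnv_apply (hA _), map_zero]; rfl
  map_add' a b := CStarEnv.ext fun π => by
    rw [coe_toEnv_apply (hA _), map_add, ← coe_toEnv_apply (hA a), ← coe_toEnv_apply (hA b)]; rfl
  commutes' c := CStarEnv.ext fun π => by
    rw [coe_toEnv_apply (hA _), AlgHomClass.commutes]; rfl
  map_star' a := CStarEnv.ext fun π => by
    rw [coe_toEnv_apply (hA _), map_star, ← coe_toEnv_apply (hA a)]; rfl

theorem toEnvHom_apply (hA : ∀ a : A, IsBoundedElt a) (a : A) : toEnvHom hA a = toEnv a := rfl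

theorem denseRange_toEnv (hA : ∀ a : A, IsBoundedElt a) : DenseRange (toEnv (A := A)) := by
  intro x
  have h : (x.1 : RepProd A) ∈ closure (repImage A : Set (RepProd A)) := x.2
  refine closure_subtype.2 (closure_mono ?_ h)
  rintro f ⟨a, ha⟩
  exact ⟨toEnv a, ⟨a, rfl⟩, lp.ext (funext fun π => (coe_toEnv_apply (hA a) π).trans (ha π).symm)⟩

variable {H : Type} [NormedAddCommGroup H] [InnerProductSpace ℂ H] [CompleteSpace H]
    [Nontrivial H]

theorem norm_extend_apply_le (π : A →⋆ₐ[ℂ] (H →L[ℂ] H)) (x : CStarEnv A) :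
    ‖extend π x‖ ≤ ‖x‖ :=
  lp.norm_apply_le_norm (by simp) x.1 (⟨H, π⟩ : StarRep A)

theorem continuous_extend (π : A →⋆ₐ[ℂ] (H →L[ℂ] H)) : Continuous (extend π) :=
  AddMonoidHomClass.continuous_of_bound (extend π) 1 fun x => by
    simpa using norm_extend_apply_le π x

end envelope

/-! ### The envelope of the coordinate algebra -/

section bounded

open Polynomial

variable {q : ℝ} {k l : ℕ}

theorem isBoundedElt_bElt (hq0 : 0 < q) (hq1 : q < 1) (hl : 0 < l) :
    IsBoundedElt (bElt q k l) := by
  refine isBoundedElt_of_le (M := 1) fun π => ?_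
  refine norm_le_one_of_relations (a := π.toHom (aElt q k l)) (k := k) hq0 hq1 hl ?_ ?_ ?_
  · rw [IsSelfAdjoint, ← map_star, star_bElt]
  · rw [← map_mul, aElt_mul_bElt, map_smul, map_mul]
  · rw [← map_star, ← map_mul, star_aElt_mul_aElt hq0.ne']
    exact (aeval_algHom_apply π.toHom _ _).symm

/-- The bounded elements form a `*`-subalgebra. It contains `b` by the spectral estimate, and `a`
because `a* a` is a polynomial in `b`. -/
theorem isBoundedElt_OW (hq0 : 0 < q) (hq1 : q < 1) (hl : 0 < l) (hkl : Nat.Coprime k l)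
    (x : OW q k l) : IsBoundedElt x := by
  have hb := isBoundedElt_bElt (k := k) hq0 hq1 hl
  have ha : IsBoundedElt (aElt q k l) := by
    refine isBoundedElt_of_star_mul_self ?_
    rw [star_aElt_mul_aElt hq0.ne']
    have h : (boundedElts (OW q k l)).toSubalgebra ≥ Algebra.adjoin ℂ {bElt q k l} :=
      Algebra.adjoin_le (Set.singleton_subset_iff.2 hb)
    exact h (aeval_mem_adjoin_singleton ℂ _)
  have h : StarAlgebra.adjoin ℂ {aElt q k l, bElt q k l} ≤ boundedElts (OW q k l) := by
    refine StarAlgebra.adjoin_le ?_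
    rintro _ (rfl | rfl)
    exacts [ha, hb]
  rw [adjoin_aElt_bElt hq0.ne' hl hkl] at h
  exact h (StarSubalgebra.mem_top)

end bounded

end QuantumWPL

namespace QuantumWPL

/-! ### Operators on the space of square summable sequences -/

section ell2

theorem e_apply (m n : ℕ) : e m n = if n = m then 1 else 0 := by
  rw [e, lp.single_apply]
  aesop

theorem inner_e_left (n : ℕ) (x : Ell2) : ⟪e n, x⟫_ℂ = x n := by
  simpa [e] using lp.inner_single_left (𝕜 := ℂ) (G := fun _ : ℕ => ℂ) n (1 : ℂ) x

theorem inner_e_e (m n : ℕ) : ⟪e m, e n⟫_ℂ = if m = n then 1 else 0 := by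
  rw [inner_e_left, e_apply]

theorem norm_e (n : ℕ) : ‖e n‖ = 1 := by
  simp [e]

theorem orthonormal_e : Orthonormal ℂ e := orthonormal_iff_ite.2 inner_e_e

theorem hasSum_e (x : Ell2) : HasSum (fun n => x n • e n) x := by
  have h := lp.hasSum_single (E := fun _ : ℕ => ℂ) (p := 2) (by simp) x
  convert h using 2 with n
  rw [e, ← lp.single_smul, smul_eq_mul, mul_one]

theorem Ell2.ext_inner {x y : Ell2} (h : ∀ n, ⟪e n, x⟫_ℂ = ⟪e n, y⟫_ℂ) : x = y := by
  refine lp.ext (funext fun n => ?_)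
  simpa only [inner_e_left] using h n

theorem Ell2.clm_ext {F : Type*} [NormedAddCommGroup F] [NormedSpace ℂ F] {S T : Ell2 →L[ℂ] F}
    (h : ∀ n, S (e n) = T (e n)) : S = T := by
  ext x
  have h1 := (hasSum_e x).mapL S
  have h2 := (hasSum_e x).mapL T
  simp only [map_smul, h] at h1 h2
  exact h1.unique h2

/-- The diagonal operator with entries bounded by one. -/
def diagOp (d : ℕ → ℂ) (hd : ∀ n, ‖d n‖ ≤ 1) : Ell2 →L[ℂ] Ell2 :=
  LinearMap.mkContinuous
    { toFun x := ⟨fun n => d n * x n, (lp.memℓp x).mono' fun n => by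
        simpa using mul_le_mul_of_nonneg_right (hd n) (norm_nonneg (x n))⟩
      map_add' x y := lp.ext (funext fun n => mul_add _ _ _)
      map_smul' c x := lp.ext (funext fun n => mul_left_comm _ _ _) } 1 fun x => by
    rw [one_mul]
    refine lp.norm_mono (by simp) fun n => ?_
    simpa using mul_le_mul_of_nonneg_right (hd n) (norm_nonneg (x n))

theorem diagOp_e (d : ℕ → ℂ) (hd : ∀ n, ‖d n‖ ≤ 1) (n : ℕ) :
    diagOp d hd (e n) = d n • e n := by
  refine lp.ext (funext fun m => ?_)
  change d m * e n m = d n * e n m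
  rw [e_apply]
  split_ifs with h <;> simp [h]

/-- The isometry `e_n ↦ e_{σ n}`. -/
def reindex (σ : ℕ → ℕ) (hσ : Function.Injective σ) : Ell2 →L[ℂ] Ell2 :=
  ((orthonormal_e.comp σ hσ).orthogonalFamily.linearIsometry).toContinuousLinearMap

theorem reindex_e (σ : ℕ → ℕ) (hσ : Function.Injective σ) (n : ℕ) :
    reindex σ hσ (e n) = e (σ n) := by
  refine ((orthonormal_e.comp σ hσ).orthogonalFamily.linearIsometry_apply_single (i := n)
    (1 : ℂ)).trans ?_
  simp

theorem star_apply_eq {T : Ell2 →L[ℂ] Ell2} {n : ℕ} {x : Ell2}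
    (h : ∀ m, ⟪T (e m), e n⟫_ℂ = ⟪e m, x⟫_ℂ) : star T (e n) = x :=
  Ell2.ext_inner fun m => by
    rw [ContinuousLinearMap.star_eq_adjoint, ContinuousLinearMap.adjoint_inner_right, h]

theorem star_reindex_e (σ : ℕ → ℕ) (hσ : Function.Injective σ) (n : ℕ) :
    star (reindex σ hσ) (e (σ n)) = e n :=
  star_apply_eq fun m => by simp [reindex_e, inner_e_e, hσ.eq_iff]

theorem star_reindex_mul_reindex (σ : ℕ → ℕ) (hσ : Function.Injective σ) :
    star (reindex σ hσ) * reindex σ hσ = 1 :=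
  Ell2.clm_ext fun n => by simp [reindex_e, star_reindex_e]

theorem star_reindex_e_of_notMem (σ : ℕ → ℕ) (hσ : Function.Injective σ) {n : ℕ}
    (hn : ∀ m, σ m ≠ n) : star (reindex σ hσ) (e n) = 0 :=
  star_apply_eq fun m => by simp [reindex_e, inner_e_e, hn m]

theorem star_diagOp_e (d : ℕ → ℂ) (hd : ∀ n, ‖d n‖ ≤ 1) (n : ℕ) :
    star (diagOp d hd) (e n) = star (d n) • e n :=
  star_apply_eq fun m => by
    rw [diagOp_e, inner_smul_left, inner_smul_right, inner_e_e]
    split_ifs with h <;> simp [h]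

end ell2

/-! ### Compression to invariant subspaces -/

section compress

variable {H : Type*} [NormedAddCommGroup H] [InnerProductSpace ℂ H] [CompleteSpace H]

/-- The projection `J J*` commutes with operators which, together with their adjoints, leave the
range of `J` invariant. -/
theorem commute_mul_star {J T A B : H →L[ℂ] H} (hJ : star J * J = 1) (hA : T * J = J * A)
    (hB : star T * J = J * B) : Commute (J * star J) T := by
  have h1 : (J * star J) * T * (J * star J) = T * (J * star J) := by
    calc (J * star J) * T * (J * star J) = J * star J * (T * J) * star J := by
          simp only [mul_assoc]
      _ = J * (star J * J) * A * star J := by rw [hA]; simp only [mul_assoc]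
      _ = T * (J * star J) := by rw [hJ, mul_one, ← hA, mul_assoc]
  have h2 : (J * star J) * star T * (J * star J) = star T * (J * star J) := by
    calc (J * star J) * star T * (J * star J) = J * star J * (star T * J) * star J := by
          simp only [mul_assoc]
      _ = J * (star J * J) * B * star J := by rw [hB]; simp only [mul_assoc]
      _ = star T * (J * star J) := by rw [hJ, mul_one, ← hB, mul_assoc]
  have h3 := congrArg star h2
  simp only [star_mul, star_star] at h3
  exact h3.symm.trans ((mul_assoc _ _ _).symm.trans h1)

/-- The compression `J* T J`. -/
def compress (J T : H →L[ℂ] H) : H →L[ℂ] H := star J * T * J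

/-- Since `J = J J* J`, a copy of `J J*` can be inserted on the right and moved past `T`; only the
right-hand factor has to commute with it. -/
theorem compress_mul {J S T : H →L[ℂ] H} (hJ : star J * J = 1) (hT : Commute (J * star J) T) :
    compress J (S * T) = compress J S * compress J T := by
  have : J = J * star J * J := by rw [mul_assoc, hJ, mul_one]
  calc star J * (S * T) * J = star J * S * (T * (J * star J)) * J := by
        nth_rw 2 [this]; simp only [mul_assoc]
    _ = _ := by rw [← hT.eq]; simp only [compress, mul_assoc]

theorem star_compress (J T : H →L[ℂ] H) : star (compress J T) = compress J (star T) := by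
  simp [compress, mul_assoc]

theorem compress_add (J S T : H →L[ℂ] H) :
    compress J (S + T) = compress J S + compress J T := by
  simp [compress, mul_add, add_mul]

theorem compress_one {J : H →L[ℂ] H} (hJ : star J * J = 1) : compress J 1 = 1 := by
  simp [compress, hJ]

end compress

/-! ### The representation of the quantum sphere -/

section sphereRep

variable {q : ℝ}

theorem sqrt_one_sub_pow_le_one (hq0 : 0 < q) (n : ℕ) : ‖(√(1 - q ^ n) : ℂ)‖ ≤ 1 := by
  rw [Complex.norm_real, Real.norm_of_nonneg (Real.sqrt_nonneg _)]
  exact Real.sqrt_le_one.2 (by linarith [pow_pos hq0 n])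

theorem norm_ofReal_pow_le_one (hq0 : 0 < q) (hq1 : q < 1) (n : ℕ) : ‖((q ^ n : ℝ) : ℂ)‖ ≤ 1 := by
  rw [Complex.norm_real, Real.norm_of_nonneg (by positivity)]
  exact pow_le_one₀ hq0.le hq1.le

theorem sqrt_mul_sqrt_one_sub (hq0 : 0 < q) (hq1 : q < 1) (n : ℕ) :
    (√(1 - q ^ n) : ℂ) * (√(1 - q ^ n) : ℂ) = 1 - (q : ℂ) ^ n := by
  rw [← Complex.ofReal_mul, Real.mul_self_sqrt (by linarith [pow_le_one₀ hq0.le hq1.le (n := n)])]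
  push_cast
  rfl

/-- The operator `e_{n+1} ↦ (1 - q ^ (2n+2)) ^ (1/2) e_n`, `e_0 ↦ 0`. -/
def opZ0 (hq0 : 0 < q) : Ell2 →L[ℂ] Ell2 :=
  diagOp (fun n => (√(1 - q ^ (2 * (n + 1))) : ℂ)) (fun _ => sqrt_one_sub_pow_le_one hq0 _) *
    star (reindex Nat.succ Nat.succ_injective)

/-- The operator `e_n ↦ q ^ (n+1) e_n`. -/
def opZ1 (hq0 : 0 < q) (hq1 : q < 1) : Ell2 →L[ℂ] Ell2 :=
  diagOp (fun n => ((q ^ (n + 1) : ℝ) : ℂ)) (fun _ => norm_ofReal_pow_le_one hq0 hq1 _)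

variable (hq0 : 0 < q) (hq1 : q < 1)

theorem opZ0_e_zero : opZ0 hq0 (e 0) = 0 := by
  rw [opZ0, mul_apply_eq_comp,
    star_reindex_e_of_notMem _ _ fun m => Nat.succ_ne_zero m, map_zero]

theorem opZ0_e_succ (n : ℕ) : opZ0 hq0 (e (n + 1)) = (√(1 - q ^ (2 * (n + 1))) : ℂ) • e n := by
  rw [opZ0, mul_apply_eq_comp]
  exact (congrArg _ (star_reindex_e Nat.succ Nat.succ_injective n)).trans (diagOp_e _ _ n)

theorem star_opZ0_e (n : ℕ) :
    star (opZ0 hq0) (e n) = (√(1 - q ^ (2 * (n + 1))) : ℂ) • e (n + 1) := by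
  rw [opZ0, star_mul, star_star, mul_apply_eq_comp, star_diagOp_e, map_smul, reindex_e]
  simp

theorem opZ1_e (n : ℕ) : opZ1 hq0 hq1 (e n) = ((q ^ (n + 1) : ℝ) : ℂ) • e n := diagOp_e _ _ n

theorem star_opZ1 : star (opZ1 hq0 hq1) = opZ1 hq0 hq1 :=
  Ell2.clm_ext fun n => by rw [opZ1_e, opZ1, star_diagOp_e]; simp

/-- The representation of the quantum sphere on the space of square summable sequences. -/
def sphereRep : OSphere q →⋆ₐ[ℂ] (Ell2 →L[ℂ] Ell2) :=
  have hq : (q : ℂ) ≠ 0 := by exact_mod_cast hq0.ne'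
  have h1 : opZ0 hq0 * opZ1 hq0 hq1 = (q : ℂ) • (opZ1 hq0 hq1 * opZ0 hq0) := by
    refine Ell2.clm_ext fun n => ?_
    cases n with
    | zero =>
      simp only [mul_apply_eq_comp, smul_apply, opZ1_e, opZ0_e_zero, map_smul, map_zero, smul_zero]
    | succ n =>
      simp only [mul_apply_eq_comp, smul_apply, opZ1_e, opZ0_e_succ, map_smul, smul_smul]
      congr 1; push_cast; ring
  have h6 : opZ0 hq0 * star (opZ0 hq0) + opZ1 hq0 hq1 * opZ1 hq0 hq1 = 1 := by
    refine Ell2.clm_ext fun n => ?_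
    simp only [mul_apply_eq_comp, add_apply, star_opZ0_e, opZ1_e, opZ0_e_succ, map_smul,
      smul_smul, ← add_smul, sqrt_mul_sqrt_one_sub hq0 hq1, one_apply_eq_self]
    convert one_smul ℂ (e n) using 2
    push_cast; ring
  OSphere.lift q (opZ0 hq0) (opZ1 hq0 hq1) h1 (by rw [star_opZ1, h1])
    (by
      have := congrArg star h1
      simp only [star_mul, star_smul, star_opZ1] at this
      rw [this, Complex.star_def, Complex.conj_ofReal])
    (by
      rw [star_opZ1]
      refine Ell2.clm_ext fun n => ?_
      cases n with
      | zero =>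
        simp only [mul_apply_eq_comp, add_apply, smul_apply, star_opZ0_e, opZ1_e,
          opZ0_e_zero, opZ0_e_succ, map_smul, smul_smul, map_zero, zero_add,
          sqrt_mul_sqrt_one_sub hq0 hq1]
        congr 1; push_cast; field_simp
      | succ n =>
        simp only [mul_apply_eq_comp, add_apply, smul_apply, star_opZ0_e, opZ1_e,
          opZ0_e_succ, map_smul, smul_smul, ← add_smul, sqrt_mul_sqrt_one_sub hq0 hq1]
        congr 1; push_cast; field_simp; ring)
    (by rw [star_opZ1]) (by rw [star_opZ1, h6])

theorem sphereRep_z0 : sphereRep hq0 hq1 (z₀ q) = opZ0 hq0 := by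
  unfold sphereRep
  exact UnivStarAlg.lift_gen _ _ 0

theorem sphereRep_z1 : sphereRep hq0 hq1 (z₁ q) = opZ1 hq0 hq1 := by
  unfold sphereRep
  exact UnivStarAlg.lift_gen _ _ 1

theorem opZ1_pow_e (k n : ℕ) :
    (opZ1 hq0 hq1 ^ k) (e n) = ((q ^ (k * (n + 1)) : ℝ) : ℂ) • e n := by
  induction k with
  | zero => simp
  | succ k ih =>
    rw [pow_succ, mul_apply_eq_comp, opZ1_e, map_smul, ih, smul_smul]
    congr 1; push_cast; ring

theorem opZ0_pow_e_add (l n : ℕ) : (opZ0 hq0 ^ l) (e (n + l)) =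
    ((∏ m ∈ Finset.range l, √(1 - q ^ (2 * (n + m + 1))) : ℝ) : ℂ) • e n := by
  induction l with
  | zero => simp
  | succ l ih =>
    rw [pow_succ, mul_apply_eq_comp, ← add_assoc, opZ0_e_succ, map_smul, ih, smul_smul,
      Finset.prod_range_succ]
    congr 1; push_cast; ring

theorem opZ0_pow_e_of_lt {l n : ℕ} (h : n < l) : (opZ0 hq0 ^ l) (e n) = 0 := by
  obtain ⟨m, rfl⟩ := Nat.exists_eq_add_of_lt h
  have h0 := opZ0_pow_e_add hq0 n 0
  rw [zero_add] at h0
  rw [show n + m + 1 = m + 1 + n by ring, pow_add, mul_apply_eq_comp, h0, map_smul,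
    pow_succ, mul_apply_eq_comp, opZ0_e_zero, map_zero, smul_zero]

theorem star_opZ0_pow_e (l n : ℕ) : (star (opZ0 hq0) ^ l) (e n) =
    ((∏ m ∈ Finset.range l, √(1 - q ^ (2 * (n + m + 1))) : ℝ) : ℂ) • e (n + l) := by
  induction l with
  | zero => simp
  | succ l ih =>
    rw [pow_succ', mul_apply_eq_comp, ih, map_smul, star_opZ0_e, smul_smul,
      Finset.prod_range_succ, ← add_assoc]
    congr 1; push_cast; ring

end sphereRep

end QuantumWPL

namespace QuantumWPL

/-! ### The representations of the quantum weighted projective line -/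

section lineRep

variable {q : ℝ} {k l t : ℕ}

theorem injective_mul_add (hl : 0 < l) : Function.Injective fun p => l * p + t := fun _ _ h =>
  Nat.eq_of_mul_eq_mul_left hl (Nat.add_right_cancel h)

/-- The isometry `e_p ↦ e_{lp+t}`. -/
def lineEmb (hl : 0 < l) (t : ℕ) : Ell2 →L[ℂ] Ell2 :=
  reindex (fun p => l * p + t) (injective_mul_add hl)

theorem lineEmb_e (hl : 0 < l) (p : ℕ) : lineEmb hl t (e p) = e (l * p + t) := reindex_e _ _ p

theorem star_lineEmb_e (hl : 0 < l) (p : ℕ) : star (lineEmb hl t) (e (l * p + t)) = e p :=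
  star_reindex_e (fun p => l * p + t) (injective_mul_add hl) p

theorem star_lineEmb_mul (hl : 0 < l) : star (lineEmb hl t) * lineEmb hl t = 1 :=
  star_reindex_mul_reindex _ _

theorem mul_lineEmb_eq (hl : 0 < l) {T : Ell2 →L[ℂ] Ell2}
    (h : ∀ p, ∃ (c : ℂ) (p' : ℕ), T (e (l * p + t)) = c • e (l * p' + t)) :
    T * lineEmb hl t = lineEmb hl t * (star (lineEmb hl t) * T * lineEmb hl t) := by
  refine Ell2.clm_ext fun p => ?_
  obtain ⟨c, p', h⟩ := h p
  simp only [mul_apply_eq_comp, lineEmb_e, h, map_smul, star_lineEmb_e]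

/-- If `T` and its adjoint send each `e_{lp+t}` to a multiple of a basis vector of the same residue
class, the closed span of that class is reducing for `T`. -/
theorem commute_of_maps_basis (hl : 0 < l) {T : Ell2 →L[ℂ] Ell2}
    (h : ∀ p, ∃ (c : ℂ) (p' : ℕ), T (e (l * p + t)) = c • e (l * p' + t))
    (h' : ∀ p, ∃ (c : ℂ) (p' : ℕ), (star T) (e (l * p + t)) = c • e (l * p' + t)) :
    Commute (lineEmb hl t * star (lineEmb hl t)) T :=
  commute_mul_star (star_lineEmb_mul hl) (mul_lineEmb_eq hl h) (mul_lineEmb_eq hl h')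

theorem commute_star {P T : Ell2 →L[ℂ] Ell2} (h : Commute (P * star P) T) :
    Commute (P * star P) (star T) := by
  simpa [Commute, SemiconjBy, eq_comm, mul_assoc] using congrArg star h.eq

variable (hq0 : 0 < q) (hq1 : q < 1)

theorem commute_opZ1_pow (hl : 0 < l) :
    Commute (lineEmb hl t * star (lineEmb hl t)) (opZ1 hq0 hq1 ^ k) :=
  commute_of_maps_basis hl (fun p => ⟨_, p, opZ1_pow_e hq0 hq1 k _⟩) fun p =>
    ⟨_, p, by rw [star_pow, star_opZ1]; exact opZ1_pow_e hq0 hq1 k _⟩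

theorem commute_opZ0_pow (hl : 0 < l) (ht : t < l) :
    Commute (lineEmb hl t * star (lineEmb hl t)) (opZ0 hq0 ^ l) :=
  commute_of_maps_basis hl (fun p => by
    cases p with
    -- Here `z₀ ^ l` kills `e_t` because `t < l`; the index in the witness is arbitrary.
    | zero => exact ⟨0, 0, by rw [opZ0_pow_e_of_lt hq0 (by lia), zero_smul]⟩
    | succ p => exact ⟨_, p, by
        rw [show l * (p + 1) + t = l * p + t + l by ring]
        exact opZ0_pow_e_add hq0 l _⟩) fun p =>
    ⟨_, p + 1, by
      rw [star_pow, show l * (p + 1) + t = l * p + t + l by ring]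
      exact star_opZ0_pow_e hq0 l _⟩

theorem commute_sphereRep_lineElt (hl : 0 < l) (ht : t < l) (i : Fin 2) :
    Commute (lineEmb hl t * star (lineEmb hl t)) (sphereRep hq0 hq1 (lineElt q k l i)) := by
  fin_cases i
  · simpa [lineElt, sphereRep_z1] using commute_opZ1_pow hq0 hq1 hl
  · simpa [lineElt, sphereRep_z0] using commute_opZ0_pow hq0 hl ht

theorem commute_sphereRep (hl : 0 < l) (hkl : Nat.Coprime k l) (ht : t < l) (x : OW q k l) :
    Commute (lineEmb hl t * star (lineEmb hl t)) (sphereRep hq0 hq1 x) := by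
  have hx : x ∈ StarAlgebra.adjoin ℂ {aElt q k l, bElt q k l} := by
    rw [adjoin_aElt_bElt hq0.ne' hl hkl]; trivial
  induction hx using StarAlgebra.adjoin_induction with
  | mem x hx =>
    obtain rfl | rfl := hx
    · change Commute _ (sphereRep hq0 hq1 (z₀ q ^ l * star (z₁ q) ^ k))
      rw [map_mul, map_pow, map_pow, map_star, sphereRep_z0, sphereRep_z1, ← star_pow]
      exact (commute_opZ0_pow hq0 hl ht).mul_right (commute_star (commute_opZ1_pow hq0 hq1 hl))
    · change Commute _ (sphereRep hq0 hq1 (z₁ q * star (z₁ q)))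
      rw [map_mul, map_star, sphereRep_z1, ← pow_one (opZ1 hq0 hq1)]
      exact (commute_opZ1_pow hq0 hq1 hl).mul_right (commute_star (commute_opZ1_pow hq0 hq1 hl))
  | algebraMap c =>
    change Commute _ (sphereRep hq0 hq1 (algebraMap ℂ (OSphere q) c))
    rw [AlgHomClass.commutes]
    exact Algebra.commute_algebraMap_right _ _
  | add x y _ _ hx hy =>
    change Commute _ (sphereRep hq0 hq1 ((x : OSphere q) + (y : OSphere q)))
    rw [map_add]
    exact hx.add_right hy
  | mul x y _ _ hx hy =>
    change Commute _ (sphereRep hq0 hq1 ((x : OSphere q) * (y : OSphere q)))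
    rw [map_mul]
    exact hx.mul_right hy
  | star x _ hx =>
    change Commute _ (sphereRep hq0 hq1 (star (x : OSphere q)))
    rw [map_star]
    exact commute_star hx

/-- The compression of the representation of the quantum sphere to the span of the `e_{lp+t}`. -/
def lineRep (hl : 0 < l) (hkl : Nat.Coprime k l) (ht : t < l) :
    OW q k l →⋆ₐ[ℂ] (Ell2 →L[ℂ] Ell2) where
  toFun x := compress (lineEmb hl t) (sphereRep hq0 hq1 x)
  map_one' := by
    rw [OneMemClass.coe_one, map_one, compress_one (star_lineEmb_mul hl)]
  map_mul' x y := by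
    rw [MulMemClass.coe_mul, map_mul,
      compress_mul (star_lineEmb_mul hl) (commute_sphereRep hq0 hq1 hl hkl ht y)]
  map_zero' := by simp [compress]
  map_add' x y := by rw [AddMemClass.coe_add, map_add, compress_add]
  commutes' c := by
    change compress _ (sphereRep hq0 hq1 (algebraMap ℂ (OSphere q) c)) = _
    rw [AlgHomClass.commutes, Algebra.algebraMap_eq_smul_one, compress, mul_smul_comm,
      smul_mul_assoc, ← compress, compress_one (star_lineEmb_mul hl),
      ← Algebra.algebraMap_eq_smul_one]
  map_star' x := by
    change compress _ (sphereRep hq0 hq1 (star (x : OSphere q))) = _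
    rw [map_star, star_compress]

theorem lineRep_apply (hl : 0 < l) (hkl : Nat.Coprime k l) (ht : t < l) (x : OW q k l) :
    lineRep hq0 hq1 hl hkl ht x = compress (lineEmb hl t) (sphereRep hq0 hq1 x) := rfl

theorem prod_range_sqrt_eq (l p t : ℕ) :
    ∏ m ∈ Finset.range l, √(1 - q ^ (2 * (l * p + t + m + 1))) =
      ∏ m ∈ Finset.Icc 1 l, √(1 - q ^ (2 * (l * (p + 1) + (t + 1) - m))) := by
  have hlp : l * (p + 1) = l * p + l := by ring
  refine Finset.prod_nbij' (fun m => l - m) (fun m => l - m) ?_ ?_ ?_ ?_ ?_ <;> intro m hm <;>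
    simp only [Finset.mem_range, Finset.mem_Icc] at hm ⊢
  · lia
  · lia
  · lia
  · lia
  · rw [hlp]
    congr 4
    lia

/-- The label is `t + 1` because `z₁` acts on `e_n` by `q ^ (n + 1)`, so `b` acts on `e_{lp+t}` by
`q ^ (2 (l p + t + 1))`. -/
theorem isPi_lineRep (hl : 0 < l) (hkl : Nat.Coprime k l) (ht : t < l) :
    IsPi q k l (t + 1) (lineRep hq0 hq1 hl hkl ht) := by
  have ha : sphereRep hq0 hq1 (aElt q k l) = opZ0 hq0 ^ l * opZ1 hq0 hq1 ^ k := by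
    change sphereRep hq0 hq1 (z₀ q ^ l * star (z₁ q) ^ k) = _
    rw [map_mul, map_pow, map_pow, map_star, sphereRep_z0, sphereRep_z1, star_opZ1]
  have hb : sphereRep hq0 hq1 (bElt q k l) = opZ1 hq0 hq1 * opZ1 hq0 hq1 := by
    change sphereRep hq0 hq1 (z₁ q * star (z₁ q)) = _
    rw [map_mul, map_star, sphereRep_z1, star_opZ1]
  refine ⟨fun p => ?_, ?_, fun p => ?_⟩
  · simp only [lineRep_apply, hb, compress, mul_apply_eq_comp, lineEmb_e, opZ1_e, map_smul,
      star_lineEmb_e, smul_smul]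
    congr 1; push_cast; ring
  · simp only [lineRep_apply, ha, compress, mul_apply_eq_comp, lineEmb_e, opZ1_pow_e, map_smul]
    rw [opZ0_pow_e_of_lt hq0 (by lia), map_zero, smul_zero]
  · simp only [lineRep_apply, ha, compress, mul_apply_eq_comp, lineEmb_e, opZ1_pow_e, map_smul]
    rw [show l * (p + 1) + t = l * p + t + l by ring, opZ0_pow_e_add, map_smul, star_lineEmb_e,
      smul_smul, ← Complex.ofReal_mul]
    congr 3
    · ring
    · exact prod_range_sqrt_eq l p t

/-- Values on the generators `a` and `b` determine the representation, so any given `π_s` may be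
replaced by the model `lineRep`. -/
theorem IsPi.ext (hq0 : 0 < q) (hl : 0 < l) (hkl : Nat.Coprime k l) {s : ℕ}
    {π π' : OW q k l →⋆ₐ[ℂ] (Ell2 →L[ℂ] Ell2)} (h : IsPi q k l s π) (h' : IsPi q k l s π') :
    π = π' := by
  refine StarAlgHom.ext_of_adjoin_eq_top (adjoin_aElt_bElt hq0.ne' hl hkl) ?_
  rintro _ (rfl | rfl)
  · refine Ell2.clm_ext fun n => ?_
    cases n with
    | zero => rw [h.map_a_zero, h'.map_a_zero]
    | succ n => rw [h.map_a_succ, h'.map_a_succ]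
  · exact Ell2.clm_ext fun n => by rw [h.map_b, h'.map_b]

theorem existsUnique_isPi (hq0 : 0 < q) (hq1 : q < 1) (hl : 0 < l) (hkl : Nat.Coprime k l) {s : ℕ}
    (hs : 1 ≤ s) (hsl : s ≤ l) : ∃! π, IsPi q k l s π := by
  obtain ⟨t, rfl⟩ := Nat.exists_eq_add_of_le' hs
  have ht : t < l := hsl
  have h := isPi_lineRep hq0 hq1 hl hkl ht
  exact ⟨lineRep hq0 hq1 hl hkl ht, h, fun π hπ => hπ.ext hq0 hl hkl h⟩

end lineRep

end QuantumWPL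

namespace QuantumWPL

/-! ### Functional calculus and eigenvectors -/

section eigenvector

variable {H : Type*} [NormedAddCommGroup H] [InnerProductSpace ℂ H]

theorem mem_spectrum_of_apply_eq {T : H →L[ℂ] H} {x : ℝ} {v : H} (hv : v ≠ 0)
    (h : T v = x • v) : x ∈ spectrum ℝ T := by
  refine spectrum.mem_iff.2 fun ⟨u, hu⟩ => hv ?_
  have h0 : (u : H →L[ℂ] H) v = 0 := by
    rw [hu, sub_apply, h, Algebra.algebraMap_eq_smul_one, smul_apply, one_apply_eq_self, sub_self]
  calc v = ((u⁻¹ : (H →L[ℂ] H)ˣ) * (u : H →L[ℂ] H)) v := by rw [Units.inv_mul, one_apply_eq_self]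
    _ = 0 := by rw [mul_apply_eq_comp, h0, map_zero]

/-- The functional calculus acts on eigenvectors through the eigenvalue. -/
theorem cfc_apply_of_apply_eq [CompleteSpace H] {T : H →L[ℂ] H} (hT : IsSelfAdjoint T) {f : ℝ → ℝ}
    (hf : ContinuousOn f (spectrum ℝ T)) {x : ℝ} {v : H} (h : T v = x • v) :
    cfc f T v = f x • v := by
  by_cases hv : v = 0
  · simp [hv]
  have hx := mem_spectrum_of_apply_eq hv h
  have key (g : C(spectrum ℝ T, ℝ)) : cfcHom hT g v = g ⟨x, hx⟩ • v := by
    induction g using ContinuousMap.induction_on_of_compact with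
    | const r =>
      have : ContinuousMap.const (spectrum ℝ T) r = algebraMap ℝ C(spectrum ℝ T, ℝ) r := rfl
      rw [this, AlgHomClass.commutes, Algebra.algebraMap_eq_smul_one, smul_apply,
        one_apply_eq_self]
      simp
    | id => rw [cfcHom_id hT, h]; rfl
    | star_id => rw [map_star, cfcHom_id hT, hT.star_eq, h]; rfl
    | add f g hf hg => rw [map_add, add_apply, hf, hg, ← add_smul]; rfl
    | mul f g hf hg =>
      rw [map_mul, mul_apply_eq_comp, hg, ContinuousLinearMap.map_smul_of_tower, hf,
        smul_smul, mul_comm]; rfl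
    | frequently f h =>
      refine h.mem_of_closed (isClosed_eq ?_ ?_)
      · exact ((ContinuousLinearMap.apply ℂ H v).continuous.comp (cfcHom_continuous hT))
      · fun_prop
  rw [cfc_apply f T hT hf]
  exact key _

theorem aeval_apply_of_apply_eq {T : H →L[ℂ] H} {x : ℂ} {v : H} (h : T v = x • v)
    (p : Polynomial ℂ) : Polynomial.aeval T p v = p.eval x • v := by
  induction p using Polynomial.induction_on' with
  | add p q hp hq => rw [map_add, add_apply, hp, hq, ← add_smul, Polynomial.eval_add]
  | monomial n a =>
    have hn (n : ℕ) : (T ^ n) v = x ^ n • v := by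
      induction n with
      | zero => simp
      | succ n ih => rw [pow_succ, mul_apply_eq_comp, h, map_smul, ih, smul_smul, pow_succ']
    rw [Polynomial.aeval_monomial, Polynomial.eval_monomial, Algebra.algebraMap_eq_smul_one,
      smul_one_mul, smul_apply, hn, smul_smul]

variable {H : Type} [NormedAddCommGroup H] [InnerProductSpace ℂ H] [CompleteSpace H] [Nontrivial H]
  {A : Type} [Ring A] [StarRing A] [Algebra ℂ A] (π : A →⋆ₐ[ℂ] (H →L[ℂ] H)) {y : CStarEnv A}

theorem extend_cfc (hy : IsSelfAdjoint y) {f : ℝ → ℝ} (hf : Continuous f) :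
    extend π (cfc f y) = cfc f (extend π y) :=
  StarAlgHom.map_cfc (p := IsSelfAdjoint) (q := IsSelfAdjoint) (extend π) f y hf.continuousOn
    (continuous_extend _) hy (hy.map (extend π))

theorem extend_cfc_apply (hy : IsSelfAdjoint y) {f : ℝ → ℝ} (hf : Continuous f) {x : ℝ} {v : H}
    (h : extend π y v = (x : ℂ) • v) : extend π (cfc f y) v = (f x : ℂ) • v := by
  rw [Complex.coe_smul] at h ⊢
  rw [extend_cfc π hy hf]
  exact cfc_apply_of_apply_eq (hy.map (extend π)) hf.continuousOn h

/-- Representations commute with the functional calculus, so positivity is needed only for the image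
of `y`, not in the envelope. -/
theorem extend_cfc_sqrt_mul_self (hy : IsSelfAdjoint y) (h : 0 ≤ extend π y) :
    extend π (cfc Real.sqrt y) * extend π (cfc Real.sqrt y) = extend π y := by
  have hsa : IsSelfAdjoint (extend π y) := hy.map (extend π)
  rw [extend_cfc π hy Real.continuous_sqrt, ← cfc_mul _ _ _ (by fun_prop) (by fun_prop)]
  conv_rhs => rw [← cfc_id' ℝ (extend π y)]
  exact cfc_congr fun x hx => Real.mul_self_sqrt (spectrum_nonneg_of_nonneg h hx)

theorem star_extend_cfc (f : ℝ → ℝ) : star (extend π (cfc f y)) = extend π (cfc f y) := by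
  rw [← map_star, (cfc_predicate f y : IsSelfAdjoint _).star_eq]

end eigenvector

/-! ### Diagonal, nuclear and compact operators on the sequence space. -/

section diagonal

open ComplexOrder in
theorem nonneg_of_apply_e_eq {T : Ell2 →L[ℂ] Ell2} {d : ℕ → ℝ} (hd : ∀ n, 0 ≤ d n)
    (h : ∀ n, T (e n) = (d n : ℂ) • e n) : 0 ≤ T := by
  rw [ContinuousLinearMap.nonneg_iff_isPositive, ContinuousLinearMap.isPositive_iff]
  have key (x y : Ell2) : HasSum (fun n => (d n : ℂ) * (x n * star (y n))) ⟪y, T x⟫_ℂ := by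
    have h1 : HasSum (fun n => ⟪y, T (x n • e n)⟫_ℂ) ⟪y, T x⟫_ℂ :=
      ((hasSum_e x).mapL T).mapL (innerSL ℂ y)
    convert h1 using 2 with n
    rw [map_smul, h, inner_smul_right, inner_smul_right, ← inner_conj_symm, inner_e_left,
      Complex.star_def]
    ring
  constructor
  · intro x y
    change ⟪T x, y⟫_ℂ = ⟪x, T y⟫_ℂ
    have h1 := (key x y).star
    rw [← starRingEnd_apply, inner_conj_symm] at h1
    have h2 : (fun n => (d n : ℂ) * (y n * star (x n))) =
        fun n => star ((d n : ℂ) * (x n * star (y n))) := by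
      ext n
      simp [mul_comm]
    exact h1.unique (h2 ▸ key y x)
  · intro x
    have h1 := (key x x).star
    rw [← starRingEnd_apply, inner_conj_symm] at h1
    refine h1.nonneg fun n => ?_
    have : star ((d n : ℂ) * (x n * star (x n))) = ((d n * ‖x n‖ ^ 2 : ℝ) : ℂ) := by
      simp [Complex.mul_conj']
    rw [this]
    exact_mod_cast mul_nonneg (hd n) (sq_nonneg _)

/-- The expansion `T = ∑ |T e_n⟩⟨e_n|` converges in norm and can be checked on basis vectors. -/
theorem isNuclearSum_of_summable {F : Type} [NormedAddCommGroup F] [InnerProductSpace ℂ F]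
    [CompleteSpace F] {T : Ell2 →L[ℂ] F} (h : Summable fun n => ‖T (e n)‖) :
    IsNuclearSum T (fun n => T (e n)) e := by
  have h1 : Summable fun n => ‖T (e n)‖ * ‖e n‖ := by simpa [norm_e] using h
  refine ⟨h1, ?_⟩
  have h2 : Summable fun n => InnerProductSpace.rankOne ℂ (T (e n)) (e n) :=
    .of_norm (by simpa using h1)
  convert h2.hasSum
  refine Ell2.clm_ext fun m => ?_
  have h3 := h2.hasSum.mapL (ContinuousLinearMap.apply ℂ F (e m))
  refine HasSum.unique ?_ h3
  convert hasSum_ite_eq m (T (e m)) using 2 with n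
  simp only [ContinuousLinearMap.apply_apply, InnerProductSpace.rankOne_apply, inner_e_e]
  split_ifs with hmn <;> simp [hmn]

theorem hasTrace_of_apply_e_eq {T : Ell2 →L[ℂ] Ell2} {d : ℕ → ℂ} {t : ℂ} (hd : HasSum d t)
    (h : ∀ n, T (e n) = d n • e n) : HasTrace T t := by
  refine ⟨ℕ, _, _, isNuclearSum_of_summable ?_, ?_⟩
  · simpa [h, norm_smul, norm_e] using hd.summable.norm
  · simpa [h, inner_smul_right, norm_e] using hd

theorem HasTrace.hasSum_of_apply_e_eq {T : Ell2 →L[ℂ] Ell2} {d : ℕ → ℂ} {t : ℂ}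
    (hT : HasTrace T t) (h : ∀ n, T (e n) = d n • e n) : HasSum d t := by
  have hb (n : ℕ) : (HilbertBasis.ofRepr (LinearIsometryEquiv.refl ℂ Ell2)) n = e n := by
    rw [← HilbertBasis.repr_symm_single]
    rfl
  have := hT.hasSum_hilbertBasis (HilbertBasis.ofRepr (LinearIsometryEquiv.refl ℂ Ell2))
  simpa [hb, h, inner_smul_right, norm_e] using this

theorem IsNuclear.star {E : Type} [NormedAddCommGroup E] [InnerProductSpace ℂ E] [CompleteSpace E]
    {T : E →L[ℂ] E} (h : IsNuclear T) : IsNuclear (star T) := by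
  obtain ⟨ι, u, v, h1, h2⟩ := h
  refine ⟨ι, v, u, by simpa only [mul_comm] using h1, ?_⟩
  simpa only [ContinuousLinearMap.star_eq_adjoint, InnerProductSpace.adjoint_rankOne] using h2.star

theorem e₀₀_eq : e₀₀ = InnerProductSpace.rankOne ℂ (e 0) (e 0) := by
  ext1 x
  rw [e₀₀, Submodule.starProjection_unit_singleton ℂ (norm_e 0), InnerProductSpace.rankOne_apply]

theorem not_isCompactOperator_smul_one {c : ℂ} (hc : c ≠ 0) :
    ¬ IsCompactOperator (c • (1 : Ell2 →L[ℂ] Ell2)) := by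
  intro h
  have h1 : IsCompactOperator (id : Ell2 → Ell2) := by
    have h2 : (id : Ell2 → Ell2) = c⁻¹ • ⇑(c • (1 : Ell2 →L[ℂ] Ell2)) := by
      funext x
      simp [smul_smul, hc]
    rw [h2]
    exact h.smul c⁻¹
  have := (isCompactOperator_id_iff_finiteDimensional (𝕜 := ℂ)).1 h1
  have := orthonormal_e.linearIndependent.finite
  exact not_finite ℕ

end diagonal

/-! ### The projections `p_r` -/

section projection

variable {q : ℝ} {k l : ℕ}

/-- A continuous function which vanishes at `0` and at all powers `q ^ (2n)` except `q ^ (2r)`. -/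
def bump (q : ℝ) (r : ℕ) (x : ℝ) : ℝ := max 0 (1 - |x - q ^ (2 * r)| / (q ^ (2 * r) * (1 - q ^ 2)))

theorem continuous_bump (q : ℝ) (r : ℕ) : Continuous (bump q r) := by
  unfold bump
  fun_prop

theorem bump_zero (hq0 : 0 < q) (hq1 : q < 1) (r : ℕ) : bump q r 0 = 0 := by
  have h1 : 0 < 1 - q ^ 2 := by nlinarith
  refine max_eq_left ?_
  rw [sub_nonpos, one_le_div (by positivity), zero_sub, abs_neg, abs_of_pos (by positivity)]
  nlinarith [pow_pos hq0 (2 * r), pow_pos hq0 2]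

/-- The half-width `q ^ (2r) (1 - q ^ 2)` is the distance from `q ^ (2r)` to its nearest neighbour
`q ^ (2r + 2)`; all other powers are at least as far away. -/
theorem bump_pow (hq0 : 0 < q) (hq1 : q < 1) (r n : ℕ) :
    bump q r (q ^ (2 * n)) = if n = r then 1 else 0 := by
  have h1 : 0 < 1 - q ^ 2 := by nlinarith
  split_ifs with h
  · simp [bump, h]
  · refine max_eq_left ?_
    rw [sub_nonpos, one_le_div (by positivity)]
    have hr := pow_pos hq0 (2 * r)
    obtain h | h := Nat.lt_or_gt_of_ne h
    · have h2 : q ^ (2 * r) ≤ q ^ (2 * n) * q ^ 2 := by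
        rw [← pow_add]
        exact pow_le_pow_of_le_one hq0.le hq1.le (by lia)
      have h3 := pow_pos hq0 (2 * n)
      have h4 : q ^ (2 * r) ≤ q ^ (2 * n) := pow_le_pow_of_le_one hq0.le hq1.le (by lia)
      refine le_trans ?_ (le_abs_self _)
      nlinarith
    · have h2 : q ^ (2 * n) ≤ q ^ (2 * r) * q ^ 2 := by
        rw [← pow_add]
        exact pow_le_pow_of_le_one hq0.le hq1.le (by lia)
      rw [abs_sub_comm]
      refine le_trans ?_ (le_abs_self _)
      linarith

/-- The element is `bump q r` applied to `b`. It is idempotent because the function takes only the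
values `0` and `1` on the spectrum of `b`. -/
theorem exists_isProj (hq0 : 0 < q) (hq1 : q < 1) (hl : 0 < l) (hkl : Nat.Coprime k l)
    {π : ℕ → OW q k l →⋆ₐ[ℂ] (Ell2 →L[ℂ] Ell2)}
    (hπ : ∀ s, 1 ≤ s → s ≤ l → IsPi q k l s (π s)) {r : ℕ} (hr : 1 ≤ r) (hrl : r ≤ l) :
    ∃ p, IsProj q k l π r p := by
  have hA := isBoundedElt_OW hq0 hq1 hl hkl
  set b := toEnvHom hA (bElt q k l) with hb
  have hbsa : IsSelfAdjoint b := by rw [hb, IsSelfAdjoint, ← map_star, star_bElt]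
  have hspec {x : ℝ} (hx : x ∈ spectrum ℝ b) : x = 0 ∨ ∃ n, 1 ≤ n ∧ x = q ^ (2 * n) := by
    refine real_spectrum_subset (a := toEnvHom hA (aElt q k l)) (k := k) hq0 hq1 hl hbsa ?_ ?_ hx
    · rw [hb, ← map_mul, aElt_mul_bElt, map_smul, map_mul]
    · rw [← map_star, ← map_mul, star_aElt_mul_aElt hq0.ne']
      exact (Polynomial.aeval_algHom_apply (toEnvHom hA) _ _).symm
  have hc := (continuous_bump q r).continuousOn (s := spectrum ℝ b)
  refine ⟨cfc (bump q r) b, ⟨?_, cfc_predicate _ _⟩, fun s hs hsl => ?_⟩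
  · rw [IsIdempotentElem, ← cfc_mul _ _ b hc hc]
    refine cfc_congr fun x hx => ?_
    obtain rfl | ⟨n, -, rfl⟩ := hspec hx
    · simp [bump_zero hq0 hq1]
    · simp [bump_pow hq0 hq1]
  · have h1 : extend (π s) b = π s (bElt q k l) := extend_toEnv _ (hA _)
    refine Ell2.clm_ext fun n => ?_
    have h3 : π s (bElt q k l) (e n) = ((q ^ (2 * (l * n + s)) : ℝ) : ℂ) • e n := by
      rw [(hπ s hs hsl).map_b]
      congr 2
      ring
    rw [extend_cfc_apply (π s) hbsa (continuous_bump q r) (h1 ▸ h3), bump_pow hq0 hq1]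
    -- Since `1 ≤ s` and `r ≤ l`, the eigenvalue `q ^ (2r)` of `b` can occur only at `n = 0`, and
    -- only for `s = r`.
    have h4 : l * n + s = r ↔ n = 0 ∧ s = r := by
      constructor
      · intro h
        have : n = 0 := by
          by_contra hn
          have : l * 1 ≤ l * n := Nat.mul_le_mul_left l (Nat.one_le_iff_ne_zero.2 hn)
          lia
        subst this
        simpa using h
      · rintro ⟨rfl, rfl⟩
        simp
    by_cases hsr : s = r
    · rw [if_pos hsr, e₀₀_eq, InnerProductSpace.rankOne_apply, inner_e_e]
      by_cases hn : n = 0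
      · simp [hn, hsr]
      · simp [h4, hn, Ne.symm hn]
    · simp [h4, hsr]

end projection

end QuantumWPL

namespace QuantumWPL

open Polynomial

/-! ### Real polynomials in self-adjoint elements -/

section realPoly

theorem star_aeval {B : Type*} [Ring B] [StarRing B] [Algebra ℂ B] [StarModule ℂ B] (x : B)
    (p : ℂ[X]) : star (aeval x p) = aeval (star x) (p.map (starRingEnd ℂ)) := by
  induction p using Polynomial.induction_on' with
  | add p q hp hq => rw [map_add, star_add, hp, hq, Polynomial.map_add, map_add]
  | monomial n a =>
    rw [aeval_monomial, Polynomial.map_monomial, aeval_monomial, star_mul, star_pow,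
      ← algebraMap_star_comm, Algebra.commutes, Complex.star_def]

/-- On monomials this is `v (u v) ^ n u = (v u) ^ (n + 1)`. It turns `(z₀*) ^ l G(z₀ ^ l (z₀*) ^ l)
z₀ ^ l` into a polynomial in `(z₀*) ^ l z₀ ^ l`. -/
theorem mul_aeval_mul {B : Type*} [Ring B] [Algebra ℂ B] (u v : B) (p : ℂ[X]) :
    v * aeval (u * v) p * u = aeval (v * u) (p * X) := by
  induction p using Polynomial.induction_on' with
  | add p q hp hq => rw [map_add, mul_add, add_mul, hp, hq, add_mul, map_add]
  | monomial n a =>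
    have h : v * (u * v) ^ n * u = (v * u) ^ (n + 1) := by
      induction n with
      | zero => simp
      | succ n ih => rw [pow_succ' (u * v), pow_succ' _ (n + 1), ← ih]; simp only [mul_assoc]
    rw [monomial_mul_X, aeval_monomial, aeval_monomial, ← h, ← Algebra.smul_def, mul_smul_comm,
      smul_mul_assoc, ← Algebra.smul_def]

variable (q : ℝ) (l : ℕ)

theorem map_lowerPoly : (lowerPoly q l).map (starRingEnd ℂ) = lowerPoly q l := by
  simp [lowerPoly, Polynomial.map_prod]

theorem map_upperPoly : (upperPoly q l).map (starRingEnd ℂ) = upperPoly q l := by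
  simp [upperPoly, Polynomial.map_prod]

theorem map_polyF : (polyF q l).map (starRingEnd ℂ) = polyF q l := by
  refine mul_right_cancel₀ X_ne_zero ?_
  have := congrArg (Polynomial.map (starRingEnd ℂ)) (polyF_mul_X q l)
  rwa [Polynomial.map_mul, Polynomial.map_X, Polynomial.map_sub, Polynomial.map_one,
    map_lowerPoly, ← polyF_mul_X] at this

theorem map_polyG (k : ℕ) : (polyG k).map (starRingEnd ℂ) = polyG k := by
  refine mul_right_cancel₀ X_ne_zero ?_
  have := congrArg (Polynomial.map (starRingEnd ℂ)) (polyG_mul_X k)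
  rwa [Polynomial.map_mul, Polynomial.map_X, Polynomial.map_sub, Polynomial.map_pow,
    Polynomial.map_sub, Polynomial.map_one, Polynomial.map_X, ← polyG_mul_X] at this

end realPoly

/-! ### The elements under the square roots in `ξ`, and the identity `Ψ* Ψ = 1`. -/

section polyElt

variable {q : ℝ} {k l : ℕ}

variable (q k l) in
/-- The elements `F(z₁ z₁*) ^ k` and `G(z₀ ^ l (z₀*) ^ l)`. -/
def polyElt : Fin 2 → OW q k l :=
  ![aeval (bElt q k l) (polyF q l) ^ k, aeval (cElt q k l) (polyG k)]

theorem ξ_eq (i : Fin 2) : ξ q k l i = cfc Real.sqrt (toEnv (polyElt q k l i)) := by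
  fin_cases i <;> rfl

theorem star_cElt : star (cElt q k l) = cElt q k l := by
  rw [cElt_eq, star_aeval, star_bElt, map_upperPoly]

theorem star_polyElt (i : Fin 2) : star (polyElt q k l i) = polyElt q k l i := by
  fin_cases i
  · simp [polyElt, star_aeval, star_bElt, map_polyF]
  · simp [polyElt, star_aeval, star_cElt, map_polyG]

theorem isSelfAdjoint_toEnv_polyElt (hA : ∀ x : OW q k l, IsBoundedElt x) (i : Fin 2) :
    IsSelfAdjoint (toEnv (polyElt q k l i)) := by
  rw [IsSelfAdjoint, ← toEnvHom_apply hA, ← map_star, star_polyElt]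

/-- The columns of `Ψ` form an isometry. -/
theorem sum_star_lineElt_mul (hq : q ≠ 0) :
    star (lineElt q k l 0) * polyElt q k l 0 * lineElt q k l 0 +
      star (lineElt q k l 1) * polyElt q k l 1 * lineElt q k l 1 = 1 := by
  have h0 : (polyElt q k l 0 : OSphere q) = aeval (bS q) (polyF q l ^ k) := by
    rw [map_pow, ← coe_bElt (k := k) (l := l), ← coe_aeval_OW]; rfl
  have h1 : (polyElt q k l 1 : OSphere q) = aeval (z₀ q ^ l * star (z₀ q) ^ l) (polyG k) :=
    coe_aeval_OW _ _
  have h2 : lineElt q k l 0 = z₁ q ^ k := rfl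
  have h3 : lineElt q k l 1 = z₀ q ^ l := rfl
  have h4 : Commute (star (z₁ q)) (z₁ q) := (z1_z1s q).symm
  rw [h0, h1, h2, h3, star_pow, star_pow, mul_aeval_mul, z0s_pow_mul_z0_pow hq, mul_assoc,
    ← ((commute_z1_aeval _).pow_left k).eq, ← mul_assoc, (h4.pow_pow k k).eq, z1_pow_mul_z1s_pow]
  -- With `L` the value of `lowerPoly` at `b`, the first summand is `(1 - L) ^ k`; the second is `1
  -- - (1 - L) ^ k` by `polyG_mul_X`.
  have h5 : bS q ^ k * aeval (bS q) (polyF q l ^ k) = aeval (bS q) ((1 - lowerPoly q l) ^ k) := by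
    rw [← polyF_mul_X, mul_pow, mul_comm (polyF q l ^ k), map_mul, map_pow, map_pow, aeval_X]
  rw [h5, polyG_mul_X]
  simp

end polyElt

/-! ### The counit -/

section counit

variable {q : ℝ} {k l : ℕ}

variable (q) in
/-- The character `z₀ ↦ 1`, `z₁ ↦ 0` of the quantum sphere. -/
def sphereCounit : OSphere q →⋆ₐ[ℂ] ℂ :=
  OSphere.lift q (1 : ℂ) 0 (by simp) (by simp) (by simp) (by simp) (by simp) (by simp)

theorem sphereCounit_z0 : sphereCounit q (z₀ q) = 1 := by
  unfold sphereCounit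
  exact UnivStarAlg.lift_gen _ _ 0

theorem sphereCounit_z1 : sphereCounit q (z₁ q) = 0 := by
  unfold sphereCounit
  exact UnivStarAlg.lift_gen _ _ 1

theorem counit_apply (x : OW q k l) : counit q k l x = sphereCounit q x := rfl

theorem sphereCounit_lineElt (hk : 0 < k) (i : Fin 2) :
    sphereCounit q (lineElt q k l i) = if i = 0 then 0 else 1 := by
  fin_cases i
  · simp [lineElt, sphereCounit_z1, hk.ne']
  · simp [lineElt, sphereCounit_z0]

/-- As `k > 0`, the counit kills `z₁ ^ k`, so only the lower right corner survives. -/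
theorem counit_sandwich (hk : 0 < k) (i j : Fin 2) (x : OW q k l) :
    counit q k l (sandwich q k l i j x) =
      (if i = 0 then 0 else 1) * counit q k l x * (if j = 0 then 0 else 1) := by
  change sphereCounit q (lineElt q k l i * (x : OSphere q) * star (lineElt q k l j)) = _
  rw [map_mul, map_mul, map_star, sphereCounit_lineElt hk, sphereCounit_lineElt hk, counit_apply]
  split_ifs <;> simp

theorem counit_aElt (hk : 0 < k) : counit q k l (aElt q k l) = 0 := by
  change sphereCounit q (z₀ q ^ l * star (z₁ q) ^ k) = 0
  rw [map_mul, map_pow, map_pow, map_star, sphereCounit_z1, star_zero, zero_pow hk.ne', mul_zero]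

theorem counit_bElt : counit q k l (bElt q k l) = 0 := by
  change sphereCounit q (z₁ q * star (z₁ q)) = 0
  rw [map_mul, sphereCounit_z1, zero_mul]

theorem counit_cElt : counit q k l (cElt q k l) = 1 := by
  change sphereCounit q (z₀ q ^ l * star (z₀ q) ^ l) = 1
  rw [map_mul, map_pow, map_pow, map_star, sphereCounit_z0]
  simp

theorem counit_polyElt_one (hk : 0 < k) : counit q k l (polyElt q k l 1) = 1 := by
  have h : (polyG k).eval 1 = 1 := by
    have := congrArg (Polynomial.eval 1) (polyG_mul_X k)
    simpa [hk.ne'] using this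
  change counit q k l (aeval (cElt q k l) (polyG k)) = 1
  rw [← aeval_algHom_apply, counit_cElt, coe_aeval_eq_eval, h]

variable {H : Type} [NormedAddCommGroup H] [InnerProductSpace ℂ H] [CompleteSpace H]
  [Nontrivial H]

theorem extend_scalarRep_toEnv (hA : ∀ x : OW q k l, IsBoundedElt x) (x : OW q k l) :
    extend (scalarRep (counit q k l) H) (toEnv x) = counit q k l x • (1 : H →L[ℂ] H) :=
  extend_toEnv _ (hA x)

theorem extend_scalarRep_ξ_one (hA : ∀ x : OW q k l, IsBoundedElt x) (hk : 0 < k) :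
    extend (scalarRep (counit q k l) H) (ξ q k l 1) = 1 := by
  ext v
  rw [ξ_eq, extend_cfc_apply (x := 1) _ (isSelfAdjoint_toEnv_polyElt hA 1) Real.continuous_sqrt]
  · simp
  · rw [extend_scalarRep_toEnv hA, counit_polyElt_one hk]
    simp

/-- The extension of the counit to the envelope. -/
theorem extend_scalarRep_eq (hA : ∀ x : OW q k l, IsBoundedElt x) (y : CW q k l) :
    extend (scalarRep (counit q k l) H) y =
      (extend (scalarRep (counit q k l) ℂ) y (1 : ℂ)) • (1 : H →L[ℂ] H) := by
  refine (denseRange_toEnv hA).induction_on y (isClosed_eq (continuous_extend _) ?_) fun x => ?_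
  · exact ((ContinuousLinearMap.apply ℂ ℂ (1 : ℂ)).continuous.comp (continuous_extend _)).smul
      continuous_const
  · rw [extend_scalarRep_toEnv hA, extend_scalarRep_toEnv hA]
    simp

end counit

/-! ### Block homomorphisms -/

section blockHom

variable {E : Type} [NormedAddCommGroup E] [InnerProductSpace ℂ E] [CompleteSpace E]

/-- The homomorphism `T ↦ V T V*` for a column `V` with `V* V = 1`. -/
def conjBlock (V : Fin 2 → E →L[ℂ] E) (hV : star (V 0) * V 0 + star (V 1) * V 1 = 1) :
    (E →L[ℂ] E) →⋆ₙₐ[ℂ] (Two E →L[ℂ] Two E) where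
  toFun T := blockOp (Matrix.of fun i j => V i * T * star (V j))
  map_zero' := by
    rw [← blockOp_zero]
    congr 1
    ext1 i j
    simp
  map_add' S T := by
    rw [blockOp_add]
    congr 1
    ext1 i j
    simp [mul_add, add_mul]
  map_mul' S T := by
    rw [blockOp_mul]
    congr 1
    ext1 i j
    have h : V i * (S * T) * star (V j) =
        V i * S * (star (V 0) * V 0 + star (V 1) * V 1) * T * star (V j) := by
      rw [hV]
      simp only [mul_assoc, one_mul]
    simp only [Matrix.mul_apply, Fin.sum_univ_two, Matrix.of_apply, h]
    simp only [mul_add, add_mul, mul_assoc]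
  map_smul' c T := by
    rw [MonoidHom.id_apply, blockOp_smul]
    congr 1
    ext1 i j
    simp
  map_star' T := by
    rw [star_blockOp]
    congr 1
    ext1 i j
    simp [Matrix.star_apply, mul_assoc]

theorem conjBlock_apply (V : Fin 2 → E →L[ℂ] E) (hV : star (V 0) * V 0 + star (V 1) * V 1 = 1)
    (T : E →L[ℂ] E) : conjBlock V hV T = blockOp (Matrix.of fun i j => V i * T * star (V j)) := rfl

/-- The column is a single isometry `E → E ⊕ E`, so `HasTrace.comp` applies with `c = 1`. -/
theorem hasTrace_conjBlock {V : Fin 2 → E →L[ℂ] E} (hV : star (V 0) * V 0 + star (V 1) * V 1 = 1)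
    {T : E →L[ℂ] E} {t : ℂ} (hT : HasTrace T t) : HasTrace (conjBlock V hV T) t := by
  have h := hT.comp (c := 1) (A := incl E 0 ∘L V 0 + incl E 1 ∘L V 1)
    (B := star (V 0) ∘L coord E 0 + star (V 1) ∘L coord E 1) fun x => by
      have := congrArg (fun S : E →L[ℂ] E => S x) hV
      simpa [incl_apply] using this
  rw [one_mul] at h
  convert h using 1
  ext v i
  fin_cases i <;> simp [conjBlock_apply, blockOp_apply, incl_apply]

/-- The direct sum of two homomorphisms. -/
def diagHom {B : Type*} [NonUnitalRing B] [StarRing B] [Module ℂ B]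
    (f g : B →⋆ₙₐ[ℂ] (E →L[ℂ] E)) : B →⋆ₙₐ[ℂ] (Two E →L[ℂ] Two E) where
  toFun b := blockOp !![f b, 0; 0, g b]
  map_zero' := by
    rw [map_zero, map_zero, ← blockOp_zero]
    congr 1
    ext1 i j
    fin_cases i <;> fin_cases j <;> rfl
  map_add' x y := by simp [blockOp_add]
  map_mul' x y := by simp [blockOp_mul]
  map_smul' c x := by simp [blockOp_smul]
  map_star' x := by
    rw [map_star, map_star, star_blockOp]
    congr 1
    ext1 i j
    fin_cases i <;> fin_cases j <;> simp [Matrix.star_apply]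

theorem diagHom_apply {B : Type*} [NonUnitalRing B] [StarRing B] [Module ℂ B]
    (f g : B →⋆ₙₐ[ℂ] (E →L[ℂ] E)) (b : B) : diagHom f g b = blockOp !![f b, 0; 0, g b] := rfl

end blockHom

end QuantumWPL

namespace QuantumWPL

open Polynomial

/-! ### Eigenvalues of diagonal operators in the representation -/

section eigenvalues

variable {q : ℝ} {k l t : ℕ}

variable (q l t) in
/-- The eigenvalues of `b`. -/
def bEigen (n : ℕ) : ℝ := q ^ (2 * (l * n + t + 1))

variable (q l t) in
/-- The eigenvalues of `(z₀*) ^ l z₀ ^ l`. -/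
def cEigen : ℕ → ℝ
  | 0 => 0
  | n + 1 => ∏ m ∈ Finset.range l, (1 - q ^ (2 * m) * bEigen q l t n)

theorem bEigen_pos (hq0 : 0 < q) (n : ℕ) : 0 < bEigen q l t n := pow_pos hq0 _

theorem pow_mul_bEigen_lt_one (hq0 : 0 < q) (hq1 : q < 1) (m n : ℕ) :
    q ^ (2 * m) * bEigen q l t n < 1 := by
  rw [bEigen, ← pow_add]
  exact pow_lt_one₀ hq0.le hq1 (by lia)

theorem cEigen_succ_pos (hq0 : 0 < q) (hq1 : q < 1) (n : ℕ) : 0 < cEigen q l t (n + 1) :=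
  Finset.prod_pos fun m _ => sub_pos.2 (pow_mul_bEigen_lt_one hq0 hq1 m n)

theorem cEigen_le_one (hq0 : 0 < q) (hq1 : q < 1) (n : ℕ) : cEigen q l t n ≤ 1 := by
  cases n with
  | zero => exact zero_le_one
  | succ n =>
    exact Finset.prod_le_one (fun m _ => (sub_pos.2 (pow_mul_bEigen_lt_one hq0 hq1 m n)).le)
      fun m _ => sub_le_self _ (mul_pos (pow_pos hq0 _) (bEigen_pos hq0 n)).le

/-- The eigenvalues of `z₀ ^ l (z₀*) ^ l` are those of `(z₀*) ^ l z₀ ^ l` shifted by one index. This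
shift is what makes the trace telescope. -/
theorem eval_upperPoly_bEigen (n : ℕ) :
    (upperPoly q l).eval (bEigen q l t n : ℂ) = (cEigen q l t (n + 1) : ℂ) := by
  rw [upperPoly, eval_prod, cEigen]
  push_cast
  simp

/-- At `n = 0` the factor with `m = t + 1` vanishes, which is where `t < l` enters. Otherwise the
substitution `m ↦ l - m` matches the two products. -/
theorem eval_lowerPoly_bEigen (hq0 : 0 < q) (ht : t < l) (n : ℕ) :
    (lowerPoly q l).eval (bEigen q l t n : ℂ) = (cEigen q l t n : ℂ) := by
  have hq : (q : ℂ) ≠ 0 := by exact_mod_cast hq0.ne'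
  rw [lowerPoly, eval_prod]
  cases n with
  | zero =>
    rw [cEigen, Complex.ofReal_zero]
    refine Finset.prod_eq_zero (Finset.mem_Icc.2 ⟨t.succ_pos, ht⟩) ?_
    simp [bEigen, hq]
  | succ n =>
    rw [cEigen]
    push_cast
    refine Finset.prod_nbij' (fun m => l - m) (fun m => l - m) ?_ ?_ ?_ ?_ ?_ <;> intro m hm <;>
      simp only [Finset.mem_range, Finset.mem_Icc] at hm ⊢
    · lia
    · lia
    · lia
    · lia
    · have h : 2 * (l * (n + 1) + t + 1) = 2 * m + (2 * (l - m) + 2 * (l * n + t + 1)) := by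
        have : l * (n + 1) = l * n + l := by ring
        lia
      simp only [eval_sub, eval_one, eval_mul, eval_C, eval_X, bEigen]
      push_cast
      rw [h, pow_add, pow_add, inv_mul_cancel_left₀ (pow_ne_zero _ hq)]

theorem eval_polyF_bEigen (hq0 : 0 < q) (ht : t < l) (n : ℕ) :
    (polyF q l).eval (bEigen q l t n : ℂ) =
      (((1 - cEigen q l t n) / bEigen q l t n : ℝ) : ℂ) := by
  have h := congrArg (Polynomial.eval (bEigen q l t n : ℂ)) (polyF_mul_X q l)
  rw [eval_mul, eval_X, eval_sub, eval_one, eval_lowerPoly_bEigen hq0 ht] at h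
  push_cast
  rw [← h, mul_div_cancel_right₀]
  exact_mod_cast (bEigen_pos hq0 n).ne'

theorem eval_polyG {x : ℝ} (hx : x ≠ 0) :
    (polyG k).eval (x : ℂ) = (((1 - (1 - x) ^ k) / x : ℝ) : ℂ) := by
  have h := congrArg (Polynomial.eval (x : ℂ)) (polyG_mul_X k)
  rw [eval_mul, eval_X, eval_sub, eval_pow, eval_sub, eval_one, eval_X] at h
  push_cast
  rw [← h, mul_div_cancel_right₀]
  exact_mod_cast hx

variable (q k l t) in
/-- The eigenvalues of the elements `polyElt q k l i`. -/
def polyEigen (i : Fin 2) (n : ℕ) : ℝ :=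
  if i = 0 then ((1 - cEigen q l t n) / bEigen q l t n) ^ k
  else (1 - (1 - cEigen q l t (n + 1)) ^ k) / cEigen q l t (n + 1)

theorem polyEigen_nonneg (hq0 : 0 < q) (hq1 : q < 1) (i : Fin 2) (n : ℕ) :
    0 ≤ polyEigen q k l t i n := by
  have h1 (n : ℕ) := cEigen_le_one (l := l) (t := t) hq0 hq1 n
  have h0 := cEigen_succ_pos (l := l) (t := t) hq0 hq1 n
  unfold polyEigen
  split_ifs
  · exact pow_nonneg (div_nonneg (sub_nonneg.2 (h1 n)) (bEigen_pos hq0 n).le) _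
  · refine div_nonneg (sub_nonneg.2 (pow_le_one₀ (sub_nonneg.2 (h1 _)) ?_)) h0.le
    linarith

end eigenvalues

/-! ### The column `Ψ` in the representation -/

section column

variable {q : ℝ} {k l t : ℕ} (hq0 : 0 < q) (hq1 : q < 1) (hl : 0 < l) (hkl : Nat.Coprime k l)
  (ht : t < l)

theorem lineRep_bElt_e (n : ℕ) :
    lineRep hq0 hq1 hl hkl ht (bElt q k l) (e n) = (bEigen q l t n : ℂ) • e n := by
  rw [(isPi_lineRep hq0 hq1 hl hkl ht).map_b, bEigen]
  congr 2
  rw [← pow_add]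
  congr 1
  ring

theorem lineRep_aeval_bElt_e (p : ℂ[X]) (n : ℕ) :
    lineRep hq0 hq1 hl hkl ht (aeval (bElt q k l) p) (e n) =
      p.eval (bEigen q l t n : ℂ) • e n := by
  rw [← aeval_algHom_apply]
  exact aeval_apply_of_apply_eq (lineRep_bElt_e hq0 hq1 hl hkl ht n) p

theorem lineRep_cElt_e (n : ℕ) :
    lineRep hq0 hq1 hl hkl ht (cElt q k l) (e n) = (cEigen q l t (n + 1) : ℂ) • e n := by
  rw [cElt_eq, lineRep_aeval_bElt_e, eval_upperPoly_bEigen]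

theorem lineRep_polyElt_e (i : Fin 2) (n : ℕ) :
    lineRep hq0 hq1 hl hkl ht (polyElt q k l i) (e n) = (polyEigen q k l t i n : ℂ) • e n := by
  fin_cases i
  · change lineRep hq0 hq1 hl hkl ht (aeval (bElt q k l) (polyF q l) ^ k) (e n) = _
    rw [← map_pow, lineRep_aeval_bElt_e, eval_pow, eval_polyF_bEigen hq0 ht, polyEigen]
    simp
  · change lineRep hq0 hq1 hl hkl ht (aeval (cElt q k l) (polyG k)) (e n) = _
    rw [← aeval_algHom_apply]
    refine (aeval_apply_of_apply_eq (lineRep_cElt_e hq0 hq1 hl hkl ht n) _).trans ?_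
    rw [eval_polyG (cEigen_succ_pos hq0 hq1 n).ne', polyEigen]
    simp

theorem lineRep_polyElt_nonneg (i : Fin 2) :
    0 ≤ lineRep hq0 hq1 hl hkl ht (polyElt q k l i) :=
  nonneg_of_apply_e_eq (polyEigen_nonneg hq0 hq1 i) (lineRep_polyElt_e hq0 hq1 hl hkl ht i)

variable (k t) in
/-- The operators `z₁ ^ k` and `z₀ ^ l` on the span of the `e_{lp+t}`. -/
def lineOp (i : Fin 2) : Ell2 →L[ℂ] Ell2 :=
  compress (lineEmb hl t) (sphereRep hq0 hq1 (lineElt q k l i))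

/-- Although `z₁ ^ k` and `z₀ ^ l` lie outside the line algebra, they and their adjoints preserve
the span of the `e_{lp+t}`, so compression is multiplicative on these products. -/
theorem lineRep_sandwich (i j : Fin 2) (x : OW q k l) :
    lineRep hq0 hq1 hl hkl ht (sandwich q k l i j x) =
      lineOp k t hq0 hq1 hl i * lineRep hq0 hq1 hl hkl ht x * star (lineOp k t hq0 hq1 hl j) := by
  rw [lineRep_apply]
  change compress _ (sphereRep hq0 hq1 (lineElt q k l i * (x : OSphere q) *
    star (lineElt q k l j))) = _
  rw [map_mul, map_mul, map_star, compress_mul (star_lineEmb_mul hl)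
    (commute_star (commute_sphereRep_lineElt hq0 hq1 hl ht j)), compress_mul (star_lineEmb_mul hl)
    (commute_sphereRep hq0 hq1 hl hkl ht x), ← star_compress]
  rfl

theorem lineOp_mul_star (i : Fin 2) :
    lineOp k t hq0 hq1 hl i * star (lineOp k t hq0 hq1 hl i) =
      lineRep hq0 hq1 hl hkl ht (sandwich q k l i i 1) := by
  rw [lineRep_sandwich, map_one, mul_one]

theorem star_lineOp_mul_lineRep_mul (i : Fin 2) (x : OW q k l) :
    star (lineOp k t hq0 hq1 hl i) * lineRep hq0 hq1 hl hkl ht x * lineOp k t hq0 hq1 hl i =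
      compress (lineEmb hl t)
        (sphereRep hq0 hq1 (star (lineElt q k l i) * (x : OSphere q) * lineElt q k l i)) := by
  rw [map_mul, map_mul, map_star, compress_mul (star_lineEmb_mul hl)
    (commute_sphereRep_lineElt hq0 hq1 hl ht i), compress_mul (star_lineEmb_mul hl)
    (commute_sphereRep hq0 hq1 hl hkl ht x), ← star_compress]
  rfl

theorem sum_star_lineOp_mul :
    star (lineOp k t hq0 hq1 hl 0) * lineRep hq0 hq1 hl hkl ht (polyElt q k l 0) *
        lineOp k t hq0 hq1 hl 0 +
      star (lineOp k t hq0 hq1 hl 1) * lineRep hq0 hq1 hl hkl ht (polyElt q k l 1) *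
        lineOp k t hq0 hq1 hl 1 = 1 := by
  rw [star_lineOp_mul_lineRep_mul, star_lineOp_mul_lineRep_mul, ← compress_add, ← map_add,
    sum_star_lineElt_mul hq0.ne', map_one, compress_one (star_lineEmb_mul hl)]

theorem summable_pow_linear (hq0 : 0 < q) (hq1 : q < 1) (hl : 0 < l) {c : ℕ} (hc : 0 < c) (d : ℕ) :
    Summable fun n : ℕ => q ^ (c * (l * n + d)) := by
  have h : Summable fun n : ℕ => q ^ (c * d) * (q ^ (c * l)) ^ n :=
    (summable_geometric_of_lt_one (pow_nonneg hq0.le _)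
      (pow_lt_one₀ hq0.le hq1 (mul_pos hc hl).ne')).mul_left _
  refine h.congr fun n => ?_
  rw [← pow_mul, ← pow_add]
  congr 1
  ring

theorem isNuclear_of_apply_e_eq {T : Ell2 →L[ℂ] Ell2} {d : ℕ → ℝ} (hd : Summable d)
    (h : ∀ n, T (e n) = (d n : ℂ) • e n) : IsNuclear T :=
  (hasTrace_of_apply_e_eq (Complex.ofRealCLM.hasSum hd.hasSum) h).isNuclear

theorem isNuclear_lineOp_zero (hk : 0 < k) : IsNuclear (lineOp k t hq0 hq1 hl 0) := by
  refine isNuclear_of_apply_e_eq (summable_pow_linear hq0 hq1 hl hk (t + 1)) fun n => ?_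
  have h : sphereRep hq0 hq1 (lineElt q k l 0) = opZ1 hq0 hq1 ^ k := by
    simp [lineElt, sphereRep_z1]
  rw [lineOp, h, compress, mul_apply_eq_comp, mul_apply_eq_comp, lineEmb_e, opZ1_pow_e, map_smul,
    star_lineEmb_e, add_assoc]

/-- For `a` the factor `(z₁*) ^ k` is nuclear, for `b` the eigenvalues are geometric. Products
follow from `xy - ε(xy) = (x - ε(x)) y + ε(x) (y - ε(y))`. -/
theorem isNuclear_lineRep_sub_counit (hk : 0 < k) (x : OW q k l) :
    IsNuclear (lineRep hq0 hq1 hl hkl ht x - counit q k l x • (1 : Ell2 →L[ℂ] Ell2)) := by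
  have hx : x ∈ StarAlgebra.adjoin ℂ {aElt q k l, bElt q k l} := by
    rw [adjoin_aElt_bElt hq0.ne' hl hkl]; trivial
  induction hx using StarAlgebra.adjoin_induction with
  | mem x hx =>
    obtain rfl | rfl := hx
    · have h : aElt q k l = sandwich q k l 1 0 1 := by
        refine Subtype.ext ?_
        simp [aElt, sandwich, lineElt]
      rw [counit_aElt hk, zero_smul, sub_zero, h, lineRep_sandwich, map_one, mul_one]
      exact (isNuclear_lineOp_zero hq0 hq1 hl hk).star.comp_left _
    · rw [counit_bElt, zero_smul, sub_zero]
      refine isNuclear_of_apply_e_eq ?_ (lineRep_bElt_e hq0 hq1 hl hkl ht)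
      exact summable_pow_linear hq0 hq1 hl two_pos (t + 1)
  | algebraMap c =>
    rw [AlgHomClass.commutes, AlgHomClass.commutes, Algebra.algebraMap_eq_smul_one]
    simpa using isNuclear_zero
  | add x y _ _ hx hy =>
    rw [map_add, map_add, add_smul, add_sub_add_comm]
    exact hx.add hy
  | mul x y _ _ hx hy =>
    have h : lineRep hq0 hq1 hl hkl ht (x * y) - counit q k l (x * y) • (1 : Ell2 →L[ℂ] Ell2) =
        (lineRep hq0 hq1 hl hkl ht x - counit q k l x • 1) ∘L lineRep hq0 hq1 hl hkl ht y +
        counit q k l x • (lineRep hq0 hq1 hl hkl ht y - counit q k l y • 1) := by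
      change _ = (lineRep hq0 hq1 hl hkl ht x - counit q k l x • 1) * lineRep hq0 hq1 hl hkl ht y +
        _
      rw [map_mul, map_mul, sub_mul, smul_mul_assoc, one_mul, smul_sub, smul_smul]
      abel
    rw [h]
    exact (hx.comp (.id ℂ _) _).add (hy.smul _)
  | star x _ hx =>
    have h := hx.star
    rwa [star_sub, star_smul, star_one, ← map_star, ← map_star] at h

/-- The column `Ψ` in the representation. -/
def column (i : Fin 2) : Ell2 →L[ℂ] Ell2 :=
  extend (lineRep hq0 hq1 hl hkl ht) (ξ q k l i) * lineOp k t hq0 hq1 hl i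

theorem extend_lineRep_ξ_mul_self (hA : ∀ x : OW q k l, IsBoundedElt x) (i : Fin 2) :
    extend (lineRep hq0 hq1 hl hkl ht) (ξ q k l i) *
      extend (lineRep hq0 hq1 hl hkl ht) (ξ q k l i) =
      lineRep hq0 hq1 hl hkl ht (polyElt q k l i) := by
  rw [ξ_eq, extend_cfc_sqrt_mul_self _ (isSelfAdjoint_toEnv_polyElt hA i), extend_toEnv _ (hA _)]
  rw [extend_toEnv _ (hA _)]
  exact lineRep_polyElt_nonneg hq0 hq1 hl hkl ht i

theorem extend_lineRep_ξ_e (hA : ∀ x : OW q k l, IsBoundedElt x) (i : Fin 2) (n : ℕ) :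
    extend (lineRep hq0 hq1 hl hkl ht) (ξ q k l i) (e n) =
      (√(polyEigen q k l t i n) : ℂ) • e n := by
  rw [ξ_eq]
  refine extend_cfc_apply _ (isSelfAdjoint_toEnv_polyElt hA i) Real.continuous_sqrt ?_
  rw [extend_toEnv _ (hA _)]
  exact lineRep_polyElt_e hq0 hq1 hl hkl ht i n

theorem star_extend_ξ {H : Type} [NormedAddCommGroup H] [InnerProductSpace ℂ H] [CompleteSpace H]
    [Nontrivial H] (π : OW q k l →⋆ₐ[ℂ] (H →L[ℂ] H)) (i : Fin 2) :
    star (extend π (ξ q k l i)) = extend π (ξ q k l i) := by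
  rw [ξ_eq, star_extend_cfc]

theorem star_column_mul (hA : ∀ x : OW q k l, IsBoundedElt x) :
    star (column hq0 hq1 hl hkl ht 0) * column hq0 hq1 hl hkl ht 0 +
      star (column hq0 hq1 hl hkl ht 1) * column hq0 hq1 hl hkl ht 1 = 1 := by
  rw [← sum_star_lineOp_mul hq0 hq1 hl hkl ht]
  simp only [← extend_lineRep_ξ_mul_self hq0 hq1 hl hkl ht hA, column, star_mul, star_extend_ξ,
    mul_assoc]

theorem column_mul_star_e (hA : ∀ x : OW q k l, IsBoundedElt x) (i : Fin 2) {n : ℕ} {d : ℝ}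
    (h : lineRep hq0 hq1 hl hkl ht (sandwich q k l i i 1) (e n) = (d : ℂ) • e n) :
    (column hq0 hq1 hl hkl ht i * star (column hq0 hq1 hl hkl ht i)) (e n) =
      ((polyEigen q k l t i n * d : ℝ) : ℂ) • e n := by
  have h1 : column hq0 hq1 hl hkl ht i * star (column hq0 hq1 hl hkl ht i) =
      extend (lineRep hq0 hq1 hl hkl ht) (ξ q k l i) *
        lineRep hq0 hq1 hl hkl ht (sandwich q k l i i 1) *
        extend (lineRep hq0 hq1 hl hkl ht) (ξ q k l i) := by
    rw [← lineOp_mul_star, column, star_mul, star_extend_ξ]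
    simp only [mul_assoc]
  rw [h1, mul_apply_eq_comp, mul_apply_eq_comp, extend_lineRep_ξ_e _ _ _ _ _ hA, map_smul, h,
    map_smul, map_smul, extend_lineRep_ξ_e _ _ _ _ _ hA, smul_smul, smul_smul]
  congr 1
  rw [mul_right_comm, ← Complex.ofReal_mul, Real.mul_self_sqrt (polyEigen_nonneg hq0 hq1 i n),
    Complex.ofReal_mul]

theorem column_zero_mul_star_e (hA : ∀ x : OW q k l, IsBoundedElt x) (n : ℕ) :
    (column hq0 hq1 hl hkl ht 0 * star (column hq0 hq1 hl hkl ht 0)) (e n) =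
      (((1 - cEigen q l t n) ^ k : ℝ) : ℂ) • e n := by
  have h1 : sandwich q k l 0 0 1 = bElt q k l ^ k := by
    refine Subtype.ext ?_
    change z₁ q ^ k * 1 * star (z₁ q ^ k) = bS q ^ k
    rw [mul_one, star_pow, z1_pow_mul_z1s_pow]
  rw [column_mul_star_e hq0 hq1 hl hkl ht hA 0 (d := bEigen q l t n ^ k), polyEigen, if_pos rfl,
    ← mul_pow, div_mul_cancel₀ _ (bEigen_pos hq0 n).ne']
  have := lineRep_aeval_bElt_e hq0 hq1 hl hkl ht (X ^ k) n
  rw [map_pow, aeval_X, eval_pow, eval_X] at this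
  rw [h1, this]
  push_cast
  rfl

theorem column_one_mul_star_e (hA : ∀ x : OW q k l, IsBoundedElt x) (n : ℕ) :
    (column hq0 hq1 hl hkl ht 1 * star (column hq0 hq1 hl hkl ht 1)) (e n) =
      ((1 - (1 - cEigen q l t (n + 1)) ^ k : ℝ) : ℂ) • e n := by
  have h1 : sandwich q k l 1 1 1 = cElt q k l := by
    refine Subtype.ext ?_
    change z₀ q ^ l * 1 * star (z₀ q ^ l) = z₀ q ^ l * star (z₀ q) ^ l
    rw [mul_one, star_pow]
  rw [column_mul_star_e hq0 hq1 hl hkl ht hA 1 (d := cEigen q l t (n + 1)), polyEigen,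
    if_neg one_ne_zero, div_mul_cancel₀ _ (cEigen_succ_pos hq0 hq1 n).ne']
  rw [h1, lineRep_cElt_e]

theorem isNuclear_column_zero (hk : 0 < k) : IsNuclear (column hq0 hq1 hl hkl ht 0) :=
  (isNuclear_lineOp_zero hq0 hq1 hl hk).comp_left _

/-- The two diagonals are `(1 - c n) ^ k` and `-(1 - c (n + 1)) ^ k`. Nuclearity of the first entry
makes the series converge, and the sum of the traces is the single term `(1 - c 0) ^ k = 1`. -/
theorem exists_hasTrace_column (hA : ∀ x : OW q k l, IsBoundedElt x) (hk : 0 < k) : ∃ t₀ t₁ : ℂ,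
    HasTrace (column hq0 hq1 hl hkl ht 0 * star (column hq0 hq1 hl hkl ht 0)) t₀ ∧
    HasTrace (column hq0 hq1 hl hkl ht 1 * star (column hq0 hq1 hl hkl ht 1) - 1) t₁ ∧
    t₀ + t₁ = 1 := by
  have h0 : IsNuclear (column hq0 hq1 hl hkl ht 0 * star (column hq0 hq1 hl hkl ht 0)) :=
    (isNuclear_column_zero hq0 hq1 hl hkl ht hk).comp (.id ℂ _) _
  obtain ⟨t₀, h0⟩ := h0.hasTrace
  have hs := h0.hasSum_of_apply_e_eq (column_zero_mul_star_e hq0 hq1 hl hkl ht hA)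
  -- Dropping the term `n = 0` and changing the sign gives the diagonal of the second operator.
  have hs1 := ((hasSum_nat_add_iff' 1).2 hs).neg
  refine ⟨t₀, _, h0, hasTrace_of_apply_e_eq hs1 fun n => ?_, ?_⟩
  · rw [sub_apply, column_one_mul_star_e _ _ _ _ _ hA, one_apply_eq_self]
    nth_rw 2 [← one_smul ℂ (e n)]
    rw [← sub_smul]
    congr 1
    push_cast
    ring
  · simp [cEigen]

end column

end QuantumWPL

namespace QuantumWPL

/-! ### Even Fredholm modules in block form -/

section evenDatum

variable {B : Type 1} [NonUnitalRing B] [StarRing B] [Module ℂ B]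
  {E : Type} [NormedAddCommGroup E] [InnerProductSpace ℂ E] [CompleteSpace E]

/-- The Fredholm datum on `E₊ ⊕ E₋` with representation `f ⊕ g`. -/
def evenDatum (f g : B →⋆ₙₐ[ℂ] (E →L[ℂ] E)) : FredholmDatum B :=
  ⟨Two E, diagHom f g, flipOp E, gradingOp E⟩

variable (f g : B →⋆ₙₐ[ℂ] (E →L[ℂ] E))

theorem evenDatum_comm (b : B) : (evenDatum f g).comm b =
    blockOp !![0, -(f b - g b); f b - g b, 0] := by
  have h : flipOp E * diagHom f g b - diagHom f g b * flipOp E =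
      blockOp !![0, -(f b - g b); f b - g b, 0] := by
    rw [flipOp, diagHom_apply, blockOp_mul, blockOp_mul, blockOp_sub]
    congr 1
    ext1 i j
    fin_cases i <;> fin_cases j <;> simp
  exact h

/-- The signs from `γ` and `F` make both diagonal entries agree, so the factor `1/2` in the pairing
leaves `Tr (f b - g b)`. -/
theorem evenDatum_pairingOp (b : B) : (evenDatum f g).pairingOp b =
    blockOp !![f b - g b, 0; 0, f b - g b] := by
  have h : gradingOp E * flipOp E * blockOp !![0, -(f b - g b); f b - g b, 0] =
      blockOp !![f b - g b, 0; 0, f b - g b] := by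
    rw [gradingOp, flipOp, blockOp_mul, blockOp_mul]
    simp
  rw [← evenDatum_comm f g b] at h
  exact h

variable (E) in
theorem star_flipOp : star (flipOp E) = flipOp E := by
  rw [flipOp, star_blockOp]
  congr 1
  ext1 i j
  fin_cases i <;> fin_cases j <;> simp [Matrix.star_apply]

variable (E) in
theorem star_gradingOp : star (gradingOp E) = gradingOp E := by
  rw [gradingOp, star_blockOp]
  congr 1
  ext1 i j
  fin_cases i <;> fin_cases j <;> simp [Matrix.star_apply]

variable (E) in
theorem flipOp_mul_self : flipOp E * flipOp E = 1 := by
  rw [flipOp, blockOp_mul, ← blockOp_one, Matrix.one_fin_two]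
  simp

variable (E) in
theorem gradingOp_mul_self : gradingOp E * gradingOp E = 1 := by
  rw [gradingOp, blockOp_mul, ← blockOp_one, Matrix.one_fin_two]
  simp

theorem gradingOp_mul_diagHom (b : B) :
    gradingOp E * diagHom f g b = diagHom f g b * gradingOp E := by
  rw [gradingOp, diagHom_apply, blockOp_mul, blockOp_mul]
  simp

variable (E) in
theorem gradingOp_mul_flipOp_add : gradingOp E * flipOp E + flipOp E * gradingOp E = 0 := by
  rw [gradingOp, flipOp, blockOp_mul, blockOp_mul, blockOp_add, ← blockOp_zero]
  congr 1
  ext1 i j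
  fin_cases i <;> fin_cases j <;> simp

theorem isNuclear_evenDatum_comm {b : B} (h : IsNuclear (f b - g b)) :
    IsNuclear ((evenDatum f g).comm b) := by
  rw [evenDatum_comm]
  exact isNuclear_blockOp isNuclear_zero h.neg h isNuclear_zero

theorem hasTrace_evenDatum_pairingOp {b : B} {t : ℂ} (h : HasTrace (f b - g b) t) :
    HasTrace ((evenDatum f g).pairingOp b) (t + t) := by
  rw [evenDatum_pairingOp]
  exact hasTrace_blockOp h isNuclear_zero isNuclear_zero h

theorem isTraceClass_evenDatum_comm {b : B} (h : IsNuclear (f b - g b)) :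
    IsTraceClass ((evenDatum f g).comm b) :=
  (isNuclear_evenDatum_comm f g h).isTraceClass

theorem isTraceClass_evenDatum_pairingOp {b : B} {t : ℂ} (h : HasTrace (f b - g b) t) :
    IsTraceClass ((evenDatum f g).pairingOp b) :=
  (hasTrace_evenDatum_pairingOp f g h).isNuclear.isTraceClass

theorem evenDatum_indexPairing {b : B} {t : ℂ} (h : HasTrace (f b - g b) t) :
    (evenDatum f g).indexPairing b = t := by
  rw [FredholmDatum.indexPairing, (hasTrace_evenDatum_pairingOp f g h).opTrace_eq]
  ring

theorem isEvenFredholm_evenDatum (h : ∀ b, IsCompactOperator ((evenDatum f g).comm b)) :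
    (evenDatum f g).IsEvenFredholm where
  F_selfAdjoint := star_flipOp E
  F_sq := flipOp_mul_self E
  γ_selfAdjoint := star_gradingOp E
  γ_sq := gradingOp_mul_self E
  γ_comm := gradingOp_mul_diagHom f g
  anticomm := gradingOp_mul_flipOp_add E
  compact := h

end evenDatum

/-! ### The Fredholm modules -/

section fredholm

theorem continuous_nonUnitalStarAlgHom {A B : Type*} [CStarAlgebra A] [CStarAlgebra B]
    (φ : A →⋆ₙₐ[ℂ] B) : Continuous φ :=
  AddMonoidHomClass.continuous_of_bound φ 1 fun x => by
    simpa using NonUnitalStarAlgHom.norm_apply_le φ x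

variable {q : ℝ} {k l : ℕ}

/-- Nuclearity is available only on the coordinate algebra. Its image is dense, and compactness,
unlike nuclearity, passes to norm limits. -/
theorem isCompactOperator_of_toEnv {E : Type} [NormedAddCommGroup E] [InnerProductSpace ℂ E]
    [CompleteSpace E] (hA : ∀ x : OW q k l, IsBoundedElt x) {φ : CW q k l → E →L[ℂ] E}
    (hφ : Continuous φ) (h : ∀ x, IsNuclear (φ (toEnv x))) (y : CW q k l) :
    IsCompactOperator (φ y) :=
  (denseRange_toEnv hA).induction_on (p := fun y => IsCompactOperator (φ y)) y
    (isClosed_setOfPred_isCompactOperator.preimage hφ) fun x => (h x).isCompactOperator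

variable {t : ℕ} (hq0 : 0 < q) (hq1 : q < 1) (hl : 0 < l) (hkl : Nat.Coprime k l)
  (ht : t < l) (hA : ∀ x : OW q k l, IsBoundedElt x)

/-- The representation `x ↦ π_s(Ψ x Ψ*)`. -/
def columnHom : CW q k l →⋆ₙₐ[ℂ] (Two Ell2 →L[ℂ] Two Ell2) :=
  (conjBlock (column hq0 hq1 hl hkl ht) (star_column_mul hq0 hq1 hl hkl ht hA)).comp
    (extend (lineRep hq0 hq1 hl hkl ht)).toNonUnitalStarAlgHom

variable (q k l) in
/-- The representation `x ↦ ε(Ψ x Ψ*)`. -/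
def counitHom : CW q k l →⋆ₙₐ[ℂ] (Two Ell2 →L[ℂ] Two Ell2) :=
  -- The column `(0, 1)` is the image of `Ψ` under the counit, since `ε(z₁) = 0`, `ε(z₀) = 1` and
  -- `ε(ξ₀) = 1`.
  (conjBlock ![0, 1] (by simp)).comp
    (extend (scalarRep (counit q k l) Ell2)).toNonUnitalStarAlgHom

theorem columnHom_apply (y : CW q k l) : columnHom hq0 hq1 hl hkl ht hA y =
    blockOp (Matrix.of fun i j => column hq0 hq1 hl hkl ht i *
      extend (lineRep hq0 hq1 hl hkl ht) y * star (column hq0 hq1 hl hkl ht j)) := rfl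

theorem counitHom_apply (y : CW q k l) : counitHom q k l y =
    blockOp !![0, 0; 0, extend (scalarRep (counit q k l) Ell2) y] := by
  change blockOp _ = _
  congr 1
  ext1 i j
  fin_cases i <;> fin_cases j <;> simp

/-- The representation `ρ_s`. -/
def rhoHom : CW q k l →⋆ₙₐ[ℂ] (Two (Two Ell2) →L[ℂ] Two (Two Ell2)) :=
  diagHom (columnHom hq0 hq1 hl hkl ht hA) (counitHom q k l)

theorem isRho_rhoHom (hk : 0 < k) :
    IsRho q k l (lineRep hq0 hq1 hl hkl ht) (rhoHom hq0 hq1 hl hkl ht hA) := by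
  intro x
  have h1 : columnHom hq0 hq1 hl hkl ht hA (toEnv x) =
      blockOp ((twist q k l x).map (extend (lineRep hq0 hq1 hl hkl ht))) := by
    rw [columnHom_apply]
    congr 1
    ext1 i j
    simp only [Matrix.of_apply, Matrix.map_apply, twist, map_mul, extend_toEnv _ (hA _), column,
      star_mul, star_extend_ξ, lineRep_sandwich, mul_assoc]
  have h2 : counitHom q k l (toEnv x) =
      blockOp ((twist q k l x).map (extend (scalarRep (counit q k l) Ell2))) := by
    rw [counitHom_apply]
    congr 1
    ext1 i j
    simp only [Matrix.map_apply, twist, Matrix.of_apply, map_mul, extend_scalarRep_toEnv hA,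
      counit_sandwich hk]
    fin_cases i <;> fin_cases j <;> simp [extend_scalarRep_ξ_one hA hk]
  rw [rhoHom, diagHom_apply, h1, h2]
  rfl

theorem IsRho.ext (hA : ∀ x : OW q k l, IsBoundedElt x)
    {π : OW q k l →⋆ₐ[ℂ] (Ell2 →L[ℂ] Ell2)}
    {ρ ρ' : CW q k l →⋆ₙₐ[ℂ] (Two (Two Ell2) →L[ℂ] Two (Two Ell2))}
    (h : IsRho q k l π ρ) (h' : IsRho q k l π ρ') : ρ = ρ' :=
  DFunLike.coe_injective <| (denseRange_toEnv hA).equalizer (continuous_nonUnitalStarAlgHom ρ)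
    (continuous_nonUnitalStarAlgHom ρ') <| funext fun x => (h x).trans (h' x).symm

theorem columnHom_sub_counitHom (y : CW q k l) :
    columnHom hq0 hq1 hl hkl ht hA y - counitHom q k l y =
      blockOp !![column hq0 hq1 hl hkl ht 0 * extend (lineRep hq0 hq1 hl hkl ht) y *
          star (column hq0 hq1 hl hkl ht 0),
        column hq0 hq1 hl hkl ht 0 * extend (lineRep hq0 hq1 hl hkl ht) y *
          star (column hq0 hq1 hl hkl ht 1);
        column hq0 hq1 hl hkl ht 1 * extend (lineRep hq0 hq1 hl hkl ht) y *
          star (column hq0 hq1 hl hkl ht 0),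
        column hq0 hq1 hl hkl ht 1 * extend (lineRep hq0 hq1 hl hkl ht) y *
          star (column hq0 hq1 hl hkl ht 1) - extend (scalarRep (counit q k l) Ell2) y] := by
  rw [columnHom_apply, counitHom_apply, blockOp_sub]
  congr 1
  ext1 i j
  fin_cases i <;> fin_cases j <;> simp

theorem isNuclear_columnHom_sub (hk : 0 < k) (x : OW q k l) :
    IsNuclear (columnHom hq0 hq1 hl hkl ht hA (toEnv x) - counitHom q k l (toEnv x)) := by
  have h0 := isNuclear_column_zero hq0 hq1 hl hkl ht hk
  obtain ⟨t₀, t₁, -, h1, -⟩ := exists_hasTrace_column hq0 hq1 hl hkl ht hA hk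
  rw [columnHom_sub_counitHom, extend_toEnv _ (hA x), extend_scalarRep_toEnv hA]
  refine isNuclear_blockOp ?_ ?_ ?_ ?_
  · exact h0.comp (.id ℂ _) (lineRep hq0 hq1 hl hkl ht x ∘L star (column hq0 hq1 hl hkl ht 0))
  · exact h0.comp (.id ℂ _) (lineRep hq0 hq1 hl hkl ht x ∘L star (column hq0 hq1 hl hkl ht 1))
  · exact h0.star.comp_left _
  -- The only corner without a nuclear factor: replace `π_s(x)` by `ε(x)` inside, then `V₁ V₁*` by
  -- `1`, each at a nuclear cost.
  · have h2 : column hq0 hq1 hl hkl ht 1 * lineRep hq0 hq1 hl hkl ht x *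
          star (column hq0 hq1 hl hkl ht 1) - counit q k l x • (1 : Ell2 →L[ℂ] Ell2) =
        column hq0 hq1 hl hkl ht 1 * ((lineRep hq0 hq1 hl hkl ht x - counit q k l x • 1) *
          star (column hq0 hq1 hl hkl ht 1)) + counit q k l x •
          (column hq0 hq1 hl hkl ht 1 * star (column hq0 hq1 hl hkl ht 1) - 1) := by
      rw [sub_mul, mul_sub, smul_mul_assoc, one_mul, mul_smul_comm, smul_sub, mul_assoc]
      abel
    rw [h2]
    exact ((isNuclear_lineRep_sub_counit hq0 hq1 hl hkl ht hk x).comp _ _).add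
      (h1.isNuclear.smul _)

theorem hasTrace_columnHom_sub_one (hk : 0 < k) :
    HasTrace (columnHom hq0 hq1 hl hkl ht hA 1 - counitHom q k l 1) 1 := by
  have h0 := isNuclear_column_zero hq0 hq1 hl hkl ht hk
  obtain ⟨t₀, t₁, h1, h2, h3⟩ := exists_hasTrace_column hq0 hq1 hl hkl ht hA hk
  rw [columnHom_sub_counitHom, map_one, map_one, ← h3]
  simp only [mul_one]
  exact hasTrace_blockOp h1 (h0.comp (.id ℂ _) _) (h0.star.comp_left _) h2

theorem isCompactOperator_extend_sub (hA : ∀ x : OW q k l, IsBoundedElt x) (hk : 0 < k)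
    (y : CW q k l) : IsCompactOperator (extend (lineRep hq0 hq1 hl hkl ht) y -
      extend (scalarRep (counit q k l) Ell2) y : Ell2 →L[ℂ] Ell2) := by
  refine isCompactOperator_of_toEnv hA
    (φ := fun y => extend (lineRep hq0 hq1 hl hkl ht) y - extend (scalarRep (counit q k l) Ell2) y)
    ((continuous_extend _).sub (continuous_extend _)) (fun x => ?_) y
  rw [extend_toEnv _ (hA x), extend_scalarRep_toEnv hA]
  exact isNuclear_lineRep_sub_counit hq0 hq1 hl hkl ht hk x

theorem isNuclear_e₀₀ : IsNuclear e₀₀ := by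
  rw [e₀₀_eq]
  exact (hasTrace_rankOne _ _).isNuclear

/-- `IsProj` prescribes only the images under the `π_s`. Already `π_1(p)` is compact and differs
from `ε(p) • 1` by a compact operator, while nonzero scalars are not compact on an
infinite-dimensional space. -/
theorem IsProj.counit_eq_zero (hq0 : 0 < q) (hq1 : q < 1) (hk : 0 < k) (hl : 0 < l)
    (hkl : Nat.Coprime k l) {π : ℕ → OW q k l →⋆ₐ[ℂ] (Ell2 →L[ℂ] Ell2)}
    (hπ : ∀ s, 1 ≤ s → s ≤ l → IsPi q k l s (π s)) {r : ℕ} {p : CW q k l}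
    (hp : IsProj q k l π r p) : extend (scalarRep (counit q k l) ℂ) p (1 : ℂ) = 0 := by
  have hA := isBoundedElt_OW hq0 hq1 hl hkl
  by_contra hne
  refine not_isCompactOperator_smul_one hne ?_
  rw [← extend_scalarRep_eq hA]
  have h1 := isCompactOperator_extend_sub hq0 hq1 hl hkl hl hA hk p
  have h2 : IsCompactOperator (extend (lineRep hq0 hq1 hl hkl hl) p) := by
    rw [← (hπ 1 le_rfl hl).ext hq0 hl hkl (isPi_lineRep hq0 hq1 hl hkl hl), hp.map_eq 1 le_rfl hl]
    split_ifs
    · exact isNuclear_e₀₀.isCompactOperator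
    · exact isNuclear_zero.isCompactOperator
  simpa using h2.sub h1

/-- The counit part vanishes, and conjugation by the isometric column preserves the trace of
`π_s(p)`, which is `e₀₀` or `0`. -/
theorem hasTrace_columnHom_sub (hk : 0 < k) {π : ℕ → OW q k l →⋆ₐ[ℂ] (Ell2 →L[ℂ] Ell2)}
    (hπ : ∀ s, 1 ≤ s → s ≤ l → IsPi q k l s (π s)) {r : ℕ} {p : CW q k l}
    (hp : IsProj q k l π r p) :
    HasTrace (columnHom hq0 hq1 hl hkl ht hA p - counitHom q k l p)
      (if t + 1 = r then 1 else 0) := by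
  have h1 : counitHom q k l p = 0 := by
    rw [counitHom_apply, extend_scalarRep_eq hA, hp.counit_eq_zero hq0 hq1 hk hl hkl hπ,
      zero_smul, ← blockOp_zero]
    congr 1
    ext1 i j
    fin_cases i <;> fin_cases j <;> rfl
  rw [h1, sub_zero]
  refine hasTrace_conjBlock (star_column_mul hq0 hq1 hl hkl ht hA) ?_
  change HasTrace (extend (lineRep hq0 hq1 hl hkl ht) p) _
  rw [← (hπ (t + 1) (by lia) ht).ext hq0 hl hkl (isPi_lineRep hq0 hq1 hl hkl ht),
    hp.map_eq (t + 1) (by lia) ht]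
  split_ifs
  · rw [e₀₀_eq]
    simpa [norm_e] using hasTrace_rankOne (e 0) (e 0)
  · exact hasTrace_zero

theorem hasTrace_complex (T : ℂ →L[ℂ] ℂ) : HasTrace T (T 1) := by
  have h : T = InnerProductSpace.rankOne ℂ (T 1) (1 : ℂ) := by
    ext
    simp
  have := hasTrace_rankOne (T 1) (1 : ℂ)
  rw [← h] at this
  simpa using this

theorem isEvenFredholm_and_pairing {E : Type} [NormedAddCommGroup E] [InnerProductSpace ℂ E]
    [CompleteSpace E] (hA : ∀ x : OW q k l, IsBoundedElt x)
    (f g : CW q k l →⋆ₙₐ[ℂ] (E →L[ℂ] E)) (h : ∀ x, IsNuclear (f (toEnv x) - g (toEnv x)))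
    {p : ℕ → CW q k l} {c : ℕ → ℂ} (hp : ∀ r ≤ l, HasTrace (f (p r) - g (p r)) (c r)) :
    (evenDatum f g).IsEvenFredholm ∧
      (∀ x : OW q k l, IsTraceClass ((evenDatum f g).comm (toEnv x))) ∧
      ∀ r ≤ l, IsTraceClass ((evenDatum f g).pairingOp (p r)) ∧
        (evenDatum f g).indexPairing (p r) = c r := by
  refine ⟨isEvenFredholm_evenDatum f g ?_, fun x => isTraceClass_evenDatum_comm f g (h x),
    fun r hr => ⟨isTraceClass_evenDatum_pairingOp f g (hp r hr),
      evenDatum_indexPairing f g (hp r hr)⟩⟩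
  refine isCompactOperator_of_toEnv (E := Two E) hA (φ := (evenDatum f g).comm) ?_ fun x =>
    isNuclear_evenDatum_comm f g (h x)
  have hc := continuous_nonUnitalStarAlgHom (diagHom f g)
  change Continuous fun b => flipOp E * diagHom f g b - diagHom f g b * flipOp E
  exact (continuous_const.mul hc).sub (hc.mul continuous_const)

theorem fredholm_zero (ρ : ℕ → CW q k l →⋆ₙₐ[ℂ] (Two (Two Ell2) →L[ℂ] Two (Two Ell2))) :
    fredholm q k l ρ 0 =
      evenDatum (extend (scalarRep (counit q k l) ℂ)).toNonUnitalStarAlgHom 0 := rfl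

theorem fredholm_succ {ρ : ℕ → CW q k l →⋆ₙₐ[ℂ] (Two (Two Ell2) →L[ℂ] Two (Two Ell2))}
    (h : ρ (t + 1) = rhoHom hq0 hq1 hl hkl ht hA) :
    fredholm q k l ρ (t + 1) = evenDatum (columnHom hq0 hq1 hl hkl ht hA) (counitHom q k l) := by
  rw [fredholm, h]
  rfl

end fredholm

end QuantumWPL

end

/-! ### Assembly: reduction to the model representations and evaluation of the pairings. -/

theorem propositionp (q : ℝ) (hq0 : 0 < q) (hq1 : q < 1) (k l : ℕ) (hk : 0 < k) (hl : 0 < l)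
    (hkl : Nat.Coprime k l) :
    (∀ x : OW q k l, IsBoundedElt x) ∧
    (∀ s, 1 ≤ s → s ≤ l → ∃! π, IsPi q k l s π) ∧
    ∀ π : ℕ → OW q k l →⋆ₐ[ℂ] (Ell2 →L[ℂ] Ell2),
      (∀ s, 1 ≤ s → s ≤ l → IsPi q k l s (π s)) →
      (∀ r, 1 ≤ r → r ≤ l → ∃ p, IsProj q k l π r p) ∧
      (∀ s, 1 ≤ s → s ≤ l → ∃! ρ, IsRho q k l (π s) ρ) ∧
      ∀ ρ : ℕ → CW q k l →⋆ₙₐ[ℂ] (Two (Two Ell2) →L[ℂ] Two (Two Ell2)),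
        (∀ s, 1 ≤ s → s ≤ l → IsRho q k l (π s) (ρ s)) →
        ∀ p : ℕ → CW q k l, p 0 = 1 →
          (∀ r, 1 ≤ r → r ≤ l → IsProj q k l π r (p r)) →
          ∀ s ≤ l,
            (fredholm q k l ρ s).IsEvenFredholm ∧
            (∀ x : OW q k l, IsTraceClass ((fredholm q k l ρ s).comm (toEnv x))) ∧
            ∀ r ≤ l,
              IsTraceClass ((fredholm q k l ρ s).pairingOp (p r)) ∧
              (fredholm q k l ρ s).indexPairing (p r) =
                if s = r then 1 else if r = 0 then 1 else 0 := by
  have hA := isBoundedElt_OW hq0 hq1 hl hkl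
  refine ⟨hA, fun s => existsUnique_isPi hq0 hq1 hl hkl, fun π hπ =>
    ⟨fun r => exists_isProj hq0 hq1 hl hkl hπ, ?_, ?_⟩⟩
  · intro s hs hsl
    obtain ⟨t, rfl⟩ := Nat.exists_eq_add_of_le' hs
    rw [(hπ _ hs hsl).ext hq0 hl hkl (isPi_lineRep hq0 hq1 hl hkl hsl)]
    exact ⟨_, isRho_rhoHom hq0 hq1 hl hkl hsl hA hk, fun ρ hρ =>
      hρ.ext hA (isRho_rhoHom hq0 hq1 hl hkl hsl hA hk)⟩
  · intro ρ hρ p hp0 hp s hs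
    cases s with
    | zero =>
      rw [fredholm_zero]
      refine isEvenFredholm_and_pairing hA _ _ (fun x => (hasTrace_complex _).isNuclear)
        fun r hr => ?_
      convert hasTrace_complex _ using 1
      change _ = (extend (scalarRep (counit q k l) ℂ) (p r) - 0) (1 : ℂ)
      rw [sub_zero]
      rcases Nat.eq_zero_or_pos r with rfl | hr0
      · rw [hp0, map_one (extend (scalarRep (counit q k l) ℂ))]
        simp
      · rw [(hp r hr0 hr).counit_eq_zero hq0 hq1 hk hl hkl hπ, if_neg hr0.ne, if_neg hr0.ne']
    | succ t =>
      have h1 := hρ (t + 1) (by lia) hs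
      -- By uniqueness the given `π_s`, and then the given `ρ_s`, are the explicit models.
      rw [(hπ _ (by lia) hs).ext hq0 hl hkl (isPi_lineRep hq0 hq1 hl hkl hs)] at h1
      rw [fredholm_succ hq0 hq1 hl hkl hs hA (h1.ext hA (isRho_rhoHom hq0 hq1 hl hkl hs hA hk))]
      refine isEvenFredholm_and_pairing hA _ _ (isNuclear_columnHom_sub hq0 hq1 hl hkl hs hA hk)
        fun r hr => ?_
      rcases Nat.eq_zero_or_pos r with rfl | hr0
      · rw [hp0]
        simpa using hasTrace_columnHom_sub_one hq0 hq1 hl hkl hs hA hk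
      · rw [if_neg hr0.ne' (c := r = 0)]
        exact hasTrace_columnHom_sub hq0 hq1 hl hkl hs hA hk hπ (hp r hr0 hr)
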